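/- Let $(X_n)_{n\ge1}$ be real random variables on a probability space, $S_N=\sum_{n=1}^N X_n$. Suppose there are a complex Banach space $\mathcal B$, bounded linear operators $\mathcal L_t:\mathcal B\to\mathcal B$ ($t\in\mathbb R$), $v\in\mathcal B$ and $\ell\in\mathcal B'$ with $\mathbb E(e^{itS_N})=\ell(\mathcal L_t^N v)$ for all $t\in\mathbb R$ and $N\ge 1$. Let $r\ge1$ be an integer and assume: (A1) $t\mapsto\mathcal L_t$ is continuous on $\mathbb R$ (in operator norm) and, for some $\delta>0$, is $s=r+2$ times continuously differentiable on $|t|\le\delta$; (A2) $1$ is an isolated point of the spectrum of $\mathcal L_0$ and a simple eigenvalue (algebraic multiplicity one), all other eigenvalues of $\mathcal L_0$ have modulus less than $1$, and the essential spectrum of $\mathcal L_0$ (the set of $z\in\mathbb C$ with $z-\mathcal L_0$ not Fredholm) is contained in a disk $\{|z|\le\rho\}$ with $\rho<1$; (A3) for all $t\ne0$, the spectrum of $\mathcal L_t$ is contained in $\{|z|<1\}$; (A4) there are positive reals $K,r_1,r_2,N_0$ with $\|\mathcal L_t^N\|\le N^{-r_2}$ for all integers $N>N_0$ and all $t$ with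 $K\le|t|\le N^{r_1}$. Let $q\in\mathbb N$ satisfy $q>\frac{r}{2r_1}$. Let $F^q_0$ be the space of $q$ times continuously differentiable $f:\mathbb R\to\mathbb C$ with $$C^q_0(f)=\max_{0\le j\le q}\|f^{(j)}\|_{L^1}+\|f\|_{L^1}<\infty .$$ Then there are $A\in\mathbb R$ and $\sigma^2\ge0$ such that $\frac{S_N-NA}{\sqrt N}$ converges in distribution to $\mathcal N(0,\sigma^2)$. If $\sigma^2>0$, then $S_N$ admits the averaged Edgeworth expansion of order $r$ for $f\in F^q_0$: writing $\mathfrak n(y)=\frac1{\sqrt{2\pi\sigma^2}}e^{-y^2/(2\sigma^2)}$ and $\mathfrak N(z)=\int_{-\infty}^z\mathfrak n(y)\,dy$, there are real polynomials $P_1,\dots,P_r$ (independent of $f$, $z$ and $N$) such that $$\int\Big[\mathbb P\Big(\tfrac{S_N-NA}{\sqrt N}\le z+\tfrac{y}{\sqrt N}\Big)-\mathfrak N\Big(z+\tfrac{y}{\sqrt N}\Big)\Big]f(y)\,dy=\sum_{p=1}^r\frac1{N^{p/2}}\int P_p\Big(z+\tfrac{y}{\sqrt N}\Big)\,\mathfrak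 n\Big(z+\tfrac{y}{\sqrt N}\Big)f(y)\,dy+C^q_0(f)\,o\big(N^{-r/2}\big)$$ as $N\to\infty$, where the $o(N^{-r/2})$ is uniform in $f\in F^q_0$ and $z\in\mathbb R$. -/

import Mathlib

open MeasureTheory ProbabilityTheory Filter Asymptotics
open scoped NNReal ENNReal

namespace AvgEdgeworth

noncomputable section

section Operators

variable {B : Type*} [NormedAddCommGroup B] [NormedSpace ℂ B]

/-- The essential spectrum of a bounded operator `T`: the set of `z` such that `z - T` is not a
Fredholm operator. -/
def essentialSpectrum (T : B →L[ℂ] B) : Set ℂ :=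
  {z | ¬ (z • ContinuousLinearMap.id ℂ B - T).IsFredholm}

/-- Condition (A1) with `s` derivatives: the family `L` is norm continuous on `ℝ`, and `s` times
continuously differentiable on some interval `[-δ, δ]`. -/
def CondA1 (L : ℝ → B →L[ℂ] B) (s : ℕ) : Prop :=
  Continuous L ∧ ∃ δ : ℝ, 0 < δ ∧ ContDiffOn ℝ s L (Set.Icc (-δ) δ)

/-- Condition (A2), the spectral gap of `T = L 0`: `1` is an isolated point of the spectrum and an
eigenvalue of algebraic multiplicity one, all other eigenvalues have modulus less than `1`, and the
essential spectrum is contained in a disk of radius less than `1`. -/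
structure CondA2 (T : B →L[ℂ] B) : Prop where
  hasEigenvalue : Module.End.HasEigenvalue (T : B →ₗ[ℂ] B) 1
  isolated : ∃ ε : ℝ, 0 < ε ∧ spectrum ℂ T ∩ Metric.ball 1 ε = {1}
  simple : Module.finrank ℂ (Module.End.maxGenEigenspace (T : B →ₗ[ℂ] B) 1) = 1
  other_eigenvalues : ∀ z : ℂ, Module.End.HasEigenvalue (T : B →ₗ[ℂ] B) z → z ≠ 1 → ‖z‖ < 1
  essential : ∃ ρ : ℝ, ρ < 1 ∧ ∀ z ∈ essentialSpectrum T, ‖z‖ ≤ ρ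

/-- Condition (A3): for `t ≠ 0` the spectrum of `L t` lies in the open unit disk. -/
def CondA3 (L : ℝ → B →L[ℂ] B) : Prop :=
  ∀ t : ℝ, t ≠ 0 → spectrum ℂ (L t) ⊆ {z : ℂ | ‖z‖ < 1}

/-- Condition (A4) with exponent `r₁`: there are positive `K`, `r₂`, `N₀` with
`‖(L t) ^ N‖ ≤ N ^ (-r₂)` for all `N > N₀` and `K ≤ |t| ≤ N ^ r₁`. -/
def CondA4 (L : ℝ → B →L[ℂ] B) (r₁ : ℝ) : Prop :=
  0 < r₁ ∧ ∃ K r₂ N₀ : ℝ, 0 < K ∧ 0 < r₂ ∧ 0 < N₀ ∧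
    ∀ N : ℕ, N₀ < (N : ℝ) → ∀ t : ℝ, K ≤ |t| → |t| ≤ (N : ℝ) ^ r₁ →
      ‖L t ^ N‖ ≤ 1 / (N : ℝ) ^ r₂

end Operators

section FunctionSpace

/-- `C^m(f) = max_{0 ≤ j ≤ m} ‖f^{(j)}‖_{L¹}`. -/
def normDeriv (m : ℕ) (f : ℝ → ℂ) : ℝ≥0∞ :=
  (Finset.range (m + 1)).sup fun j => eLpNorm (iteratedDeriv j f) 1 volume

/-- `C_k(f) = max_{0 ≤ j ≤ k} ‖x^j f‖_{L¹}`. -/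
def normMoment (k : ℕ) (f : ℝ → ℂ) : ℝ≥0∞ :=
  (Finset.range (k + 1)).sup fun j => eLpNorm (fun x : ℝ => (x : ℂ) ^ j * f x) 1 volume

/-- `C^m_k(f) = C^m(f) + C_k(f)`. -/
def normF (m k : ℕ) (f : ℝ → ℂ) : ℝ≥0∞ := normDeriv m f + normMoment k f

/-- The space `F^m_k`: the `m` times continuously differentiable `f` with `C^m_k(f) < ∞`. -/
def spaceF (m k : ℕ) : Set (ℝ → ℂ) := {f | ContDiff ℝ m f ∧ normF m k f < ∞}

end FunctionSpace

section Expansion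

variable {Ω : Type*} [MeasurableSpace Ω]

/-- `S_N = X_1 + ⋯ + X_N`. -/
def partialSum (X : ℕ → Ω → ℝ) (N : ℕ) (ω : Ω) : ℝ := ∑ n ∈ Finset.Icc 1 N, X n ω

/-- `(S_N - N A) / √N`. -/
def normalized (S : ℕ → Ω → ℝ) (A : ℝ) (N : ℕ) (ω : Ω) : ℝ := (S N ω - N * A) / √(N : ℝ)

/-- The distribution function of the centred normal law with variance `v`. -/
def normalCdf (v : ℝ≥0) (z : ℝ) : ℝ := ∫ y in Set.Iic z, gaussianPDFReal 0 v y

/-- The averaged Edgeworth expansion of order `r` for `f ∈ F`, where `F` carries the norm `nrm`,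
`A` is the centring constant and `v` is the variance of the limiting normal law. The polynomials
depend neither on `f` nor on `z` and `N`; the error is `nrm f` times a quantity `e N`
of order `o(N ^ (-r / 2))` that does not depend on `f` and `z`. -/
def AdmitsAveragedExpansion (P : Measure Ω) (S : ℕ → Ω → ℝ) (A : ℝ) (v : ℝ≥0) (r : ℕ)
    (F : Set (ℝ → ℂ)) (nrm : (ℝ → ℂ) → ℝ) : Prop :=
  ∃ Q : ℕ → Polynomial ℝ, ∃ e : ℕ → ℝ,
    e =o[atTop] (fun N : ℕ => (N : ℝ) ^ (-(r : ℝ) / 2)) ∧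
    ∀ f ∈ F, ∀ N : ℕ, 1 ≤ N → ∀ z : ℝ,
      ‖(∫ y : ℝ, ((P.real {ω | normalized S A N ω ≤ z + y / √(N : ℝ)}
            - normalCdf v (z + y / √(N : ℝ)) : ℝ) : ℂ) * f y)
        - ∑ p ∈ Finset.Icc 1 r, ((1 / (N : ℝ) ^ ((p : ℝ) / 2) : ℝ) : ℂ) *
            ∫ y : ℝ, (((Q p).eval (z + y / √(N : ℝ))
              * gaussianPDFReal 0 v (z + y / √(N : ℝ)) : ℝ) : ℂ) * f y‖
      ≤ nrm f * e N

end Expansion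

end

end AvgEdgeworth

/-! Write φ_N(t) = E exp(it S_N) = ℓ(L_t^N v). Near t = 0 the spectral gap of L_0 persists: L_t^N =
λ(t)^N Q(t) + Λ(t)^N with λ and Q smooth and Λ(t)^N exponentially small
(`exists_spectral_decomposition`). The expansion log λ(t) = iAt - σ²t²/2 + t²χ(t) defines A and σ²
(`exists_expansionData`). The bound |φ_N| ≤ 1 and the symmetry of φ_N under conjugation make A real
and σ² ≥ 0, and convergence of characteristic functions gives the central limit theorem.

With w = Nt², the function e^{-iNAt} φ_N(t) equals e^{-σ²w/2} e^{wχ(t)} Z(t) up to an exponentially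
small error. Expanding e^{wχ}Z in powers of t, with coefficients polynomial in w, and putting t =
u/√N produces the Edgeworth approximation, with error o(|t|^r) e^{-σ²w/6}
(`exists_edgeworthChar_approx`). A polynomial in iu times the Gaussian transform is the transform of
a polynomial times the Gaussian density; hence the approximation is the transform of a density whose
distribution function is 𝔑 + Σ N^{-p/2} P_p 𝔫 (`exists_edgeworth_density`).

The difference of two distribution functions, averaged against f, is bounded up to a constant by the
integral of |difference of transforms| · |f̂| / |t| (`norm_integral_cdfOf_sub_le`). Since f and its
q-th derivative are in L¹, |f̂| is at most C^q_0(f)/(1 + |t|^q). It remains to show that N^{r/2} ∫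
D_N(t)/(|t|(1 + |t|^q)) dt tends to 0, where D_N is the error of the Edgeworth approximation; this
integral involves neither f nor z, whence the uniformity.

For |t| ≤ δ the local expansion and the scaling u = √N t suffice. For |t| ≥ δ, N^{r/2}|φ_N(t)| is at
most a constant times 1 + |t|^{r/(2r₁)} (`exists_bound_of_le_abs`): by (A3) on compact sets, by (A4)
up to frequencies of order N^{r₁}, and beyond that because N^{r/2} itself is so bounded while |φ_N|
≤ 1. The condition q > r/(2r₁) makes the resulting majorant integrable, and dominated convergence
turns the pointwise decay into o(N^{-r/2}). -/

namespace AvgEdgeworth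

/-! ### Spectral gap: from Fredholm hypotheses to a rank one splitting at the eigenvalue 1. -/

section Spectral

open Topology

variable {B : Type*} [NormedAddCommGroup B] [NormedSpace ℂ B] [CompleteSpace B]

/-- A bounded below operator that is a limit of invertible operators `T - w` is invertible. -/
lemma isUnit_of_bounded_below_of_frequently {T : B →L[ℂ] B} {c : ℝ} (hc : 0 < c)
    (hT : ∀ x, c * ‖x‖ ≤ ‖T x‖)
    (hn : ∀ ε : ℝ, 0 < ε → ∃ w : ℂ, ‖w‖ < ε ∧ IsUnit (T - w • (1 : B →L[ℂ] B))) : IsUnit T := by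
  rcases subsingleton_or_nontrivial B with hB | hB
  · have : Subsingleton (B →L[ℂ] B) := ⟨fun a b => by ext x; exact Subsingleton.elim _ _⟩
    exact isUnit_of_subsingleton T
  -- With ‖w‖ < c/4 the invertible S = T - w is still bounded below by c/2, so ‖S⁻¹‖⁻¹ ≥ c/2 exceeds
  -- ‖T - S‖ = ‖w‖ and T lies in the ball of invertibles around S.
  obtain ⟨w, hw, ⟨S, hS⟩⟩ := hn (c / 4) (by positivity)
  have hSx : ∀ x, c / 2 * ‖x‖ ≤ ‖(S : B →L[ℂ] B) x‖ := by
    intro x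
    have h1 := norm_sub_norm_le (T x) (w • x)
    have h2 := hT x
    have h3 : (S : B →L[ℂ] B) x = T x - w • x := by rw [hS]; simp
    rw [h3]
    rw [norm_smul] at h1
    nlinarith [norm_nonneg x]
  have hinv : ‖((S⁻¹ : (B →L[ℂ] B)ˣ) : B →L[ℂ] B)‖ ≤ 2 / c := by
    refine ContinuousLinearMap.opNorm_le_bound _ (by positivity) fun y => ?_
    have h1 := hSx (((S⁻¹ : (B →L[ℂ] B)ˣ) : B →L[ℂ] B) y)
    have h2 : (S : B →L[ℂ] B) (((S⁻¹ : (B →L[ℂ] B)ˣ) : B →L[ℂ] B) y) = y := by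
      rw [← mul_apply_eq_comp, Units.mul_inv]; rfl
    rw [h2] at h1
    rw [div_mul_eq_mul_div, le_div_iff₀ hc]
    linarith
  have hpos : 0 < ‖((S⁻¹ : (B →L[ℂ] B)ˣ) : B →L[ℂ] B)‖ := Units.norm_pos _
  have hlt : ‖T - (S : B →L[ℂ] B)‖ < ‖((S⁻¹ : (B →L[ℂ] B)ˣ) : B →L[ℂ] B)‖⁻¹ := by
    have h1 : T - (S : B →L[ℂ] B) = w • (1 : B →L[ℂ] B) := by rw [hS]; abel
    rw [h1, norm_smul, norm_one, mul_one]
    calc ‖w‖ < c / 4 := hw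
      _ < (2 / c)⁻¹ := by rw [inv_div]; linarith
      _ ≤ _ := inv_anti₀ hpos hinv
  exact (Units.ofNearby S T hlt).isUnit

/-- A point of the spectrum that is a limit of points of the resolvent set and at which `z - T` is
Fredholm is an eigenvalue. -/
lemma hasEigenvalue_of_isFredholm {T : B →L[ℂ] B} {z : ℂ} (hz : z ∈ spectrum ℂ T)
    (hn : ∀ ε : ℝ, 0 < ε → ∃ w : ℂ, ‖w‖ < ε ∧ z + w ∉ spectrum ℂ T)
    (hF : (z • ContinuousLinearMap.id ℂ B - T).IsFredholm) :
    Module.End.HasEigenvalue (T : B →ₗ[ℂ] B) z := by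
  by_contra hne
  apply hz
  have hker : (z • ContinuousLinearMap.id ℂ B - T).ker = ⊥ := by
    rw [LinearMap.ker_eq_bot']
    intro x hx
    by_contra hx0
    apply hne
    refine Module.End.hasEigenvalue_of_hasEigenvector (x := x) ⟨?_, hx0⟩
    rw [Module.End.mem_eigenspace_iff]
    have : z • x - T x = 0 := hx
    exact (sub_eq_zero.mp this).symm
  have hinj : Function.Injective (z • ContinuousLinearMap.id ℂ B - T) :=
    LinearMap.ker_eq_bot.mp hker
  obtain ⟨K, hK⟩ := ContinuousLinearMap.antilipschitz_of_injective_of_isClosed_range _ hinj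
    hF.isClosed_range
  have hK' : 0 < max (K : ℝ) 1 := by positivity
  have halg : algebraMap ℂ (B →L[ℂ] B) z - T = z • ContinuousLinearMap.id ℂ B - T := by
    rw [Algebra.algebraMap_eq_smul_one]; rfl
  rw [spectrum.mem_resolventSet_iff, halg]
  refine isUnit_of_bounded_below_of_frequently (c := (max (K : ℝ) 1)⁻¹) (by positivity) ?_ ?_
  · intro x
    have h := hK.le_mul_dist x 0
    simp only [dist_zero_right, map_zero] at h
    rw [inv_mul_le_iff₀ hK']
    exact h.trans (mul_le_mul_of_nonneg_right (le_max_left _ _) (norm_nonneg _))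
  · intro ε hε
    obtain ⟨w, hw, hwz⟩ := hn ε hε
    refine ⟨-w, by simpa using hw, ?_⟩
    have h1 : IsUnit (algebraMap ℂ (B →L[ℂ] B) (z + w) - T) := by
      simpa [spectrum, resolventSet] using hwz
    convert h1 using 1
    rw [Algebra.algebraMap_eq_smul_one, add_smul, neg_smul]
    change z • (1 : B →L[ℂ] B) - T - -(w • 1) = _
    abel

/-- Under the spectral gap condition, `1` is the only point of the spectrum outside the open unit
disk. -/
lemma CondA2.eq_one_of_one_le_norm {T : B →L[ℂ] B} (hT : CondA2 T) {z : ℂ}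
    (hz : z ∈ spectrum ℂ T) (h1 : 1 ≤ ‖z‖) : z = 1 := by
  have : Nontrivial B := by
    obtain ⟨x, hx⟩ := hT.hasEigenvalue.exists_hasEigenvector
    exact ⟨x, 0, hx.2⟩
  -- A spectral point of maximal modulus leaves the spectrum when pushed radially outwards, so it is
  -- a limit of resolvent points; being Fredholm, it is an eigenvalue, hence 1. Consequently the
  -- spectral radius is 1, and every spectral point of modulus at least 1 is itself of maximal
  -- modulus.
  have key : ∀ z₀ ∈ spectrum ℂ T, (∀ y ∈ spectrum ℂ T, ‖y‖ ≤ ‖z₀‖) → 1 ≤ ‖z₀‖ → z₀ = 1 := by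
    intro z₀ hz₀ hmax hge
    by_contra hne
    obtain ⟨ρ, hρ, hess⟩ := hT.essential
    have hF : (z₀ • ContinuousLinearMap.id ℂ B - T).IsFredholm := by
      by_contra hcon
      have := hess z₀ hcon
      linarith
    have hlt := hT.other_eigenvalues z₀ (hasEigenvalue_of_isFredholm hz₀ ?_ hF) hne
    · linarith
    · intro ε hε
      have hp : 0 < ‖z₀‖ := by linarith
      refine ⟨((ε / 2 / ‖z₀‖ : ℝ) : ℂ) * z₀, ?_, fun hmem => ?_⟩
      · rw [norm_mul, Complex.norm_real, Real.norm_of_nonneg (by positivity),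
          div_mul_cancel₀ _ hp.ne']
        linarith
      · have h2 := hmax _ hmem
        have h3 : z₀ + ((ε / 2 / ‖z₀‖ : ℝ) : ℂ) * z₀ = ((1 + ε / 2 / ‖z₀‖ : ℝ) : ℂ) * z₀ := by
          push_cast; ring
        rw [h3, norm_mul, Complex.norm_real, Real.norm_of_nonneg (by positivity), add_mul,
          div_mul_cancel₀ _ hp.ne'] at h2
        linarith
  obtain ⟨z₀, hz₀, hmax⟩ := (spectrum.isCompact (𝕜 := ℂ) T).exists_isMaxOn ⟨z, hz⟩
    continuous_norm.continuousOn
  have hz01 : z₀ = 1 := key z₀ hz₀ (fun y hy => hmax hy) (h1.trans (hmax hz))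
  refine key z hz (fun y hy => ?_) h1
  have := hmax hy
  simp only [Set.mem_ofPred_eq, hz01, norm_one] at this
  exact this.trans h1

/-- S is block diagonal for the splitting given by p and acts as c on the range of p. Adding d • p
only changes that block to c + d, so the inverse is S⁻¹(1 - p) + (c + d)⁻¹ p. -/
lemma isUnit_add_smul_of_commute_idempotent {A : Type*} [Ring A] [Algebra ℂ A] {S p : A} {c d : ℂ}
    (hS : IsUnit S) (hp : p * p = p) (h1 : S * p = c • p) (h2 : p * S = c • p) (hcd : c + d ≠ 0) :
    IsUnit (S + d • p) := by
  obtain ⟨S, rfl⟩ := hS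
  have hSp : (↑S⁻¹ : A) * p = p * ↑S⁻¹ := by
    have : (S : A) * p = p * S := by rw [h1, h2]
    rw [Units.inv_mul_eq_iff_eq_mul, ← mul_assoc, this, mul_assoc, Units.mul_inv, mul_one]
  have hcomm : ↑S⁻¹ * (1 - p) * p = 0 := by rw [mul_assoc, sub_mul, one_mul, hp, sub_self, mul_zero]
  have hcomm' : p * (↑S⁻¹ * (1 - p)) = 0 := by
    rw [← mul_assoc, ← hSp, mul_assoc, mul_sub, mul_one, hp, sub_self, mul_zero]
  refine ⟨⟨S + d • p, ↑S⁻¹ * (1 - p) + (c + d)⁻¹ • p, ?_, ?_⟩, rfl⟩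
  · rw [add_mul, mul_add, mul_add, ← mul_assoc, Units.mul_inv, one_mul, mul_smul_comm, h1,
      smul_mul_assoc, hcomm', smul_zero, zero_add, smul_mul_assoc, mul_smul_comm, hp, add_assoc,
      smul_smul, smul_smul, ← add_smul]
    rw [show (c + d)⁻¹ * c + d * (c + d)⁻¹ = 1 by field_simp, one_smul]
    abel
  · rw [mul_add, add_mul, add_mul, mul_smul_comm, hcomm, smul_zero, zero_add, smul_mul_assoc, h2,
      mul_assoc, sub_mul, one_mul, h2, mul_sub, Units.inv_mul, mul_smul_comm, smul_mul_assoc,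
      mul_smul_comm, hp, smul_smul, smul_smul]
    have h3 : c • (↑S⁻¹ * p) = p := by
      rw [← mul_smul_comm, ← h1, ← mul_assoc, Units.inv_mul, one_mul]
    rw [h3, add_assoc, ← add_smul,
      show (c + d)⁻¹ * c + (c + d)⁻¹ * d = 1 by field_simp, one_smul]
    abel

/-- The rank one operator `x ↦ φ x • h`. -/
noncomputable def rankOne (φ : B →L[ℂ] ℂ) (h : B) : B →L[ℂ] B := φ.smulRight h

@[simp]
lemma rankOne_apply (φ : B →L[ℂ] ℂ) (h x : B) : rankOne φ h x = φ x • h := rfl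

/-- The data extracted from the spectral gap at the eigenvalue `1`: a right and a left eigenvector,
normalized, such that the corresponding rank one perturbation is invertible. -/
lemma CondA2.exists_eigenvectors {T : B →L[ℂ] B} (hT : CondA2 T) :
    ∃ (h : B) (φ : B →L[ℂ] ℂ), φ h = 1 ∧ T h = h ∧ (∀ x, φ (T x) = φ x) ∧
      IsUnit (1 - T + rankOne φ h) := by
  obtain ⟨h, hh⟩ := hT.hasEigenvalue.exists_hasEigenvector
  have hTh : T h = h := by simpa using hh.apply_eq_smul
  -- Algebraic simplicity in usable form: there is no Jordan chain of length two. This puts h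
  -- outside the range of 1 - T and also identifies the kernel of 1 - T.
  have hgen : ∀ x : B, (1 - T) ((1 - T) x) = 0 → ∃ a : ℂ, x = a • h := by
    intro x hx
    have hmem : ∀ y : B, (1 - T) ((1 - T) y) = 0 →
        y ∈ Module.End.maxGenEigenspace (T : B →ₗ[ℂ] B) 1 := by
      intro y hy
      rw [Module.End.mem_maxGenEigenspace]
      refine ⟨2, ?_⟩
      have h3 : (1 - T) ((1 - T) y) = T (T y) - T y - (T y - y) := by
        simp only [sub_apply, one_apply_eq_self, map_sub]
        abel
      rw [h3] at hy
      simpa [pow_two] using hy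
    have hh' := hmem h (by simp [hTh])
    have := (finrank_eq_one_iff_of_nonzero' (⟨h, hh'⟩ : Module.End.maxGenEigenspace (T : B →ₗ[ℂ] B) 1)
      (by simpa using hh.2)).mp hT.simple ⟨x, hmem x hx⟩
    obtain ⟨a, ha⟩ := this
    exact ⟨a, by simpa using (congrArg Subtype.val ha).symm⟩
  obtain ⟨ρ, hρ, hess⟩ := hT.essential
  have hF : (1 - T).IsFredholm := by
    by_contra hcon
    have := hess 1 (by rw [essentialSpectrum, Set.mem_ofPred_eq, one_smul]; exact hcon)
    simp at this
    linarith
  have hnot : h ∉ (1 - T).range := by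
    rintro ⟨x, hx⟩
    have hx : (1 - T) x = h := hx
    have h0 : (1 - T) ((1 - T) x) = 0 := by rw [hx]; simp [hTh]
    obtain ⟨a, rfl⟩ := hgen x h0
    apply hh.2
    rw [← hx]
    simp [hTh]
  have hcl : IsClosed ((1 - T).range : Set B) := hF.isClosed_range
  have : IsClosed ((1 - T).range : Set B) := hcl
  obtain ⟨f, hf⟩ := SeparatingDual.exists_eq_one (R := ℂ)
    (x := (Submodule.Quotient.mk h : B ⧸ (1 - T).range))
    (by rwa [Ne, Submodule.Quotient.mk_eq_zero])
  set φ : B →L[ℂ] ℂ := f.comp ((1 - T).range.mkQL) with hφ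
  have hφh : φ h = 1 := hf
  have hφN : ∀ x, φ ((1 - T) x) = 0 := by
    intro x
    have : (Submodule.Quotient.mk ((1 - T) x) : B ⧸ (1 - T).range) = 0 := by
      rw [Submodule.Quotient.mk_eq_zero]
      exact ⟨x, rfl⟩
    change f (Submodule.Quotient.mk ((1 - T) x)) = 0
    rw [this, map_zero]
  have hφT : ∀ x, φ (T x) = φ x := by
    intro x
    have := hφN x
    simp only [sub_apply, one_apply_eq_self, map_sub] at this
    exact (sub_eq_zero.mp this).symm
  refine ⟨h, φ, hφh, hTh, hφT, ?_⟩
  have : CompleteSpace (1 - T).range := hcl.completeSpace_coe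
  -- Surjectivity of 1 - T + P is not read off from an index. The open mapping theorem on the closed
  -- range of 1 - T makes this operator bounded below, and it is a limit of invertible operators.
  obtain ⟨C, hC, hpre⟩ := ContinuousLinearMap.exists_preimage_norm_le
    ((1 - T).codRestrict (1 - T).range fun x => ⟨x, rfl⟩) (by
      rintro ⟨y, x, rfl⟩
      exact ⟨x, rfl⟩)
  have hpre' : ∀ x, ∃ x', (1 - T) x' = (1 - T) x ∧ ‖x'‖ ≤ C * ‖(1 - T) x‖ := by
    intro x
    obtain ⟨x', h1, h2⟩ := hpre ⟨(1 - T) x, x, rfl⟩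
    exact ⟨x', congrArg Subtype.val h1, h2⟩
  set D : ℝ := C * (1 + ‖φ‖ * ‖h‖) + (‖φ‖ + ‖φ‖ * (C * (1 + ‖φ‖ * ‖h‖))) * ‖h‖ + 1 with hD
  have hDpos : 0 < D := by positivity
  refine isUnit_of_bounded_below_of_frequently (c := D⁻¹) (by positivity) ?_ ?_
  · intro x
    rw [inv_mul_le_iff₀ hDpos]
    set y := (1 - T + rankOne φ h) x with hy
    have hyx : y = (1 - T) x + φ x • h := rfl
    have hφy : φ y = φ x := by
      rw [hyx, map_add, hφN, map_smul, hφh]; simp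
    have hNx : ‖(1 - T) x‖ ≤ (1 + ‖φ‖ * ‖h‖) * ‖y‖ := by
      have : (1 - T) x = y - φ y • h := by rw [hφy, hyx]; abel
      rw [this]
      calc ‖y - φ y • h‖ ≤ ‖y‖ + ‖φ y‖ * ‖h‖ := by rw [← norm_smul]; exact norm_sub_le _ _
        _ ≤ ‖y‖ + ‖φ‖ * ‖y‖ * ‖h‖ := by gcongr; exact φ.le_opNorm y
        _ = _ := by ring
    obtain ⟨x', h1, h2⟩ := hpre' x
    obtain ⟨a, ha⟩ := hgen (x - x') (by rw [map_sub, h1, sub_self, map_zero])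
    have hx : x = x' + a • h := by rw [← ha]; abel
    have hx' : ‖x'‖ ≤ C * (1 + ‖φ‖ * ‖h‖) * ‖y‖ := by
      calc ‖x'‖ ≤ C * ‖(1 - T) x‖ := h2
        _ ≤ C * ((1 + ‖φ‖ * ‖h‖) * ‖y‖) := by gcongr
        _ = _ := by ring
    have hanorm : ‖a‖ ≤ (‖φ‖ + ‖φ‖ * (C * (1 + ‖φ‖ * ‖h‖))) * ‖y‖ := by
      have : a = φ y - φ x' := by
        rw [hφy]
        nth_rewrite 1 [hx]
        rw [map_add, map_smul, hφh]
        simp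
      rw [this]
      calc ‖φ y - φ x'‖ ≤ ‖φ‖ * ‖y‖ + ‖φ‖ * ‖x'‖ :=
            (norm_sub_le _ _).trans (add_le_add (φ.le_opNorm _) (φ.le_opNorm _))
        _ ≤ ‖φ‖ * ‖y‖ + ‖φ‖ * (C * (1 + ‖φ‖ * ‖h‖) * ‖y‖) := by gcongr
        _ = _ := by ring
    calc ‖x‖ ≤ ‖x'‖ + ‖a‖ * ‖h‖ := by rw [← norm_smul]; nth_rewrite 1 [hx]; exact norm_add_le _ _
      _ ≤ C * (1 + ‖φ‖ * ‖h‖) * ‖y‖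
          + (‖φ‖ + ‖φ‖ * (C * (1 + ‖φ‖ * ‖h‖))) * ‖y‖ * ‖h‖ := by gcongr
      _ ≤ D * ‖y‖ := by rw [hD]; nlinarith [norm_nonneg y]
  · intro ε hε
    -- As 1 is isolated in the spectrum, 1 - T - d is invertible for small d > 0; it acts as -d on
    -- h, and adding P replaces this by 1 - d ≠ 0.
    obtain ⟨η, hη, hiso⟩ := hT.isolated
    set d : ℝ := min (min (ε / 2) (η / 2)) (1 / 2) with hd
    have hdpos : 0 < d := by positivity
    have hdε : d < ε := by
      have : d ≤ ε / 2 := (min_le_left _ _).trans (min_le_left _ _)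
      linarith
    have hdη : d < η := by
      have : d ≤ η / 2 := (min_le_left _ _).trans (min_le_right _ _)
      linarith
    have hd1 : d ≤ 1 / 2 := min_le_right _ _
    refine ⟨(d : ℂ), by rwa [Complex.norm_real, Real.norm_of_nonneg hdpos.le], ?_⟩
    have hres : (1 - (d : ℂ)) ∉ spectrum ℂ T := by
      intro hmem
      have : (1 - (d : ℂ)) ∈ spectrum ℂ T ∩ Metric.ball 1 η :=
        ⟨hmem, by simpa [dist_eq_norm, abs_of_pos hdpos] using hdη⟩
      rw [hiso, Set.mem_singleton_iff, sub_eq_self] at this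
      exact hdpos.ne' (by exact_mod_cast this)
    have hS : IsUnit (1 - T - (d : ℂ) • (1 : B →L[ℂ] B)) := by
      have h1 : IsUnit (algebraMap ℂ (B →L[ℂ] B) (1 - (d : ℂ)) - T) := by
        simpa [spectrum, resolventSet] using hres
      convert h1 using 1
      rw [Algebra.algebraMap_eq_smul_one, sub_smul, one_smul]
      abel
    have hp : rankOne φ h * rankOne φ h = rankOne φ h := by
      ext x; simp [hφh]
    have := isUnit_add_smul_of_commute_idempotent (c := -(d : ℂ)) (d := 1) hS hp
      (by ext x; simp [hTh, smul_smul, mul_comm, -Complex.coe_smul])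
      (by ext x; simp [hφT, smul_smul, -Complex.coe_smul])
      (by
        intro h0
        have : (1 : ℝ) - d = 0 := by exact_mod_cast (by linear_combination h0 : (1 : ℂ) - d = 0)
        linarith)
    convert this using 1
    rw [one_smul]
    abel

/-- Removing the eigenvalue `1` leaves an operator with spectrum in the open unit disk. -/
lemma CondA2.spectrum_sub_rankOne_subset {T : B →L[ℂ] B} (hT : CondA2 T) {h : B}
    {φ : B →L[ℂ] ℂ} (hφh : φ h = 1) (hTh : T h = h) (hφT : ∀ x, φ (T x) = φ x)
    (hu : IsUnit (1 - T + rankOne φ h)) :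
    spectrum ℂ (T - rankOne φ h) ⊆ {z : ℂ | ‖z‖ < 1} := by
  intro z hz
  by_contra hcon
  have hge : 1 ≤ ‖z‖ := not_lt.mp hcon
  apply hz
  rw [spectrum.mem_resolventSet_iff]
  by_cases hz1 : z = 1
  · rw [hz1, map_one]
    convert hu using 1
    abel
  · have hS : IsUnit (algebraMap ℂ (B →L[ℂ] B) z - T) := by
      by_contra hns
      exact hz1 (hT.eq_one_of_one_le_norm hns hge)
    have hp : rankOne φ h * rankOne φ h = rankOne φ h := by
      ext x; simp [hφh]
    -- On h the operator z - T acts as z - 1; adding P makes it z, which is nonzero since ‖z‖ ≥ 1.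
    have := isUnit_add_smul_of_commute_idempotent (c := z - 1) (d := 1) hS hp
      (by ext x; simp [hTh, Algebra.algebraMap_eq_smul_one, sub_smul, smul_sub, smul_smul, mul_comm])
      (by ext x; simp [hφT, sub_smul, Algebra.algebraMap_eq_smul_one, smul_smul])
      (by
        intro h0
        have : z = 0 := by linear_combination h0
        rw [this, norm_zero] at hge
        linarith)
    convert this using 1
    rw [one_smul]
    abel

end Spectral

/-! ### Uniform exponential decay of powers. -/

section PowerBounds

open Topology

variable {A : Type*} [NormedRing A] [NormedAlgebra ℂ A] [CompleteSpace A]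

/-- Gelfand's formula. A bound on a single power is an open condition on the element, which is what
makes the later decay uniform in a parameter. -/
lemma exists_norm_pow_lt_half {a : A} (ha : spectrum ℂ a ⊆ {z : ℂ | ‖z‖ < 1}) :
    ∃ m : ℕ, 1 ≤ m ∧ ‖a ^ m‖ < 1 / 2 := by
  rcases subsingleton_or_nontrivial A with hA | hA
  · exact ⟨1, le_rfl, by rw [Subsingleton.elim (a ^ 1) 0, norm_zero]; norm_num⟩
  have hr : spectralRadius ℂ a < 1 := by
    have := spectrum.spectralRadius_lt_of_forall_lt a (r := 1) fun z hz => by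
      have h1 : ‖z‖ < 1 := ha hz
      exact_mod_cast h1
    simpa using this
  obtain ⟨κ, h1, h2⟩ := ENNReal.lt_iff_exists_nnreal_btwn.mp hr
  have h2' : (κ : ℝ) < 1 := by exact_mod_cast h2
  have hev := (spectrum.pow_nnnorm_pow_one_div_tendsto_nhds_spectralRadius a).eventually_lt_const h1
  have hpow := (tendsto_pow_atTop_nhds_zero_of_lt_one κ.2 h2').eventually_lt_const
    (by norm_num : (0 : ℝ) < 1 / 2)
  obtain ⟨m, ⟨hm1, hm2⟩, hm3⟩ := ((hev.and hpow).and (eventually_ge_atTop 1)).exists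
  refine ⟨m, hm3, lt_of_le_of_lt ?_ hm2⟩
  have hm0 : (0 : ℝ) < m := by exact_mod_cast hm3
  have h4 := ENNReal.rpow_lt_rpow hm1 hm0
  rw [← ENNReal.rpow_mul, one_div_mul_cancel hm0.ne', ENNReal.rpow_one, ENNReal.rpow_natCast] at h4
  have h5 : ‖a ^ m‖₊ < κ ^ m := by exact_mod_cast h4
  exact_mod_cast h5.le

/-- If the spectrum of `a t₀` lies in the open unit disk, then the powers of `a t` decay
exponentially, uniformly for `t` near `t₀`. -/
lemma eventually_norm_pow_le {X : Type*} [TopologicalSpace X] {a : X → A} {t₀ : X}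
    (hc : ContinuousAt a t₀) (ha : spectrum ℂ (a t₀) ⊆ {z : ℂ | ‖z‖ < 1}) :
    ∃ C κ : ℝ, 0 < C ∧ 0 < κ ∧ κ < 1 ∧ ∀ᶠ t in 𝓝 t₀, ∀ n : ℕ, ‖a t ^ n‖ ≤ C * κ ^ n := by
  obtain ⟨m, hm, hlt⟩ := exists_norm_pow_lt_half ha
  have e1 : ∀ᶠ t in 𝓝 t₀, ‖a t ^ m‖ < 1 / 2 := (hc.pow m).norm.eventually_lt_const hlt
  have e2 : ∀ᶠ t in 𝓝 t₀, ‖a t‖ < ‖a t₀‖ + 1 := hc.norm.eventually_lt_const (by linarith)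
  set D : ℝ := ‖(1 : A)‖ + (‖a t₀‖ + 1) with hD
  have hD1 : 1 ≤ ‖a t₀‖ + 1 := by linarith [norm_nonneg (a t₀)]
  -- Chosen so that κ ^ m = 1/2: writing n = m(n / m) + n % m, each block of length m gains a factor
  -- 1/2, and the remainder costs at most a factor 2.
  set κ : ℝ := (1 / 2 : ℝ) ^ (1 / (m : ℝ)) with hκ
  have hm0 : (0 : ℝ) < m := by exact_mod_cast hm
  have hκ0 : 0 < κ := by positivity
  have hκ1 : κ < 1 := Real.rpow_lt_one (by norm_num) (by norm_num) (by positivity)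
  have hκm : κ ^ m = 1 / 2 := by
    rw [hκ, ← Real.rpow_natCast, ← Real.rpow_mul (by norm_num), one_div_mul_cancel hm0.ne',
      Real.rpow_one]
  set E : ℝ := (‖(1 : A)‖ + 1) * (‖a t₀‖ + 1) ^ m with hE
  have hEpos : 0 < E := by positivity
  refine ⟨(‖(1 : A)‖ + 1) * E * 2, κ, by positivity, hκ0, hκ1, ?_⟩
  filter_upwards [e1, e2] with t h1 h2 n
  -- The factor ‖1‖ + 1 serves the exponent 0, since ‖1‖ = 1 is not assumed.
  have hpow : ∀ (b : A) (D : ℝ), ‖b‖ ≤ D → ∀ k : ℕ, ‖b ^ k‖ ≤ (‖(1 : A)‖ + 1) * D ^ k := by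
    intro b D hb k
    have hD0 : 0 ≤ D := (norm_nonneg _).trans hb
    rcases Nat.eq_zero_or_pos k with rfl | hk
    · simp
    · calc ‖b ^ k‖ ≤ ‖b‖ ^ k := norm_pow_le' b hk
        _ ≤ 1 * D ^ k := by rw [one_mul]; gcongr
        _ ≤ _ := by gcongr; linarith [norm_nonneg (1 : A)]
  have hn : n = m * (n / m) + n % m := (Nat.div_add_mod n m).symm
  have hmod : n % m < m := Nat.mod_lt _ hm
  have b1 : ‖(a t ^ m) ^ (n / m)‖ ≤ (‖(1 : A)‖ + 1) * (1 / 2) ^ (n / m) := hpow _ _ h1.le _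
  have b2 : ‖a t ^ (n % m)‖ ≤ E := by
    refine (hpow _ _ h2.le _).trans ?_
    rw [hE]
    gcongr
  have b3 : (1 / 2 : ℝ) ^ (n / m) ≤ 2 * κ ^ n := by
    have : κ ^ n = (1 / 2) ^ (n / m) * κ ^ (n % m) := by
      conv_lhs => rw [hn]
      rw [pow_add, pow_mul, hκm]
    rw [this]
    have h3 : (1 / 2 : ℝ) ≤ κ ^ (n % m) := by
      rw [← hκm]
      exact pow_le_pow_of_le_one hκ0.le hκ1.le hmod.le
    have h4 : (0 : ℝ) < (1 / 2) ^ (n / m) := by positivity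
    nlinarith
  calc ‖a t ^ n‖ = ‖(a t ^ m) ^ (n / m) * a t ^ (n % m)‖ := by
        conv_lhs => rw [hn]
        rw [pow_add, pow_mul]
    _ ≤ ‖(a t ^ m) ^ (n / m)‖ * ‖a t ^ (n % m)‖ := norm_mul_le _ _
    _ ≤ ((‖(1 : A)‖ + 1) * (1 / 2) ^ (n / m)) * E := by gcongr
    _ ≤ ((‖(1 : A)‖ + 1) * (2 * κ ^ n)) * E := by gcongr
    _ = _ := by ring

/-- Uniform exponential decay of powers over a compact set of parameters. -/
lemma exists_norm_pow_le_of_isCompact {X : Type*} [TopologicalSpace X] {a : X → A}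
    (hc : Continuous a) {s : Set X} (hs : IsCompact s)
    (ha : ∀ t ∈ s, spectrum ℂ (a t) ⊆ {z : ℂ | ‖z‖ < 1}) :
    ∃ C κ : ℝ, 0 < C ∧ 0 < κ ∧ κ < 1 ∧ ∀ t ∈ s, ∀ n : ℕ, ‖a t ^ n‖ ≤ C * κ ^ n := by
  refine hs.induction_on (p := fun s => ∃ C κ : ℝ, 0 < C ∧ 0 < κ ∧ κ < 1 ∧
    ∀ t ∈ s, ∀ n : ℕ, ‖a t ^ n‖ ≤ C * κ ^ n) ?_ ?_ ?_ ?_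
  · exact ⟨1, 1 / 2, by norm_num, by norm_num, by norm_num, by simp⟩
  · rintro s t hst ⟨C, κ, h1, h2, h3, h4⟩
    exact ⟨C, κ, h1, h2, h3, fun x hx => h4 x (hst hx)⟩
  · rintro s t ⟨C, κ, h1, h2, h3, h4⟩ ⟨C', κ', h1', h2', h3', h4'⟩
    refine ⟨max C C', max κ κ', by positivity, by positivity, max_lt h3 h3', ?_⟩
    rintro x (hx | hx) n
    · refine (h4 x hx n).trans ?_
      gcongr
      · exact le_max_left _ _
      · exact le_max_left _ _
    · refine (h4' x hx n).trans ?_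
      gcongr
      · exact le_max_right _ _
      · exact le_max_right _ _
  · intro x hx
    obtain ⟨C, κ, h1, h2, h3, h4⟩ := eventually_norm_pow_le hc.continuousAt (ha x hx)
    exact ⟨_, mem_nhdsWithin_of_mem_nhds h4, C, κ, h1, h2, h3, fun t ht => ht⟩

lemma pow_sub_pow_eq_sum (a b : A) (n : ℕ) :
    a ^ n - b ^ n = ∑ k ∈ Finset.range n, a ^ k * (a - b) * b ^ (n - 1 - k) := by
  induction n with
  | zero => simp
  | succ n ih =>
    rw [Finset.sum_range_succ]
    have : ∑ k ∈ Finset.range n, a ^ k * (a - b) * b ^ (n + 1 - 1 - k)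
        = (∑ k ∈ Finset.range n, a ^ k * (a - b) * b ^ (n - 1 - k)) * b := by
      rw [Finset.sum_mul]
      refine Finset.sum_congr rfl fun k hk => ?_
      have hk := Finset.mem_range.mp hk
      rw [mul_assoc _ _ b, ← pow_succ]
      congr 2
      omega
    rw [this, ← ih, Nat.add_sub_cancel, Nat.sub_self, pow_zero, mul_one, pow_succ, pow_succ,
      sub_mul, mul_sub]
    abel

/-- In the telescoping sum each of the n terms carries κ^k κ^{n-1-k} = κ^n / κ. The powers therefore
depend on the element in a Lipschitz way, with an exponentially small constant. -/
lemma norm_pow_sub_pow_le {a b : A} {C κ : ℝ} (hC : 0 ≤ C) (hκ : 0 < κ)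
    (ha : ∀ n : ℕ, ‖a ^ n‖ ≤ C * κ ^ n) (hb : ∀ n : ℕ, ‖b ^ n‖ ≤ C * κ ^ n) (n : ℕ) :
    ‖a ^ n - b ^ n‖ ≤ n * (C ^ 2 / κ * κ ^ n) * ‖a - b‖ := by
  rw [pow_sub_pow_eq_sum]
  refine (norm_sum_le _ _).trans ?_
  calc ∑ k ∈ Finset.range n, ‖a ^ k * (a - b) * b ^ (n - 1 - k)‖
      ≤ ∑ _k ∈ Finset.range n, (C ^ 2 / κ * κ ^ n) * ‖a - b‖ := by
        refine Finset.sum_le_sum fun k hk => ?_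
        have hk := Finset.mem_range.mp hk
        calc ‖a ^ k * (a - b) * b ^ (n - 1 - k)‖ ≤ ‖a ^ k‖ * ‖a - b‖ * ‖b ^ (n - 1 - k)‖ :=
              (norm_mul_le _ _).trans (by gcongr; exact norm_mul_le _ _)
          _ ≤ (C * κ ^ k) * ‖a - b‖ * (C * κ ^ (n - 1 - k)) := by
              gcongr
              · exact ha k
              · exact hb _
          _ = C ^ 2 / κ * (κ * κ ^ k * κ ^ (n - 1 - k)) * ‖a - b‖ := by
              field_simp
          _ = _ := by
              rw [mul_assoc κ, ← pow_add, ← pow_succ']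
              congr 3
              omega
    _ = _ := by rw [Finset.sum_const, Finset.card_range, nsmul_eq_mul]; ring

end PowerBounds
end AvgEdgeworth

namespace AvgEdgeworth

/-! ### Perturbation of the leading eigenvalue. -/

section Perturbation

open Topology

lemma sub_smul_pow_of_idempotent {A : Type*} [Ring A] [Algebra ℂ A] {a p : A} {c : ℂ}
    (hp : p * p = p) (h1 : a * p = c • p) (h2 : p * a = c • p) {n : ℕ} (hn : 1 ≤ n) :
    a ^ n = c ^ n • p + (a - c • p) ^ n := by
  have hpow : ∀ k : ℕ, a ^ k * p = c ^ k • p := by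
    intro k
    induction k with
    | zero => simp
    | succ k ih => rw [pow_succ, mul_assoc, h1, mul_smul_comm, ih, smul_smul, pow_succ, mul_comm]
  induction n, hn using Nat.le_induction with
  | base => simp
  | succ n hn ih =>
    have h3 : (a - c • p) ^ n = a ^ n - c ^ n • p := by rw [ih]; abel
    rw [pow_succ (a - c • p), h3, sub_mul, mul_sub, mul_sub, mul_smul_comm, hpow, smul_mul_assoc,
      h2, smul_mul_assoc, mul_smul_comm, hp, smul_smul, smul_smul, ← pow_succ, ← pow_succ,
      ← pow_succ']
    abel

/-- The factor n is absorbed by moving κ halfway towards 1. -/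
lemma exists_natCast_mul_pow_le {κ : ℝ} (h0 : 0 < κ) (h1 : κ < 1) :
    ∃ C κ' : ℝ, 0 < C ∧ κ ≤ κ' ∧ κ' < 1 ∧ ∀ n : ℕ, n * κ ^ n ≤ C * κ' ^ n := by
  set κ' := (1 + κ) / 2 with hκ'
  have hκ'0 : 0 < κ' := by positivity
  have hlt : κ / κ' < 1 := by rw [div_lt_one hκ'0]; linarith
  have ht := tendsto_self_mul_const_pow_of_lt_one (by positivity : 0 ≤ κ / κ') hlt
  obtain ⟨C, hC⟩ := ht.bddAbove_range
  refine ⟨max C 1, κ', by positivity, by linarith, by linarith, fun n => ?_⟩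
  have h2 : (n : ℝ) * (κ / κ') ^ n ≤ C := hC ⟨n, rfl⟩
  have h3 : (n : ℝ) * κ ^ n = n * (κ / κ') ^ n * κ' ^ n := by
    rw [div_pow]; field_simp
  rw [h3]
  gcongr
  exact h2.trans (le_max_left _ _)

variable {B : Type*} [NormedAddCommGroup B] [NormedSpace ℂ B] [CompleteSpace B]

lemma rankOne_mul_mul_rankOne (φ : B →L[ℂ] ℂ) (h : B) (X : B →L[ℂ] B) :
    rankOne φ h * X * rankOne φ h = φ (X h) • rankOne φ h := by
  ext x
  simp [smul_smul, mul_comm]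

/-- The simple eigenvalue `1` of `L 0` continues to a smooth branch of simple eigenvalues. -/
lemma exists_eigenvalue_branch {L : ℝ → B →L[ℂ] B} {s : ℕ} (hs : s ≠ 0)
    (hL : ContDiffAt ℝ s L 0) {h : B} {φ : B →L[ℂ] ℂ} (hφh : φ h = 1) (hTh : L 0 h = h)
    (hu : IsUnit (1 - L 0 + rankOne φ h)) :
    ∃ lam : ℝ → ℂ, ContDiffAt ℝ s lam 0 ∧ lam 0 = 1 ∧
      ∀ᶠ t in 𝓝 (0 : ℝ), φ (Ring.inverse (lam t • 1 - L t + rankOne φ h) h) = 1 := by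
  set M : ℝ × ℂ → B →L[ℂ] B := fun p => p.2 • 1 - L p.1 + rankOne φ h with hM
  have hMc : ContDiffAt ℝ s M (0, 1) := by
    have h1 : ContDiffAt ℝ s (fun p : ℝ × ℂ => L p.1) (0, 1) :=
      ContDiffAt.comp (g := L) (f := Prod.fst) (0, 1) hL contDiffAt_fst
    have h2 : ContDiffAt ℝ s (fun p : ℝ × ℂ => p.2 • (1 : B →L[ℂ] B)) (0, 1) :=
      contDiffAt_snd.smul contDiffAt_const
    exact (h2.sub h1).add contDiffAt_const
  have hM0 : M (0, 1) = 1 - L 0 + rankOne φ h := by simp [hM]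
  obtain ⟨U, hU⟩ := hu
  have hinv : ContDiffAt ℝ s (fun p => Ring.inverse (M p)) (0, 1) := by
    refine ContDiffAt.comp (g := Ring.inverse) (0, 1) ?_ hMc
    rw [hM0, ← hU]
    exact contDiffAt_ringInverse ℝ U
  set ev : (B →L[ℂ] B) →L[ℂ] ℂ := φ.comp (ContinuousLinearMap.apply ℂ B h) with hev
  -- If x = M⁻¹h satisfies φ x = 1, then (λ - L t) x = h - φ(x) h = 0, so g = 1 is an equation for
  -- an eigenvalue of L t. At t = 0, M(0, z) h = z h gives g(0, z) = z⁻¹, whose derivative at 1 is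
  -- -1; the implicit function theorem then solves for λ(t).
  set g : ℝ × ℂ → ℂ := fun p => φ (Ring.inverse (M p) h) with hg
  have hgc : ContDiffAt ℝ s g (0, 1) :=
    ContDiffAt.comp (g := ev.restrictScalars ℝ) (0, 1)
      (ev.restrictScalars ℝ).contDiff.contDiffAt hinv
  have hs' : (s : WithTop ℕ∞) ≠ 0 := by exact_mod_cast hs
  have hgd := (hgc.differentiableAt hs').hasFDerivAt
  have hMunit : ∀ᶠ z : ℂ in 𝓝 1, IsUnit (M (0, z)) := by
    have hcont : ContinuousAt (fun z : ℂ => M (0, z)) 1 :=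
      ContinuousAt.comp (f := fun z : ℂ => ((0 : ℝ), z)) (g := M) hMc.continuousAt (by fun_prop)
    refine hcont.eventually_mem (Units.isOpen.mem_nhds ?_)
    exact ⟨U, by rw [hU, hM0]⟩
  have hg0 : (fun z : ℂ => g (0, z)) =ᶠ[𝓝 1] fun z => z⁻¹ := by
    filter_upwards [hMunit, eventually_ne_nhds (one_ne_zero (α := ℂ))] with z hz hz0
    have h1 : M (0, z) h = z • h := by simp [hM, hTh, hφh]
    have h2 : Ring.inverse (M (0, z)) h = z⁻¹ • h := by
      have h3 : Ring.inverse (M (0, z)) (M (0, z) h) = h := by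
        rw [← mul_apply_eq_comp, Ring.inverse_mul_cancel _ hz, one_apply_eq_self]
      rw [h1, map_smul] at h3
      rw [← h3, smul_smul, inv_mul_cancel₀ hz0, one_smul]
      simp [h3]
    simp [hg, h2, hφh]
  have hd1 : HasFDerivAt (fun z : ℂ => g (0, z)) (fderiv ℝ g (0, 1) ∘L .inr ℝ ℝ ℂ) 1 :=
    HasFDerivAt.comp (f := fun z : ℂ => ((0 : ℝ), z)) 1 hgd (hasFDerivAt_prodMk_right 0 1)
  have hd2 : HasFDerivAt (fun z : ℂ => g (0, z))
      ((ContinuousLinearEquiv.neg ℝ : ℂ ≃L[ℝ] ℂ) : ℂ →L[ℝ] ℂ) 1 := by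
    have h3 : HasDerivAt (fun z : ℂ => z⁻¹) (-((1 : ℂ) ^ 2)⁻¹) 1 := hasDerivAt_inv one_ne_zero
    have h4 := (h3.hasFDerivAt.restrictScalars ℝ).congr_of_eventuallyEq hg0
    have h5 : ((ContinuousLinearEquiv.neg ℝ : ℂ ≃L[ℝ] ℂ) : ℂ →L[ℝ] ℂ)
        = (ContinuousLinearMap.toSpanSingleton ℂ (-((1 : ℂ) ^ 2)⁻¹)).restrictScalars ℝ :=
      ContinuousLinearMap.ext fun z => by simp
    rw [h5]
    exact h4
  have hinvtb : (fderiv ℝ g (0, 1) ∘L .inr ℝ ℝ ℂ).IsInvertible :=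
    ⟨_, (hd1.unique hd2).symm⟩
  refine ⟨hgc.implicitFunction hs' hinvtb, hgc.contDiffAt_implicitFunction hs' hinvtb,
    hgc.implicitFunction_apply_self hs' hinvtb, ?_⟩
  filter_upwards [hgc.eventually_apply_implicitFunction hs' hinvtb] with t ht
  have h5 : g (0, 1) = 1 := by
    have := hg0.self_of_nhds
    simpa using this
  rw [h5] at ht
  exact ht

/-- Spectral decomposition of `L t ^ N` for small `t`: a smooth leading eigenvalue, a smooth rank
one projection and an exponentially small remainder. -/
lemma exists_spectral_decomposition {L : ℝ → B →L[ℂ] B} {s : ℕ} (hs : s ≠ 0)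
    (hL : ContDiffAt ℝ s L 0) (hA2 : CondA2 (L 0)) :
    ∃ (lam : ℝ → ℂ) (Q Λ : ℝ → B →L[ℂ] B), ContDiffAt ℝ s lam 0 ∧ lam 0 = 1 ∧
      ContDiffAt ℝ s Q 0 ∧ ContDiffAt ℝ s Λ 0 ∧ spectrum ℂ (Λ 0) ⊆ {z : ℂ | ‖z‖ < 1} ∧
      ∀ᶠ t in 𝓝 (0 : ℝ), ∀ N : ℕ, 1 ≤ N → L t ^ N = lam t ^ N • Q t + Λ t ^ N := by
  obtain ⟨h, φ, hφh, hTh, hφT, hu⟩ := hA2.exists_eigenvectors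
  obtain ⟨lam, hlam, hlam0, hev⟩ := exists_eigenvalue_branch hs hL hφh hTh hu
  set P := rankOne φ h with hP
  set M : ℝ → B →L[ℂ] B := fun t => lam t • 1 - L t + P with hM
  have hMc : ContDiffAt ℝ s M 0 := ((hlam.smul contDiffAt_const).sub hL).add contDiffAt_const
  have hM0 : M 0 = 1 - L 0 + P := by simp [hM, hlam0]
  have hu0 : IsUnit (M 0) := by rwa [hM0]
  have hinv : ContDiffAt ℝ s (fun t => Ring.inverse (M t)) 0 := by
    refine ContDiffAt.comp (g := Ring.inverse) 0 ?_ hMc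
    obtain ⟨U, hU⟩ := hu0
    rw [← hU]
    exact contDiffAt_ringInverse ℝ U
  set J : ℝ → B →L[ℂ] B := fun t => Ring.inverse (M t) with hJ
  have hunit : ∀ᶠ t in 𝓝 (0 : ℝ), IsUnit (M t) :=
    hMc.continuousAt.eventually_mem (Units.isOpen.mem_nhds hu0)
  set ev : (B →L[ℂ] B) →L[ℂ] ℂ := φ.comp (ContinuousLinearMap.apply ℂ B h) with hev'
  set c : ℝ → ℂ := fun t => φ ((J t * J t) h) with hc
  have hcc : ContDiffAt ℝ s c 0 :=
    ContDiffAt.comp (g := ev.restrictScalars ℝ) 0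
      (ev.restrictScalars ℝ).contDiff.contDiffAt (hinv.mul hinv)
  have hJ1 : ∀ t, IsUnit (M t) → M t * J t = 1 := fun t ht => Ring.mul_inverse_cancel _ ht
  have hJ2 : ∀ t, IsUnit (M t) → J t * M t = 1 := fun t ht => Ring.inverse_mul_cancel _ ht
  have hMP : M 0 * P = P := by
    rw [hM0]; ext x; simp [hP, hTh, hφh]
  have hPM : P * M 0 = P := by
    rw [hM0]; ext x; simp [hP, hφT, hφh]
  have hJP : J 0 * P = P := by
    conv_lhs => rw [← hMP]
    rw [← mul_assoc, hJ2 0 hu0, one_mul]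
  have hPJ : P * J 0 = P := by
    conv_lhs => rw [← hPM]
    rw [mul_assoc, hJ1 0 hu0, mul_one]
  have hJh : J 0 h = h := by
    have := congrArg (fun T : B →L[ℂ] B => T h) hJP
    simpa [hP, hφh] using this
  have hc0 : c 0 = 1 := by simp [hc, hJh, hφh]
  have hcne : ∀ᶠ t in 𝓝 (0 : ℝ), c t ≠ 0 :=
    hcc.continuousAt.eventually_ne (by rw [hc0]; exact one_ne_zero)
  -- J h is a right and φ ∘ J a left eigenvector of L t: both follow from L t = λ + P - M and P J P
  -- = P, the latter being the equation defining λ. Since (J P J)² = c J P J, dividing by c gives a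
  -- projection, equal to P at t = 0.
  set Q : ℝ → B →L[ℂ] B := fun t => (c t)⁻¹ • (J t * P * J t) with hQ
  have hQc : ContDiffAt ℝ s Q 0 :=
    (hcc.inv (by rw [hc0]; exact one_ne_zero)).smul ((hinv.mul contDiffAt_const).mul hinv)
  have hQ0 : Q 0 = P := by simp [hQ, hc0, hJP, hPJ]
  refine ⟨lam, Q, fun t => L t - lam t • Q t, hlam, hlam0, hQc, hL.sub (hlam.smul hQc), ?_, ?_⟩
  · simp only [hQ0, hlam0, one_smul]
    exact hA2.spectrum_sub_rankOne_subset hφh hTh hφT hu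
  · filter_upwards [hev, hunit, hcne] with t h1 h2 h3 N hN
    have hPJP : P * J t * P = P := by
      rw [hP, rankOne_mul_mul_rankOne]
      change φ (Ring.inverse (M t) h) • _ = _
      rw [h1, one_smul]
    have e : L t = lam t • 1 + P - M t := by simp only [hM]; abel
    refine sub_smul_pow_of_idempotent ?_ ?_ ?_ hN
    · simp only [hQ]
      rw [smul_mul_assoc, mul_smul_comm, smul_smul]
      have : J t * P * J t * (J t * P * J t) = c t • (J t * P * J t) := by
        calc J t * P * J t * (J t * P * J t) = J t * (P * (J t * J t) * P) * J t := by
              simp only [mul_assoc]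
          _ = _ := by
              rw [hP, rankOne_mul_mul_rankOne, mul_smul_comm, smul_mul_assoc]
      rw [this, smul_smul]
      congr 1
      field_simp
    · simp only [hQ]
      rw [mul_smul_comm, smul_comm]
      congr 1
      rw [← mul_assoc, ← mul_assoc, e, sub_mul, add_mul, hJ1 t h2, sub_mul, add_mul, hPJP,
        one_mul, smul_mul_assoc, smul_mul_assoc, one_mul, add_sub_cancel_right, smul_mul_assoc]
    · simp only [hQ]
      rw [smul_mul_assoc, smul_comm]
      congr 1
      have h4 : P * (J t * L t) = lam t • (P * J t) := by
        rw [e, mul_sub, mul_add, hJ2 t h2, mul_sub, mul_add, ← mul_assoc P (J t) P, hPJP, mul_one,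
          mul_smul_comm, mul_smul_comm, mul_one, add_sub_cancel_right]
      rw [mul_assoc, mul_assoc, h4, mul_smul_comm, ← mul_assoc]

/-- The resulting expansion of the scalar quantities `ℓ (L t ^ N v)`. -/
lemma exists_scalar_decomposition {L : ℝ → B →L[ℂ] B} {s : ℕ} (hs : s ≠ 0)
    (hL : ContDiffAt ℝ s L 0) (hA2 : CondA2 (L 0)) (v : B) (l : B →L[ℂ] ℂ) :
    ∃ (lam Z : ℝ → ℂ) (R : ℕ → ℝ → ℂ) (C κ : ℝ), ContDiffAt ℝ s lam 0 ∧ lam 0 = 1 ∧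
      ContDiffAt ℝ s Z 0 ∧ 0 < C ∧ 0 < κ ∧ κ < 1 ∧
      ∀ᶠ t in 𝓝 (0 : ℝ), ∀ N : ℕ, 1 ≤ N → l ((L t ^ N) v) = lam t ^ N * Z t + R N t ∧
        ‖R N t‖ ≤ C * κ ^ N ∧ ‖R N t - R N 0‖ ≤ C * κ ^ N * |t| := by
  obtain ⟨lam, Q, Λ, h1, h2, h3, h4, h5, h6⟩ := exists_spectral_decomposition hs hL hA2
  obtain ⟨C, κ, hC, hκ0, hκ1, hpow⟩ := eventually_norm_pow_le h4.continuousAt h5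
  obtain ⟨C', κ', hC', hκκ', hκ'1, hn⟩ := exists_natCast_mul_pow_le hκ0 hκ1
  have hs1 : (s : WithTop ℕ∞) ≠ 0 := by exact_mod_cast hs
  obtain ⟨K, hK⟩ := ((h4.differentiableAt hs1).isBigO_sub).bound
  have hκ'0 : 0 < κ' := hκ0.trans_le hκκ'
  set ev : (B →L[ℂ] B) →L[ℂ] ℂ := l.comp (ContinuousLinearMap.apply ℂ B v) with hev
  have hQc : ContDiffAt ℝ s (fun t => l (Q t v)) 0 :=
    ContDiffAt.comp (g := ev.restrictScalars ℝ) 0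
      (ev.restrictScalars ℝ).contDiff.contDiffAt h3
  refine ⟨lam, fun t => l (Q t v), fun N t => l ((Λ t ^ N) v),
    ‖l‖ * C * ‖v‖ + ‖l‖ * (C ^ 2 / κ * C' * |K|) * ‖v‖ + 1, κ', h1, h2, hQc, by positivity, hκ'0,
    hκ'1, ?_⟩
  have hnn : ∀ T : B →L[ℂ] B, ‖l (T v)‖ ≤ ‖l‖ * ‖T‖ * ‖v‖ := by
    intro T
    calc ‖l (T v)‖ ≤ ‖l‖ * ‖T v‖ := l.le_opNorm _
      _ ≤ ‖l‖ * (‖T‖ * ‖v‖) := by gcongr; exact T.le_opNorm v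
      _ = _ := by ring
  have hpow0 := hpow.self_of_nhds
  filter_upwards [h6, hpow, hK] with t e1 e2 e3 N hN
  refine ⟨by rw [e1 N hN]; simp, ?_, ?_⟩
  · calc ‖l ((Λ t ^ N) v)‖ ≤ ‖l‖ * ‖Λ t ^ N‖ * ‖v‖ := hnn _
      _ ≤ ‖l‖ * (C * κ ^ N) * ‖v‖ := by gcongr; exact e2 N
      _ ≤ ‖l‖ * (C * κ' ^ N) * ‖v‖ := by gcongr
      _ = (‖l‖ * C * ‖v‖) * κ' ^ N := by ring
      _ ≤ _ := by
        gcongr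
        have : 0 ≤ ‖l‖ * (C ^ 2 / κ * C' * |K|) * ‖v‖ := by positivity
        linarith
  -- The factor |t| gained from differentiability of Λ at 0 is needed later to cancel the singular
  -- weight 1/|t| of the smoothing inequality.
  · have e4 : ‖Λ t - Λ 0‖ ≤ |K| * |t| := by
      refine e3.trans ?_
      rw [sub_zero, Real.norm_eq_abs]
      gcongr
      exact le_abs_self K
    calc ‖l ((Λ t ^ N) v) - l ((Λ 0 ^ N) v)‖ = ‖l ((Λ t ^ N - Λ 0 ^ N) v)‖ := by simp
      _ ≤ ‖l‖ * ‖Λ t ^ N - Λ 0 ^ N‖ * ‖v‖ := hnn _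
      _ ≤ ‖l‖ * (N * (C ^ 2 / κ * κ ^ N) * ‖Λ t - Λ 0‖) * ‖v‖ := by
          gcongr
          exact norm_pow_sub_pow_le hC.le hκ0 e2 hpow0 N
      _ = ‖l‖ * (C ^ 2 / κ * (N * κ ^ N) * ‖Λ t - Λ 0‖) * ‖v‖ := by ring
      _ ≤ ‖l‖ * (C ^ 2 / κ * (C' * κ' ^ N) * (|K| * |t|)) * ‖v‖ := by
          gcongr ‖l‖ * (C ^ 2 / κ * ?_ * ?_) * ‖v‖
          exact hn N
      _ = (‖l‖ * (C ^ 2 / κ * C' * |K|) * ‖v‖) * κ' ^ N * |t| := by ring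
      _ ≤ _ := by
        gcongr
        have : 0 ≤ ‖l‖ * C * ‖v‖ := by positivity
        linarith

end Perturbation
end AvgEdgeworth

namespace AvgEdgeworth

/-! ### Logarithm of the eigenvalue, mean, variance and the central limit theorem. -/

section ScalarExpansion

open Topology Polynomial

lemma exists_taylor_polynomial {f : ℝ → ℂ} {n : ℕ} (hf : ContDiffAt ℝ n f 0) :
    ∃ p : ℂ[X], (fun t : ℝ => f t - p.eval (t : ℂ)) =o[𝓝 0] fun t : ℝ => t ^ n := by
  obtain ⟨u, hu, hfu⟩ := hf.contDiffOn (m := n) le_rfl (by simp)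
  obtain ⟨ε, hε, hball⟩ := Metric.mem_nhds_iff.mp hu
  have h := taylor_isLittleO (convex_ball (0 : ℝ) ε) (Metric.mem_ball_self hε)
    (hfu.mono hball)
  rw [Metric.isOpen_ball.nhdsWithin_eq (Metric.mem_ball_self hε)] at h
  refine ⟨∑ k ∈ Finset.range (n + 1), Polynomial.monomial k
    (((k.factorial : ℝ)⁻¹ : ℂ) * iteratedDerivWithin k f (Metric.ball 0 ε) 0), ?_⟩
  simp only [sub_zero] at h
  refine h.congr_left fun t => ?_
  rw [taylor_within_apply, Polynomial.eval_finsetSum]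
  congr 1
  refine Finset.sum_congr rfl fun k _ => ?_
  rw [Polynomial.eval_monomial, Complex.real_smul]
  push_cast
  ring

/-- The neighbourhood filter is not punctured, so the estimate also holds at t = 0, where t ^ n
vanishes. -/
lemma eq_zero_of_isLittleO_pow {f : ℝ → ℂ} {n : ℕ} (hn : n ≠ 0)
    (h : f =o[𝓝 0] fun t : ℝ => t ^ n) : f 0 = 0 := by
  have := (h.bound one_pos).self_of_nhds
  simpa [hn] using this

/-- Data describing `φ N t = E exp (i t S_N)` near `t = 0`. -/
structure ExpansionData (φ : ℕ → ℝ → ℂ) (r : ℕ) (A : ℝ) (σsq : ℝ≥0) where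
  χ : ℝ → ℂ
  Z : ℝ → ℂ
  p : ℂ[X]
  b : ℂ[X]
  C : ℝ
  κ : ℝ
  C_pos : 0 < C
  κ_pos : 0 < κ
  κ_lt : κ < 1
  χ_zero : χ 0 = 0
  Z_zero : Z 0 = 1
  χ_sub : (fun t : ℝ => χ t - p.eval (t : ℂ)) =o[𝓝 0] fun t : ℝ => t ^ r
  Z_sub : (fun t : ℝ => Z t - b.eval (t : ℂ)) =o[𝓝 0] fun t : ℝ => t ^ r
  approx : ∀ᶠ t in 𝓝 (0 : ℝ), ∀ N : ℕ, 1 ≤ N →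
    ‖φ N t - Complex.exp (N * (Complex.I * A * t - σsq * t ^ 2 / 2 + t ^ 2 * χ t)) * Z t‖
      ≤ C * κ ^ N * |t|

lemma tendsto_zero_of_isLittleO_pow {f : ℝ → ℂ} {p : ℂ[X]} {n : ℕ}
    (h : (fun t : ℝ => f t - p.eval (t : ℂ)) =o[𝓝 0] fun t : ℝ => t ^ n) (hn : n ≠ 0) :
    Tendsto f (𝓝 0) (𝓝 (f 0)) := by
  have h0 := eq_zero_of_isLittleO_pow hn h
  have h1 : Tendsto (fun t : ℝ => t ^ n) (𝓝 0) (𝓝 0) := by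
    have : Continuous fun t : ℝ => t ^ n := by fun_prop
    simpa [hn] using this.tendsto 0
  have h2 := h.trans_tendsto h1
  have h3 : Tendsto (fun t : ℝ => p.eval (t : ℂ)) (𝓝 0) (𝓝 (p.eval ((0 : ℝ) : ℂ))) :=
    (p.continuous.comp Complex.continuous_ofReal).tendsto 0
  have h4 := h2.add h3
  simp only [sub_add_cancel, zero_add] at h4
  rw [← sub_eq_zero.mp h0] at h4
  exact h4

lemma tendsto_const_div_sqrt (u : ℝ) : Tendsto (fun N : ℕ => u / √(N : ℝ)) atTop (𝓝 0) :=
  Tendsto.div_atTop tendsto_const_nhds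
    (Real.tendsto_sqrt_atTop.comp tendsto_natCast_atTop_atTop)

/-- The central limit theorem for the characteristic functions, with a complex variance. -/
lemma tendsto_charFun_of_approx {φ : ℕ → ℝ → ℂ} {A : ℝ} {c : ℂ} {χ Z : ℝ → ℂ} {C κ : ℝ}
    (h0 : 0 < κ) (h1 : κ < 1) (hχ : Tendsto χ (𝓝 0) (𝓝 0)) (hZ : Tendsto Z (𝓝 0) (𝓝 1))
    (happ : ∀ᶠ t in 𝓝 (0 : ℝ), ∀ N : ℕ, 1 ≤ N →
      ‖φ N t - Complex.exp (N * (Complex.I * A * t + c * t ^ 2 + t ^ 2 * χ t)) * Z t‖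
        ≤ C * κ ^ N * |t|) (u : ℝ) :
    Tendsto (fun N : ℕ => Complex.exp (-(Complex.I * A * √(N : ℝ) * u)) * φ N (u / √(N : ℝ)))
      atTop (𝓝 (Complex.exp (c * u ^ 2))) := by
  have ht := tendsto_const_div_sqrt u
  set g : ℕ → ℂ := fun N => Complex.exp (c * u ^ 2 + u ^ 2 * χ (u / √(N : ℝ))) * Z (u / √(N : ℝ))
    with hg
  have hg1 : Tendsto g atTop (𝓝 (Complex.exp (c * u ^ 2))) := by
    have e1 : Tendsto (fun N : ℕ => Complex.exp (c * u ^ 2 + u ^ 2 * χ (u / √(N : ℝ)))) atTop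
        (𝓝 (Complex.exp (c * u ^ 2 + u ^ 2 * 0))) :=
      (Complex.continuous_exp.tendsto _).comp
        (tendsto_const_nhds.add (tendsto_const_nhds.mul (hχ.comp ht)))
    have := e1.mul (hZ.comp ht)
    simpa using this
  have herr : Tendsto (fun N : ℕ =>
      Complex.exp (-(Complex.I * A * √(N : ℝ) * u)) * φ N (u / √(N : ℝ)) - g N) atTop (𝓝 0) := by
    have hb : Tendsto (fun N : ℕ => C * κ ^ N * |u / √(N : ℝ)|) atTop (𝓝 0) := by
      have := ((tendsto_pow_atTop_nhds_zero_of_lt_one h0.le h1).const_mul C).mul ht.abs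
      simpa using this
    refine squeeze_zero_norm' ?_ hb
    filter_upwards [ht.eventually happ, eventually_ge_atTop 1] with N hN hN1
    have hNpos : (0 : ℝ) < N := by exact_mod_cast hN1
    have hs0 : (√(N : ℝ) : ℂ) ≠ 0 := by
      exact_mod_cast (Real.sqrt_pos.mpr hNpos).ne'
    have hs : (√(N : ℝ) : ℂ) ^ 2 = N := by
      rw [← Complex.ofReal_pow, Real.sq_sqrt hNpos.le]; simp
    have e2 : g N = Complex.exp (-(Complex.I * A * √(N : ℝ) * u)) *
        (Complex.exp (N * (Complex.I * A * (u / √(N : ℝ) : ℝ) + c * (u / √(N : ℝ) : ℝ) ^ 2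
          + (u / √(N : ℝ) : ℝ) ^ 2 * χ (u / √(N : ℝ)))) * Z (u / √(N : ℝ))) := by
      rw [← mul_assoc, ← Complex.exp_add]
      simp only [hg]
      congr 2
      push_cast
      rw [← hs]
      field_simp
      ring
    rw [e2, ← mul_sub, norm_mul]
    have e3 : ‖Complex.exp (-(Complex.I * A * √(N : ℝ) * u))‖ = 1 := by
      rw [Complex.norm_exp]; simp
    rw [e3, one_mul]
    exact hN N hN1
  have := herr.add hg1
  simpa using this

/-- If Im c ≠ 0, some u gives Im(c u²) = ±π/2, where the exponential is not real. -/
lemma ofReal_of_exp_mul_sq_conj {c : ℂ}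
    (h : ∀ u : ℝ, (starRingEnd ℂ) (Complex.exp (c * u ^ 2)) = Complex.exp (c * u ^ 2)) :
    c.im = 0 := by
  by_contra hne
  have hpos : 0 < |c.im| := abs_pos.mpr hne
  set u : ℝ := √(Real.pi / 2 / |c.im|) with hu
  have hu2 : u ^ 2 = Real.pi / 2 / |c.im| := Real.sq_sqrt (by positivity)
  have h1 := h u
  rw [Complex.conj_eq_iff_im, Complex.exp_im] at h1
  have him : (c * (u : ℂ) ^ 2).im = c.im * u ^ 2 := by
    rw [← Complex.ofReal_pow, Complex.im_mul_ofReal]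
  rw [him, hu2] at h1
  rcases mul_eq_zero.mp h1 with h2 | h2
  · exact (Real.exp_pos _).ne' h2
  · rcases abs_cases c.im with ⟨h3, _⟩ | ⟨h3, _⟩
    · have : c.im * (Real.pi / 2 / |c.im|) = Real.pi / 2 := by rw [h3]; field_simp
      rw [this, Real.sin_pi_div_two] at h2
      exact one_ne_zero h2
    · have : c.im * (Real.pi / 2 / |c.im|) = -(Real.pi / 2) := by rw [h3]; field_simp
      rw [this, Real.sin_neg, Real.sin_pi_div_two] at h2
      norm_num at h2

/-- A smooth leading eigenvalue gives the expansion data and the central limit theorem. -/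
theorem exists_expansionData {φ : ℕ → ℝ → ℂ} {r : ℕ} (hr : 1 ≤ r)
    (hφ1 : ∀ N t, ‖φ N t‖ ≤ 1) (hφ0 : ∀ N, φ N 0 = 1)
    (hφc : ∀ N t, (starRingEnd ℂ) (φ N t) = φ N (-t))
    {lam Z : ℝ → ℂ} {R : ℕ → ℝ → ℂ} {C κ : ℝ} (hlam : ContDiffAt ℝ (r + 2 : ℕ) lam 0)
    (hlam0 : lam 0 = 1) (hZ : ContDiffAt ℝ (r + 2 : ℕ) Z 0) (hC : 0 < C) (hκ0 : 0 < κ) (hκ1 : κ < 1)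
    (hdec : ∀ᶠ t in 𝓝 (0 : ℝ), ∀ N : ℕ, 1 ≤ N → φ N t = lam t ^ N * Z t + R N t ∧
        ‖R N t‖ ≤ C * κ ^ N ∧ ‖R N t - R N 0‖ ≤ C * κ ^ N * |t|) :
    ∃ (A : ℝ) (σsq : ℝ≥0), Nonempty (ExpansionData φ r A σsq) ∧ ∀ u : ℝ,
      Tendsto (fun N : ℕ => Complex.exp (-(Complex.I * A * √(N : ℝ) * u)) * φ N (u / √(N : ℝ)))
        atTop (𝓝 (Complex.exp (-(σsq * u ^ 2) / 2))) := by
  have hpowκ := tendsto_pow_atTop_nhds_zero_of_lt_one hκ0.le hκ1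
  have hR0 : ∀ N : ℕ, 1 ≤ N → R N 0 = 1 - Z 0 := by
    intro N hN
    have := (hdec.self_of_nhds N hN).1
    rw [hφ0, hlam0] at this
    linear_combination -this
  -- At t = 0 the remainder is 1 - Z 0 for every N and also decays exponentially, so it vanishes.
  -- The Lipschitz bound then becomes a bound on R N t itself.
  have hZ0 : Z 0 = 1 := by
    have h1 : Tendsto (fun N : ℕ => C * κ ^ N) atTop (𝓝 0) := by simpa using hpowκ.const_mul C
    have h2 : ‖1 - Z 0‖ ≤ 0 := by
      refine ge_of_tendsto h1 ?_
      filter_upwards [eventually_ge_atTop 1] with N hN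
      rw [← hR0 N hN]
      exact (hdec.self_of_nhds N hN).2.1
    have h3 := norm_le_zero_iff.mp h2
    exact (sub_eq_zero.mp h3).symm
  have hR0' : ∀ N : ℕ, 1 ≤ N → R N 0 = 0 := fun N hN => by rw [hR0 N hN, hZ0, sub_self]
  -- Otherwise lam t ^ N * Z t would be unbounded in N, while φ N t and R N t are bounded.
  have hlamle : ∀ᶠ t in 𝓝 (0 : ℝ), ‖lam t‖ ≤ 1 := by
    have hZne : ∀ᶠ t in 𝓝 (0 : ℝ), Z t ≠ 0 :=
      hZ.continuousAt.eventually_ne (by rw [hZ0]; exact one_ne_zero)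
    filter_upwards [hdec, hZne] with t h1 h2
    by_contra hcon
    have hgt : 1 < ‖lam t‖ := not_le.mp hcon
    have h3 := (tendsto_pow_atTop_atTop_of_one_lt hgt).eventually_gt_atTop ((1 + C) / ‖Z t‖)
    obtain ⟨N, hN, hN1⟩ := (h3.and (eventually_ge_atTop 1)).exists
    obtain ⟨e1, e2, -⟩ := h1 N hN1
    have e3 : ‖lam t ^ N * Z t‖ ≤ 1 + C := by
      have : lam t ^ N * Z t = φ N t - R N t := by rw [e1]; ring
      rw [this]
      refine (norm_sub_le _ _).trans (add_le_add (hφ1 N t) (e2.trans ?_))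
      have : κ ^ N ≤ 1 := pow_le_one₀ hκ0.le hκ1.le
      nlinarith
    rw [norm_mul, norm_pow] at e3
    rw [div_lt_iff₀ (norm_pos_iff.mpr h2)] at hN
    linarith
  set ψ : ℝ → ℂ := fun t => Complex.log (lam t) with hψ
  have hψc : ContDiffAt ℝ (r + 2 : ℕ) ψ 0 := by
    have h1 : ContDiffAt ℂ (r + 2 : ℕ) Complex.log (lam 0) :=
      Complex.contDiffAt_log (by rw [hlam0]; exact Complex.one_mem_slitPlane)
    exact ContDiffAt.comp (0 : ℝ) (h1.restrict_scalars ℝ) hlam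
  have hlamexp : ∀ᶠ t in 𝓝 (0 : ℝ), lam t = Complex.exp (ψ t) := by
    filter_upwards [hlam.continuousAt.eventually_ne (by rw [hlam0]; exact one_ne_zero)] with t ht
    exact (Complex.exp_log ht).symm
  have hψre : ∀ᶠ t in 𝓝 (0 : ℝ), (ψ t).re ≤ 0 := by
    filter_upwards [hlamle, hlamexp] with t h1 h2
    rw [h2, Complex.norm_exp, Real.exp_le_one_iff] at h1
    exact h1
  have hψ0 : ψ 0 = 0 := by simp [hψ, hlam0]
  obtain ⟨p₀, hp₀⟩ := exists_taylor_polynomial hψc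
  have hc0 : p₀.coeff 0 = 0 := by
    have := eq_zero_of_isLittleO_pow (by omega) hp₀
    rw [hψ0] at this
    rw [Polynomial.coeff_zero_eq_eval_zero]
    simpa using this
  set p₁ := p₀.divX with hp₁
  set p₂ := p₁.divX with hp₂
  set p₃ := p₂.divX with hp₃
  set c := p₂.coeff 0 with hc
  have hpeval : ∀ z : ℂ, p₀.eval z = z * (p₁.coeff 0) + c * z ^ 2 + z ^ 2 * (z * p₃.eval z) := by
    intro z
    have e1 : p₀ = X * (X * (X * p₃ + Polynomial.C c) + Polynomial.C (p₁.coeff 0)) := by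
      rw [hp₃, hc, Polynomial.X_mul_divX_add, hp₂, Polynomial.X_mul_divX_add, hp₁]
      conv_lhs => rw [← Polynomial.X_mul_divX_add p₀, hc0, map_zero, add_zero]
    rw [e1]
    simp only [Polynomial.eval_mul, Polynomial.eval_add, Polynomial.eval_X, Polynomial.eval_C]
    ring
  have hderiv : HasDerivAt ψ (p₁.coeff 0) 0 := by
    have e1 : HasDerivAt (fun t : ℝ => ψ t - p₀.eval (t : ℂ)) 0 0 := by
      rw [hasDerivAt_iff_isLittleO_nhds_zero]
      have e2 := hp₀.trans (isLittleO_pow_id (by omega : 1 < r + 2))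
      have e3 := eq_zero_of_isLittleO_pow (by omega) hp₀
      simp only [zero_add, e3, smul_zero, sub_zero]
      exact e2
    have e2 : HasDerivAt (fun t : ℝ => p₀.eval (t : ℂ)) (p₀.derivative.eval ((0 : ℝ) : ℂ)) 0 :=
      (p₀.hasDerivAt ((0 : ℝ) : ℂ)).comp_ofReal
    have e3 : p₀.derivative.eval ((0 : ℝ) : ℂ) = p₁.coeff 0 := by
      rw [Complex.ofReal_zero, ← Polynomial.coeff_zero_eq_eval_zero, Polynomial.coeff_derivative,
        hp₁, Polynomial.coeff_divX]
      simp
    have e4 := e1.add e2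
    rw [e3, zero_add] at e4
    refine e4.congr_of_eventuallyEq (Eventually.of_forall fun t => ?_)
    simp
  -- Re ψ ≤ 0 near 0 with equality at 0, so 0 is a local maximum; the first coefficient is thus
  -- purely imaginary, equal to iA.
  have hre : (p₁.coeff 0).re = 0 := by
    have h1 : HasDerivAt (fun t : ℝ => (ψ t).re) (p₁.coeff 0).re 0 :=
      Complex.reCLM.hasFDerivAt.comp_hasDerivAt (0 : ℝ) hderiv
    refine IsLocalMax.hasDerivAt_eq_zero (f := fun t : ℝ => (ψ t).re) (a := 0) ?_ h1
    filter_upwards [hψre] with t ht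
    simpa [hψ0] using ht
  set A : ℝ := (p₁.coeff 0).im with hA
  have hIA : p₁.coeff 0 = Complex.I * A := by
    apply Complex.ext
    · simp [hre]
    · simp [hA]
  -- Dividing by t² costs two orders: r + 2 derivatives of ψ leave an expansion of χ up to o(t^r).
  -- Division by zero gives χ 0 = 0, the correct value.
  set χ : ℝ → ℂ := fun t => (ψ t - Complex.I * A * t - c * t ^ 2) / t ^ 2 with hχ
  have hψχ : ∀ t : ℝ, ψ t = Complex.I * A * t + c * t ^ 2 + t ^ 2 * χ t := by
    intro t
    by_cases ht : t = 0
    · simp [ht, hψ0]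
    · have : (t : ℂ) ≠ 0 := by exact_mod_cast ht
      simp only [hχ]
      field_simp
      ring
  have hχp : (fun t : ℝ => χ t - (X * p₃).eval (t : ℂ)) =o[𝓝 0] fun t : ℝ => t ^ r := by
    rw [isLittleO_iff]
    intro ε hε
    filter_upwards [hp₀.bound hε] with t ht
    by_cases ht0 : t = 0
    · subst ht0
      simp only [hχ]
      simp
      positivity
    · have h1 : ψ t - p₀.eval (t : ℂ) = t ^ 2 * (χ t - (X * p₃).eval (t : ℂ)) := by
        rw [hpeval, hIA, hψχ t, Polynomial.eval_mul, Polynomial.eval_X]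
        ring
      rw [h1, norm_mul, norm_pow, norm_pow, Complex.norm_real] at ht
      rw [norm_pow]
      have h2 : 0 < ‖t‖ ^ 2 := by positivity
      rw [pow_add] at ht
      nlinarith
  obtain ⟨b, hb⟩ := exists_taylor_polynomial (hZ.of_le (m := (r : ℕ)) (by exact_mod_cast (by omega)))
  have hχ0 : χ 0 = 0 := by simp [hχ]
  have happ : ∀ᶠ t in 𝓝 (0 : ℝ), ∀ N : ℕ, 1 ≤ N →
      ‖φ N t - Complex.exp (N * (Complex.I * A * t + c * t ^ 2 + t ^ 2 * χ t)) * Z t‖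
        ≤ C * κ ^ N * |t| := by
    filter_upwards [hdec, hlamexp] with t h1 h2 N hN
    obtain ⟨e1, -, e3⟩ := h1 N hN
    rw [hR0' N hN, sub_zero] at e3
    rw [← hψχ, Complex.exp_nat_mul, ← h2, e1, add_sub_cancel_left]
    exact e3
  have hclt := tendsto_charFun_of_approx (A := A) (c := c) hκ0 hκ1
    (by simpa [hχ0] using tendsto_zero_of_isLittleO_pow hχp (by omega))
    (by simpa [hZ0] using hZ.continuousAt.tendsto) happ
  -- Conjugating the normalized characteristic functions amounts to u ↦ -u, under which the limit
  -- exp(c u²) is unchanged; so the limit is real.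
  have hcim : c.im = 0 := by
    refine ofReal_of_exp_mul_sq_conj fun u => ?_
    have h1 := (Complex.continuous_conj.tendsto _).comp (hclt u)
    have h2 := hclt (-u)
    have h3 : (fun N : ℕ => Complex.exp (-(Complex.I * A * √(N : ℝ) * (-u : ℝ)))
        * φ N (-u / √(N : ℝ))) = (starRingEnd ℂ) ∘ fun N : ℕ =>
          Complex.exp (-(Complex.I * A * √(N : ℝ) * u)) * φ N (u / √(N : ℝ)) := by
      funext N
      simp only [Function.comp_apply, map_mul, hφc, ← Complex.exp_conj, neg_div]
      simp
    rw [h3] at h2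
    have h4 := tendsto_nhds_unique h1 h2
    rw [h4]
    simp
  have hcre : c.re ≤ 0 := by
    have h1 := (hclt 1).norm
    have h2 : ‖Complex.exp (c * (1 : ℝ) ^ 2)‖ ≤ 1 := by
      refine le_of_tendsto h1 (Eventually.of_forall fun N => ?_)
      rw [norm_mul]
      have e3 : ‖Complex.exp (-(Complex.I * A * √(N : ℝ) * (1 : ℝ)))‖ = 1 := by
        rw [Complex.norm_exp]; simp
      rw [e3, one_mul]
      exact hφ1 _ _
    rw [Complex.norm_exp, Real.exp_le_one_iff] at h2
    simpa using h2
  set σsq : ℝ≥0 := Real.toNNReal (-2 * c.re) with hσ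
  have hσre : (σsq : ℝ) = -2 * c.re := Real.coe_toNNReal _ (by linarith)
  have hcσ : c = -((σsq : ℝ) : ℂ) / 2 := by
    rw [hσre]
    apply Complex.ext
    · simp
    · simp [hcim]
  refine ⟨A, σsq, ⟨⟨χ, Z, X * p₃, b, C, κ, hC, hκ0, hκ1, hχ0, hZ0, hχp, hb, ?_⟩⟩, ?_⟩
  · filter_upwards [happ] with t ht N hN
    convert ht N hN using 6
    rw [hcσ]
    ring
  · intro u
    convert hclt u using 3
    rw [hcσ]
    ring

end ScalarExpansion
end AvgEdgeworth

namespace AvgEdgeworth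

/-! ### Expansions in t, uniform in w = N t², and the Edgeworth approximation. -/

section FormalExpansion

open Topology Polynomial

/-- The filter of pairs `(t, w)` with `t → 0`, uniformly in `w ≥ 0`. -/
def uniformNhds : Filter (ℝ × ℝ) := 𝓝 (0 : ℝ) ×ˢ 𝓟 (Set.Ici (0 : ℝ))

lemma eventually_uniformNhds {P : ℝ × ℝ → Prop} :
    (∀ᶠ q in uniformNhds, P q) ↔ ∀ᶠ t in 𝓝 (0 : ℝ), ∀ w, 0 ≤ w → P (t, w) := by
  rw [uniformNhds, eventually_prod_principal_iff]
  rfl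

lemma tendsto_fst_uniformNhds : Tendsto Prod.fst uniformNhds (𝓝 0) := tendsto_fst

/-- `F (t, w)` agrees with the polynomial `M` up to `o(t ^ r)`, with any exponential weight in the
parameter `w ≥ 0`. -/
def HasExpansion (r : ℕ) (F : ℝ × ℝ → ℂ) (M : ℂ[X][X]) : Prop :=
  ∀ c : ℝ, 0 < c → (fun q : ℝ × ℝ => F q - M.evalEval (q.2 : ℂ) (q.1 : ℂ)) =o[uniformNhds]
    fun q : ℝ × ℝ => q.1 ^ r * Real.exp (c * q.2)

lemma exists_pow_le_mul_exp {c : ℝ} (hc : 0 < c) (n : ℕ) :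
    ∃ K : ℝ, 0 < K ∧ ∀ w : ℝ, 0 ≤ w → w ^ n ≤ K * Real.exp (c * w) := by
  refine ⟨n.factorial / c ^ n, by positivity, fun w hw => ?_⟩
  have h := Real.pow_div_factorial_le_exp (c * w) (by positivity) n
  rw [mul_pow, div_le_iff₀ (by positivity)] at h
  rw [div_mul_eq_mul_div, le_div_iff₀ (by positivity)]
  linarith

lemma exists_norm_eval_le_mul_exp (p : ℂ[X]) {c : ℝ} (hc : 0 < c) :
    ∃ K : ℝ, 0 < K ∧ ∀ w : ℝ, 0 ≤ w → ‖p.eval (w : ℂ)‖ ≤ K * Real.exp (c * w) := by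
  induction p using Polynomial.induction_on' with
  | add p q hp hq =>
    obtain ⟨K, hK, h1⟩ := hp
    obtain ⟨K', hK', h2⟩ := hq
    refine ⟨K + K', by positivity, fun w hw => ?_⟩
    rw [Polynomial.eval_add, add_mul]
    exact (norm_add_le _ _).trans (add_le_add (h1 w hw) (h2 w hw))
  | monomial n a =>
    obtain ⟨K, hK, h1⟩ := exists_pow_le_mul_exp hc n
    refine ⟨(‖a‖ + 1) * K, by positivity, fun w hw => ?_⟩
    rw [Polynomial.eval_monomial, norm_mul, norm_pow, Complex.norm_real, Real.norm_of_nonneg hw,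
      mul_assoc]
    gcongr
    · linarith
    · exact h1 w hw

lemma evalEval_eq_sum (M : ℂ[X][X]) (x y : ℂ) {n : ℕ} (hn : M.natDegree < n) :
    M.evalEval x y = ∑ j ∈ Finset.range n, (M.coeff j).eval x * y ^ j := by
  rw [Polynomial.evalEval, Polynomial.eval_eq_sum_range' hn, Polynomial.eval_finsetSum]
  simp

lemma isBigO_fst_of_tendsto {f : ℝ → ℂ} {a : ℂ} (hf : Tendsto f (𝓝 0) (𝓝 a)) :
    (fun q : ℝ × ℝ => f q.1) =O[uniformNhds] fun _ => (1 : ℝ) :=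
  (hf.comp tendsto_fst).isBigO_one ℝ

lemma isBigO_evalEval (M : ℂ[X][X]) {c : ℝ} (hc : 0 < c) :
    (fun q : ℝ × ℝ => M.evalEval (q.2 : ℂ) (q.1 : ℂ)) =O[uniformNhds]
      fun q : ℝ × ℝ => Real.exp (c * q.2) := by
  simp_rw [evalEval_eq_sum M _ _ (Nat.lt_succ_self _)]
  refine IsBigO.fun_sum fun j _ => ?_
  obtain ⟨K, hK, h1⟩ := exists_norm_eval_le_mul_exp (M.coeff j) hc
  have h2 : (fun q : ℝ × ℝ => (M.coeff j).eval (q.2 : ℂ)) =O[uniformNhds]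
      fun q : ℝ × ℝ => Real.exp (c * q.2) := by
    refine IsBigO.of_bound K (eventually_uniformNhds.mpr (Eventually.of_forall fun t w hw => ?_))
    rw [Real.norm_of_nonneg (Real.exp_pos _).le]
    exact h1 w hw
  have h3 : (fun q : ℝ × ℝ => (q.1 : ℂ) ^ j) =O[uniformNhds] fun _ => (1 : ℝ) :=
    isBigO_fst_of_tendsto (f := fun t : ℝ => (t : ℂ) ^ j)
      (Continuous.tendsto (by fun_prop) 0)
  simpa using h2.mul h3

lemma isBigO_weight {r : ℕ} (c : ℝ) : (fun q : ℝ × ℝ => q.1 ^ r * Real.exp (c * q.2))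
    =O[uniformNhds] fun q : ℝ × ℝ => Real.exp (c * q.2) := by
  have h3 : (fun q : ℝ × ℝ => q.1 ^ r) =O[uniformNhds] fun _ => (1 : ℝ) :=
    ((Continuous.tendsto (by fun_prop : Continuous fun t : ℝ => t ^ r) 0).comp
      tendsto_fst).isBigO_one ℝ
  simpa using h3.mul (isBigO_refl (fun q : ℝ × ℝ => Real.exp (c * q.2)) uniformNhds)

namespace HasExpansion

variable {r : ℕ} {F G : ℝ × ℝ → ℂ} {M N : ℂ[X][X]}

lemma isBigO (hF : HasExpansion r F M) {c : ℝ} (hc : 0 < c) :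
    F =O[uniformNhds] fun q : ℝ × ℝ => Real.exp (c * q.2) := by
  have h1 := ((hF c hc).isBigO.trans (isBigO_weight c)).add (isBigO_evalEval M hc)
  simpa using h1

lemma add (hF : HasExpansion r F M) (hG : HasExpansion r G N) :
    HasExpansion r (fun q => F q + G q) (M + N) := by
  intro c hc
  refine ((hF c hc).add (hG c hc)).congr_left fun q => ?_
  rw [Polynomial.evalEval_add]
  ring

/-- Since every exponential rate is allowed, the weight e^{cw} can be split as e^{cw/2} e^{cw/2},
one half for each factor. -/
lemma mul (hF : HasExpansion r F M) (hG : HasExpansion r G N) :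
    HasExpansion r (fun q => F q * G q) (M * N) := by
  intro c hc
  have h1 := (hF (c / 2) (by positivity)).mul_isBigO (hG.isBigO (c := c / 2) (by positivity))
  have h2 := (isBigO_evalEval M (c := c / 2) (by positivity)).mul_isLittleO
    (hG (c / 2) (by positivity))
  have e : ∀ w : ℝ, Real.exp (c / 2 * w) * Real.exp (c / 2 * w) = Real.exp (c * w) := fun w => by
    rw [← Real.exp_add]; congr 1; ring
  have h1' := h1.congr_right (g₂ := fun q : ℝ × ℝ => q.1 ^ r * Real.exp (c * q.2)) fun q => by
    rw [mul_assoc, e]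
  have h2' := h2.congr_right (g₂ := fun q : ℝ × ℝ => q.1 ^ r * Real.exp (c * q.2)) fun q => by
    rw [mul_left_comm, e]
  refine (h1'.add h2').congr_left fun q => ?_
  rw [Polynomial.evalEval_mul]
  ring

lemma of_eq (h : ∀ q : ℝ × ℝ, F q = M.evalEval (q.2 : ℂ) (q.1 : ℂ)) : HasExpansion r F M := by
  intro c _
  exact (isLittleO_zero _ _).congr_left fun q => by rw [h, sub_self]

lemma const (a : ℂ) : HasExpansion r (fun _ => a) (Polynomial.C (Polynomial.C a)) :=
  of_eq fun q => by rw [Polynomial.evalEval_C, Polynomial.eval_C]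

lemma snd : HasExpansion r (fun q => (q.2 : ℂ)) (Polynomial.C Polynomial.X) :=
  of_eq fun q => by rw [Polynomial.evalEval_C, Polynomial.eval_X]

lemma pow (hF : HasExpansion r F M) (n : ℕ) : HasExpansion r (fun q => F q ^ n) (M ^ n) := by
  induction n with
  | zero => simpa using const (r := r) 1
  | succ n ih => simpa only [pow_succ] using ih.mul hF

lemma sum {ι : Type*} {s : Finset ι} {F : ι → ℝ × ℝ → ℂ} {M : ι → ℂ[X][X]}
    (h : ∀ i ∈ s, HasExpansion r (F i) (M i)) :
    HasExpansion r (fun q => ∑ i ∈ s, F i q) (∑ i ∈ s, M i) := by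
  classical
  induction s using Finset.induction_on with
  | empty => simpa using const (r := r) 0
  | insert a s ha ih =>
    simp only [Finset.sum_insert ha]
    exact (h a (by simp)).add (ih fun i hi => h i (by simp [hi]))

lemma fst {f : ℝ → ℂ} {p : ℂ[X]}
    (h : (fun t : ℝ => f t - p.eval (t : ℂ)) =o[𝓝 0] fun t : ℝ => t ^ r) :
    HasExpansion r (fun q => f q.1) (p.map Polynomial.C) := by
  intro c hc
  have h1 := h.comp_tendsto tendsto_fst_uniformNhds
  have h2 : (fun _ : ℝ × ℝ => (1 : ℂ)) =O[uniformNhds] fun q : ℝ × ℝ => Real.exp (c * q.2) := by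
    refine IsBigO.of_bound 1 (eventually_uniformNhds.mpr (Eventually.of_forall fun t w hw => ?_))
    rw [norm_one, one_mul, Real.norm_of_nonneg (Real.exp_pos _).le]
    exact Real.one_le_exp (by positivity)
  have h3 := h1.mul_isBigO h2
  refine (h3.congr_left fun q => ?_)
  simp [Polynomial.evalEval_map_C]

lemma congr_littleO (hG : HasExpansion r G M) (h : ∀ c : ℝ, 0 < c →
    (fun q => F q - G q) =o[uniformNhds] fun q : ℝ × ℝ => q.1 ^ r * Real.exp (c * q.2)) :
    HasExpansion r F M := by
  intro c hc
  refine ((h c hc).add (hG c hc)).congr_left fun q => ?_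
  ring

end HasExpansion

lemma isBigO_of_isLittleO_pow {f : ℝ → ℂ} {p : ℂ[X]} {r : ℕ} (hr : 1 ≤ r)
    (h : (fun t : ℝ => f t - p.eval (t : ℂ)) =o[𝓝 0] fun t : ℝ => t ^ r) (h0 : f 0 = 0) :
    f =O[𝓝 0] fun t : ℝ => t := by
  have h1 : (fun t : ℝ => t ^ r) =O[𝓝 0] fun t : ℝ => t := by
    refine IsBigO.of_bound 1 ?_
    filter_upwards [Metric.ball_mem_nhds (0 : ℝ) one_pos] with t ht
    rw [norm_pow, one_mul]
    exact pow_le_of_le_one (norm_nonneg t) (mem_ball_zero_iff.mp ht).le (by omega)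
  have h2 : (fun t : ℝ => p.eval (t : ℂ)) =O[𝓝 0] fun t : ℝ => t := by
    have hp0 : p.eval 0 = 0 := by
      have := eq_zero_of_isLittleO_pow (by omega) h
      simpa [h0] using this
    have := ((p.hasDerivAt ((0 : ℝ) : ℂ)).comp_ofReal).differentiableAt.isBigO_sub
    simpa [hp0] using this
  simpa using (h.isBigO.trans h1).add h2

/-- Expansion of `exp (w χ(t))`. -/
lemma HasExpansion.exp {χ : ℝ → ℂ} {p : ℂ[X]} {r : ℕ} (hr : 1 ≤ r)
    (h : (fun t : ℝ => χ t - p.eval (t : ℂ)) =o[𝓝 0] fun t : ℝ => t ^ r) (h0 : χ 0 = 0) :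
    HasExpansion r (fun q => Complex.exp (q.2 * χ q.1))
      (∑ k ∈ Finset.range (r + 1),
        (Polynomial.C Polynomial.X * p.map Polynomial.C) ^ k
          * Polynomial.C (Polynomial.C ((k.factorial : ℂ)⁻¹))) := by
  have hs : HasExpansion r (fun q => ∑ k ∈ Finset.range (r + 1),
      (q.2 * χ q.1) ^ k * ((k.factorial : ℂ)⁻¹)) _ :=
    HasExpansion.sum fun k _ => ((HasExpansion.snd.mul (HasExpansion.fst h)).pow k).mul
      (HasExpansion.const _)
  refine hs.congr_littleO fun c hc => ?_
  have hχ := isBigO_of_isLittleO_pow hr h h0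
  have hχ0 : Tendsto χ (𝓝 0) (𝓝 0) := by
    simpa [h0] using tendsto_zero_of_isLittleO_pow h (by omega)
  -- The exponential remainder is at most w^{r+1} |χ|^{r+1} e^{w|χ|}. Here χ = O(t) gives o(t^r),
  -- and |χ| < c/2 near 0 keeps the growth in w below e^{cw}.
  have e1 : (fun t : ℝ => ‖χ t‖ ^ (r + 1)) =o[𝓝 0] fun t : ℝ => t ^ r :=
    (hχ.norm_left.pow (r + 1)).trans_isLittleO (isLittleO_pow_pow (by omega))
  have e1' := e1.comp_tendsto tendsto_fst_uniformNhds
  obtain ⟨K, hK, hKw⟩ := exists_pow_le_mul_exp (c := c / 2) (by positivity) (r + 1)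
  have e2 : (fun q : ℝ × ℝ => q.2 ^ (r + 1) * Real.exp (q.2 * ‖χ q.1‖)) =O[uniformNhds]
      fun q : ℝ × ℝ => Real.exp (c * q.2) := by
    refine IsBigO.of_bound K (eventually_uniformNhds.mpr ?_)
    filter_upwards [hχ0.norm.eventually_lt_const (u := c / 2) (by rw [norm_zero]; positivity)]
      with t ht w hw
    rw [Real.norm_of_nonneg (by positivity), Real.norm_of_nonneg (by positivity)]
    calc w ^ (r + 1) * Real.exp (w * ‖χ t‖) ≤ (K * Real.exp (c / 2 * w)) * Real.exp (w * (c / 2)) := by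
          gcongr
          exact hKw w hw
      _ = K * Real.exp (c * w) := by rw [mul_assoc, ← Real.exp_add]; ring_nf
  refine (IsBigO.of_bound 1 ?_).trans_isLittleO (e1'.mul_isBigO e2)
  refine eventually_uniformNhds.mpr (Eventually.of_forall fun t w hw => ?_)
  have h3 := Complex.norm_exp_sub_sum_le_norm_mul_exp (w * χ t) (r + 1)
  simp only [div_eq_mul_inv] at h3
  refine h3.trans (le_of_eq ?_)
  rw [norm_mul, Complex.norm_real, Real.norm_of_nonneg hw, one_mul]
  simp only [Function.comp_apply]
  rw [Real.norm_of_nonneg (by positivity)]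
  ring

/-- Truncation of an expansion at order `r`. -/
lemma HasExpansion.exists_bound {r : ℕ} {F : ℝ × ℝ → ℂ} {M : ℂ[X][X]} (hF : HasExpansion r F M)
    {c : ℝ} (hc : 0 < c) {ε : ℝ} (hε : 0 < ε) :
    ∃ δ : ℝ, 0 < δ ∧ ∀ t : ℝ, |t| ≤ δ → ∀ w : ℝ, 0 ≤ w →
      ‖F (t, w) - ∑ j ∈ Finset.range (r + 1), (t : ℂ) ^ j * (M.coeff j).eval (w : ℂ)‖
        ≤ ε * (|t| ^ r * Real.exp (c * w)) := by
  have htail : (fun q : ℝ × ℝ => M.evalEval (q.2 : ℂ) (q.1 : ℂ)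
      - ∑ j ∈ Finset.range (r + 1), (q.1 : ℂ) ^ j * (M.coeff j).eval (q.2 : ℂ)) =o[uniformNhds]
        fun q : ℝ × ℝ => q.1 ^ r * Real.exp (c * q.2) := by
    have hn : M.natDegree < (r + 1) + (M.natDegree + 1) := by omega
    have : ∀ q : ℝ × ℝ, M.evalEval (q.2 : ℂ) (q.1 : ℂ)
        - ∑ j ∈ Finset.range (r + 1), (q.1 : ℂ) ^ j * (M.coeff j).eval (q.2 : ℂ)
        = ∑ j ∈ Finset.range (M.natDegree + 1),
          (q.1 : ℂ) ^ (r + 1 + j) * (M.coeff (r + 1 + j)).eval (q.2 : ℂ) := by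
      intro q
      rw [evalEval_eq_sum M _ _ hn, Finset.sum_range_add]
      simp only [mul_comm]
      ring
    simp only [this]
    refine IsLittleO.fun_sum fun j _ => ?_
    have h1 : (fun t : ℝ => (t : ℂ) ^ (r + 1 + j)) =o[𝓝 0] fun t : ℝ => t ^ r := by
      have h2 : (fun t : ℝ => t ^ (r + 1 + j)) =o[𝓝 0] fun t : ℝ => t ^ r :=
        isLittleO_pow_pow (by omega)
      refine IsLittleO.of_norm_left (h2.norm_left.congr_left fun t => ?_)
      simp
    have h1' := h1.comp_tendsto tendsto_fst_uniformNhds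
    have h3 := isBigO_evalEval (Polynomial.C (M.coeff (r + 1 + j))) hc
    simp only [Polynomial.evalEval_C] at h3
    exact h1'.mul_isBigO h3
  have hall := ((hF c hc).add htail).bound hε
  obtain ⟨δ, hδ, hball⟩ := Metric.eventually_nhds_iff.mp (eventually_uniformNhds.mp hall)
  refine ⟨δ / 2, by positivity, fun t ht w hw => ?_⟩
  have := hball (y := t) (by rw [Real.dist_eq, sub_zero]; linarith) w hw
  simp only [sub_add_sub_cancel, norm_mul, norm_pow, Real.norm_eq_abs, Real.abs_exp] at this
  exact this

lemma HasExpansion.coeff_zero_eval {r : ℕ} (hr : 1 ≤ r) {F : ℝ × ℝ → ℂ} {M : ℂ[X][X]}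
    (hF : HasExpansion r F M) {w : ℝ} (hw : 0 ≤ w) : (M.coeff 0).eval (w : ℂ) = F (0, w) := by
  obtain ⟨δ, hδ, h⟩ := hF.exists_bound one_pos one_pos
  have := h 0 (by simpa using hδ.le) w hw
  rw [Finset.sum_range_succ'] at this
  have hr0 : r ≠ 0 := by omega
  simp [hr0] at this
  exact (sub_eq_zero.mp this).symm

/-- Real part of the coefficients of a complex polynomial, seen on the imaginary axis. -/
lemma exists_real_polynomial (P : ℂ[X]) : ∃ Q : ℝ[X], ∀ z : ℂ,
    Polynomial.aeval z Q = (P.eval z + (starRingEnd ℂ) (P.eval ((starRingEnd ℂ) z))) / 2 := by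
  induction P using Polynomial.induction_on' with
  | add p q hp hq =>
    obtain ⟨Q, hQ⟩ := hp
    obtain ⟨Q', hQ'⟩ := hq
    refine ⟨Q + Q', fun z => ?_⟩
    simp only [map_add, hQ, hQ', Polynomial.eval_add]
    ring
  | monomial n a =>
    refine ⟨Polynomial.monomial n a.re, fun z => ?_⟩
    have h1 : (a.re : ℂ) = (a + (starRingEnd ℂ) a) / 2 := by
      rw [Complex.add_conj]; push_cast; ring
    simp only [Polynomial.aeval_monomial, Polynomial.eval_monomial, map_mul, map_pow,
      Complex.conj_conj, Complex.coe_algebraMap, h1]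
    ring

/-- The Fourier transform of the formal Edgeworth density of order `r`. -/
noncomputable def edgeworthChar (σsq : ℝ≥0) (Q : ℕ → ℝ[X]) (r N : ℕ) (u : ℝ) : ℂ :=
  Complex.exp (-(σsq * u ^ 2) / 2) *
    (1 + ∑ p ∈ Finset.Icc 1 r, ((√(N : ℝ))⁻¹ : ℂ) ^ p * Polynomial.aeval (Complex.I * u) (Q p))

/-- With u = √N t and w = u², the j-th term of the expansion of e^{wχ}Z is t^j M_j(w) = N^{-j/2} u^j
M_j(u²). Allowing growth e^{σ²w/3} in the remainder leaves e^{-σ²w/6} after multiplication by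
e^{-σ²w/2}. The vanishing of Q_p at 0 will permit division by iu. -/
theorem exists_edgeworthChar_approx {φ : ℕ → ℝ → ℂ} {r : ℕ} {A : ℝ} {σsq : ℝ≥0} (hr : 1 ≤ r)
    (hσ : 0 < σsq) (D : ExpansionData φ r A σsq)
    (hφc : ∀ N t, (starRingEnd ℂ) (φ N t) = φ N (-t)) :
    ∃ Q : ℕ → ℝ[X], (∀ p, 1 ≤ p → (Q p).eval 0 = 0) ∧ ∀ ε : ℝ, 0 < ε → ∃ δ : ℝ, 0 < δ ∧
      ∀ t : ℝ, |t| ≤ δ → ∀ N : ℕ, 1 ≤ N →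
        ‖Complex.exp (-(Complex.I * (N * A) * t)) * φ N t
            - edgeworthChar σsq Q r N (√(N : ℝ) * t)‖
          ≤ ε * (|t| ^ r * Real.exp (-(σsq / 6 * (N * t ^ 2)))) + D.C * D.κ ^ N * |t| := by
  have hF := (HasExpansion.exp hr D.χ_sub D.χ_zero).mul (HasExpansion.fst D.Z_sub)
  set M : ℂ[X][X] := _ * D.b.map Polynomial.C with hM
  -- Designed so that its value at X = iu is u^j M_j(u²).
  set P : ℕ → ℂ[X] := fun j =>
    (Polynomial.C (-Complex.I) * X) ^ j * (M.coeff j).comp (-X ^ 2) with hP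
  choose Q hQ using fun j => exists_real_polynomial (P j)
  have hPeval : ∀ (j : ℕ) (u : ℝ), (P j).eval (Complex.I * u)
      = (u : ℂ) ^ j * (M.coeff j).eval ((u ^ 2 : ℝ) : ℂ) := by
    intro j u
    simp only [hP, Polynomial.eval_mul, Polynomial.eval_pow, Polynomial.eval_C, Polynomial.eval_X,
      Polynomial.eval_comp, Polynomial.eval_neg]
    have h1 : -Complex.I * (Complex.I * u) = u := by
      rw [← mul_assoc, neg_mul, Complex.I_mul_I]; ring
    have h2 : -(Complex.I * (u : ℂ)) ^ 2 = ((u ^ 2 : ℝ) : ℂ) := by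
      rw [mul_pow, Complex.I_sq]; push_cast; ring
    rw [h1, h2]
  refine ⟨Q, ?_, ?_⟩
  · intro p hp
    have h1 := hQ p 0
    have h2 : (P p).eval 0 = 0 := by
      have := hPeval p 0
      rw [Complex.ofReal_zero, mul_zero] at this
      rw [this]
      simp [show p ≠ 0 by omega]
    rw [map_zero, h2, map_zero, add_zero, zero_div, ← Complex.ofReal_zero,
      ← Complex.coe_algebraMap, Polynomial.aeval_algebraMap_apply,
      Complex.coe_algebraMap] at h1
    exact_mod_cast h1
  intro ε hε
  have hσ' : (0 : ℝ) < σsq := hσ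
  obtain ⟨δ₁, hδ₁, hb⟩ := hF.exists_bound (c := (σsq : ℝ) / 3) (by positivity) hε
  obtain ⟨δ₂, hδ₂, happ⟩ := Metric.eventually_nhds_iff.mp D.approx
  set ec : ℕ → ℝ → ℂ := fun N u => Complex.exp (-(σsq * u ^ 2) / 2) *
    ∑ j ∈ Finset.range (r + 1), ((√(N : ℝ))⁻¹ : ℂ) ^ j * (P j).eval (Complex.I * u) with hec
  set y : ℕ → ℝ → ℂ := fun N t => Complex.exp (-(Complex.I * (N * A) * t)) * φ N t with hy
  have key : ∀ t : ℝ, |t| ≤ min δ₁ (δ₂ / 2) → ∀ N : ℕ, 1 ≤ N → ‖y N t - ec N (√(N : ℝ) * t)‖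
      ≤ ε * (|t| ^ r * Real.exp (-(σsq / 6 * (N * t ^ 2)))) + D.C * D.κ ^ N * |t| := by
    intro t ht N hN
    have hNpos : (0 : ℝ) < N := by exact_mod_cast hN
    have hsN : √(N : ℝ) ^ 2 = N := Real.sq_sqrt hNpos.le
    have hs0 : (√(N : ℝ) : ℂ) ≠ 0 := by exact_mod_cast (Real.sqrt_pos.mpr hNpos).ne'
    set w : ℝ := N * t ^ 2 with hw
    have hw0 : 0 ≤ w := by positivity
    have hsq : (√(N : ℝ) * t) ^ 2 = w := by rw [mul_pow, hsN]
    have e1 : ec N (√(N : ℝ) * t) = Complex.exp (-(σsq * w : ℝ) / 2) *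
        ∑ j ∈ Finset.range (r + 1), (t : ℂ) ^ j * (M.coeff j).eval (w : ℂ) := by
      simp only [hec]
      congr 1
      · congr 1
        rw [← hsq]
        push_cast
        ring
      · refine Finset.sum_congr rfl fun j _ => ?_
        rw [hPeval, hsq, Complex.ofReal_mul, mul_pow, ← mul_assoc, ← mul_assoc, ← mul_pow,
          inv_mul_cancel₀ hs0, one_pow, one_mul]
    have e2 : Complex.exp (-(Complex.I * (N * A) * t)) *
        (Complex.exp (N * (Complex.I * A * t - σsq * t ^ 2 / 2 + t ^ 2 * D.χ t)) * D.Z t)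
        = Complex.exp (-(σsq * w : ℝ) / 2) * (Complex.exp (w * D.χ t) * D.Z t) := by
      have hmul : ∀ a b z : ℂ, Complex.exp a * (Complex.exp b * z) = Complex.exp (a + b) * z :=
        fun a b z => by rw [Complex.exp_add, mul_assoc]
      rw [hmul, hmul, hw]
      congr 2
      push_cast
      ring
    have e3 : y N t - ec N (√(N : ℝ) * t) = Complex.exp (-(Complex.I * (N * A) * t)) * (φ N t -
        Complex.exp (N * (Complex.I * A * t - σsq * t ^ 2 / 2 + t ^ 2 * D.χ t)) * D.Z t)
        + Complex.exp (-(σsq * w : ℝ) / 2) * (Complex.exp (w * D.χ t) * D.Z t -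
          ∑ j ∈ Finset.range (r + 1), (t : ℂ) ^ j * (M.coeff j).eval (w : ℂ)) := by
      rw [mul_sub, mul_sub, e2, e1]
      ring
    have n1 : ‖Complex.exp (-(Complex.I * (N * A) * t))‖ = 1 := by
      rw [Complex.norm_exp]; simp
    have n2 : ‖Complex.exp (-(σsq * w : ℝ) / 2)‖ = Real.exp (-(σsq * w) / 2) := by
      rw [Complex.norm_exp]
      congr 1
      rw [← Complex.ofReal_neg, ← Complex.ofReal_ofNat, ← Complex.ofReal_div, Complex.ofReal_re]
    rw [e3, add_comm]
    refine (norm_add_le _ _).trans (add_le_add ?_ ?_)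
    · rw [norm_mul, n2]
      have h1 := hb t (ht.trans (min_le_left _ _)) w hw0
      calc Real.exp (-(σsq * w) / 2) * _
          ≤ Real.exp (-(σsq * w) / 2) * (ε * (|t| ^ r * Real.exp (σsq / 3 * w))) := by gcongr
        _ = ε * (|t| ^ r * (Real.exp (-(σsq * w) / 2) * Real.exp (σsq / 3 * w))) := by ring
        _ = _ := by rw [← Real.exp_add]; ring_nf
    · rw [norm_mul, n1, one_mul]
      refine happ ?_ N hN
      rw [Real.dist_eq, sub_zero]
      have := ht.trans (min_le_right _ _)
      linarith
  refine ⟨min δ₁ (δ₂ / 2), by positivity, fun t ht N hN => ?_⟩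
  -- The exact function is invariant under t ↦ -t followed by conjugation, so averaging the
  -- estimates at t and -t replaces P_j by a real polynomial with the same error.
  have hyc : y N t = (starRingEnd ℂ) (y N (-t)) := by
    simp only [hy, map_mul, hφc, neg_neg, ← Complex.exp_conj]
    simp
  have hee : ∀ u : ℝ, edgeworthChar σsq Q r N u
      = (ec N u + (starRingEnd ℂ) (ec N (-u))) / 2 := by
    intro u
    simp only [edgeworthChar, hec, Finset.sum_range_succ']
    have hr0 : ∀ u : ℝ, (P 0).eval (Complex.I * u) = 1 := by
      intro u
      rw [hPeval, pow_zero, one_mul, hF.coeff_zero_eval hr (sq_nonneg u)]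
      simp [D.χ_zero, D.Z_zero]
    have hIcc : ∑ p ∈ Finset.Icc 1 r, ((√(N : ℝ))⁻¹ : ℂ) ^ p
          * Polynomial.aeval (Complex.I * u) (Q p)
        = ∑ j ∈ Finset.range r, ((√(N : ℝ))⁻¹ : ℂ) ^ (j + 1)
          * Polynomial.aeval (Complex.I * u) (Q (j + 1)) := by
      rw [← Finset.sum_image (f := fun p => ((√(N : ℝ))⁻¹ : ℂ) ^ p
          * Polynomial.aeval (Complex.I * u) (Q p)) (g := fun j => j + 1) (by simp)]
      congr 1
      ext p
      simp only [Finset.mem_Icc, Finset.mem_image, Finset.mem_range]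
      constructor
      · rintro ⟨h1, h2⟩
        exact ⟨p - 1, by omega, by omega⟩
      · rintro ⟨j, h1, rfl⟩
        omega
    have hconj : (starRingEnd ℂ) (Complex.I * u) = Complex.I * ((-u : ℝ) : ℂ) := by simp
    have hexp : (starRingEnd ℂ) (Complex.exp (-(σsq * ((-u : ℝ) : ℂ) ^ 2) / 2))
        = Complex.exp (-(σsq * (u : ℂ) ^ 2) / 2) := by
      rw [← Complex.exp_conj, map_div₀, map_ofNat]; simp
    rw [hIcc, map_mul, hexp, hr0, hr0, map_add, map_sum]
    simp only [hQ, hconj, map_mul, map_pow, map_inv₀, Complex.conj_ofReal, map_one, pow_zero,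
      one_mul]
    have : ∀ S T : ℂ, ∀ E : ℂ, (E * (S + 1) + E * (T + 1)) / 2 = E * (1 + (S + T) / 2) := by
      intro S T E; ring
    rw [this, ← Finset.sum_add_distrib, Finset.sum_div]
    congr 2
    refine Finset.sum_congr rfl fun j _ => ?_
    ring
  have h1 := key t ht N hN
  have h2 := key (-t) (by rwa [abs_neg]) N hN
  rw [abs_neg, neg_sq] at h2
  rw [hee]
  have e4 : y N t - (ec N (√(N : ℝ) * t) + (starRingEnd ℂ) (ec N (-(√(N : ℝ) * t)))) / 2
      = ((y N t - ec N (√(N : ℝ) * t))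
        + (starRingEnd ℂ) (y N (-t) - ec N (√(N : ℝ) * -t))) / 2 := by
    rw [map_sub, ← hyc, mul_neg]; ring
  change ‖y N t - _‖ ≤ _
  rw [e4, norm_div, Complex.norm_ofNat]
  rw [div_le_iff₀ two_pos]
  refine (norm_add_le _ _).trans ?_
  rw [Complex.norm_conj]
  linarith

end FormalExpansion
end AvgEdgeworth

namespace AvgEdgeworth

/-! ### Smoothing inequality for averaged distribution functions. -/

section Smoothing

open Topology FourierTransform

/-- The sliding integral of `f` over intervals of length `b`. -/
noncomputable def slidingIntegral (f : ℝ → ℂ) (b u : ℝ) : ℂ := ∫ y in u..(u + b), f y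

/-- The sliding integral is the convolution of f with the indicator of (-b, 0]. -/
lemma integrable_slidingIntegral {f : ℝ → ℂ} (hf : Integrable f) {b : ℝ} (hb : 0 ≤ b) :
    Integrable (slidingIntegral f b) := by
  have hg : Integrable ((Set.Ioc (-b) 0).indicator fun _ : ℝ => (1 : ℂ)) :=
    (integrable_indicator_iff measurableSet_Ioc).mpr (integrableOn_const (by simp))
  have h := hg.integrable_convolution (ContinuousLinearMap.mul ℝ ℂ) hf
  refine h.congr (Eventually.of_forall fun u => ?_)
  simp only [convolution, ContinuousLinearMap.mul_apply', slidingIntegral]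
  have h1 : ∀ t : ℝ, (Set.Ioc (-b) 0).indicator (fun _ : ℝ => (1 : ℂ)) t * f (u - t)
      = (Set.Ioc (-b) 0).indicator (fun t => f (u - t)) t := by
    intro t
    by_cases ht : t ∈ Set.Ioc (-b) 0 <;> simp [ht]
  simp_rw [h1]
  rw [integral_indicator measurableSet_Ioc,
    ← intervalIntegral.integral_of_le (by linarith : -b ≤ 0),
    intervalIntegral.integral_comp_sub_left, sub_zero, sub_neg_eq_add]

lemma hasDerivAt_slidingIntegral {f : ℝ → ℂ} (hf : Continuous f) (b u : ℝ) :
    HasDerivAt (slidingIntegral f b) (f (u + b) - f u) u := by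
  have hF : ∀ x, HasDerivAt (fun x => ∫ y in (0 : ℝ)..x, f y) (f x) x := fun x =>
    intervalIntegral.integral_hasDerivAt_right (hf.intervalIntegrable _ _)
      (hf.stronglyMeasurableAtFilter _ _) hf.continuousAt
  have h := ((hF (u + b)).comp_add_const u b).sub (hF u)
  refine h.congr_of_eventuallyEq (Eventually.of_forall fun x => ?_)
  simp only [slidingIntegral, Pi.sub_apply]
  rw [intervalIntegral.integral_interval_sub_left] <;> exact hf.intervalIntegrable _ _

lemma norm_fourier_le (f : ℝ → ℂ) (ξ : ℝ) : ‖𝓕 f ξ‖ ≤ ∫ x, ‖f x‖ :=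
  VectorFourier.norm_fourierIntegral_le_integral_norm _ _ _ _ _

lemma norm_fourier_comp_add_right (f : ℝ → ℂ) (b ξ : ℝ) :
    ‖𝓕 (fun x => f (x + b)) ξ‖ = ‖𝓕 f ξ‖ := by
  have h := congrFun (VectorFourier.fourierIntegral_comp_add_right Real.fourierChar volume
    (innerₗ ℝ) f b) ξ
  change 𝓕 (fun x => f (x + b)) ξ = _ • 𝓕 f ξ at h
  rw [h]
  exact Circle.norm_smul _ _

lemma continuous_fourier_of_integrable {f : ℝ → ℂ} (hf : Integrable f) : Continuous (𝓕 f) :=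
  VectorFourier.fourierIntegral_continuous Real.continuous_fourierChar (by fun_prop) hf

/-- The derivative of the sliding integral is f(u + b) - f(u), whose transform is at most 2|f̂| in
modulus. The bound does not involve b, so b may tend to infinity. -/
lemma norm_fourier_slidingIntegral_le {f : ℝ → ℂ} (hfc : Continuous f) (hf : Integrable f) {b : ℝ}
    (hb : 0 ≤ b) (ξ : ℝ) :
    2 * Real.pi * |ξ| * ‖𝓕 (slidingIntegral f b) ξ‖ ≤ 2 * ‖𝓕 f ξ‖ := by
  have hd : deriv (slidingIntegral f b) = fun u => f (u + b) - f u :=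
    funext fun u => (hasDerivAt_slidingIntegral hfc b u).deriv
  have hfb : Integrable fun u => f (u + b) := hf.comp_add_right b
  have h := congrFun (Real.fourier_deriv (integrable_slidingIntegral hf hb)
    (fun u => (hasDerivAt_slidingIntegral hfc b u).differentiableAt)
    (by rw [hd]; exact hfb.sub hf)) ξ
  have h2 : 2 * Real.pi * |ξ| * ‖𝓕 (slidingIntegral f b) ξ‖
      = ‖𝓕 (deriv (slidingIntegral f b)) ξ‖ := by
    rw [h]
    simp [abs_of_pos Real.pi_pos]
  rw [h2, hd]
  have h3 : 𝓕 (fun u => f (u + b) - f u) ξ = 𝓕 (fun u => f (u + b)) ξ - 𝓕 f ξ := by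
    simp only [Real.fourier_eq, smul_sub]
    rw [integral_sub]
    · exact (Real.fourierIntegral_convergent_iff ξ).mpr hfb
    · exact (Real.fourierIntegral_convergent_iff ξ).mpr hf
  rw [h3]
  refine (norm_sub_le _ _).trans ?_
  rw [norm_fourier_comp_add_right]
  linarith

lemma norm_fourier_deriv_le {f : ℝ → ℂ} (hd : Differentiable ℝ f) (hf : Integrable f)
    (hf' : Integrable (deriv f)) (ξ : ℝ) :
    2 * Real.pi * |ξ| * ‖𝓕 f ξ‖ ≤ ∫ x, ‖deriv f x‖ := by
  have h := congrFun (Real.fourier_deriv hf hd hf') ξ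
  refine le_trans (le_of_eq ?_) (norm_fourier_le (deriv f) ξ)
  rw [h]
  simp [abs_of_pos Real.pi_pos]

/-- The transform decays like ξ⁻²: one order from the sliding integral, one from the integrable
derivative of f. -/
lemma integrable_fourier_slidingIntegral {f : ℝ → ℂ} (hd : Differentiable ℝ f)
    (hf : Integrable f) (hf' : Integrable (deriv f)) {b : ℝ} (hb : 0 ≤ b) :
    Integrable (𝓕 (slidingIntegral f b)) := by
  set K : ℝ := (∫ x, ‖slidingIntegral f b x‖) + 2 * ∫ x, ‖deriv f x‖ with hK
  refine (integrable_inv_one_add_sq.const_mul K).mono'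
    (continuous_fourier_of_integrable (integrable_slidingIntegral hf hb)).aestronglyMeasurable
    (Eventually.of_forall fun ξ => ?_)
  have h1 := norm_fourier_le (slidingIntegral f b) ξ
  have h2 := norm_fourier_slidingIntegral_le hd.continuous hf hb ξ
  have h3 := norm_fourier_deriv_le hd hf hf' ξ
  rw [← div_eq_mul_inv, le_div_iff₀ (by positivity)]
  set a := ‖𝓕 (slidingIntegral f b) ξ‖
  have hp : 1 ≤ 2 * Real.pi := by linarith [Real.pi_gt_three]
  have ha : 0 ≤ a := norm_nonneg _
  have h4 : |ξ| * (|ξ| * a) ≤ 2 * ∫ x, ‖deriv f x‖ := by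
    have e1 : |ξ| * a ≤ 2 * Real.pi * |ξ| * a := by
      have : 0 ≤ |ξ| * a := by positivity
      nlinarith
    calc |ξ| * (|ξ| * a) ≤ |ξ| * (2 * ‖𝓕 f ξ‖) :=
          mul_le_mul_of_nonneg_left (e1.trans h2) (abs_nonneg ξ)
      _ = 2 * (|ξ| * ‖𝓕 f ξ‖) := by ring
      _ ≤ 2 * (2 * Real.pi * |ξ| * ‖𝓕 f ξ‖) := by
        have : 0 ≤ |ξ| * ‖𝓕 f ξ‖ := by positivity
        nlinarith
      _ ≤ _ := by linarith
  have h5 : |ξ| * (|ξ| * a) = ξ ^ 2 * a := by rw [← sq_abs]; ring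
  rw [hK]
  nlinarith

variable {M : Measure ℝ} [SFinite M] {w : ℝ → ℂ}

/-- The primitive of the complex measure `w M`. -/
noncomputable def cdfOf (M : Measure ℝ) (w : ℝ → ℂ) (x : ℝ) : ℂ := ∫ s in Set.Iic x, w s ∂M

/-- The Fourier transform of the complex measure `w M`. -/
noncomputable def charOf (M : Measure ℝ) (w : ℝ → ℂ) (t : ℝ) : ℂ :=
  ∫ s, Complex.exp (Complex.I * t * s) * w s ∂M

lemma norm_cdfOf_le (hw : Integrable w M) (x : ℝ) : ‖cdfOf M w x‖ ≤ ∫ s, ‖w s‖ ∂M :=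
  (norm_integral_le_integral_norm _).trans
    (setIntegral_le_integral hw.norm (Eventually.of_forall fun _ => norm_nonneg _))

lemma stronglyMeasurable_cdfOf (hwm : Measurable w) : StronglyMeasurable (cdfOf M w) := by
  have h1 : ∀ x, cdfOf M w x = ∫ s, {p : ℝ × ℝ | p.2 ≤ p.1}.indicator (fun p => w p.2) (x, s) ∂M := by
    intro x
    rw [cdfOf, ← integral_indicator measurableSet_Iic]
    rfl
  have hm : Measurable ({p : ℝ × ℝ | p.2 ≤ p.1}.indicator fun p => w p.2) :=
    (hwm.comp measurable_snd).indicator (measurableSet_le measurable_snd measurable_fst)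
  rw [show cdfOf M w = _ from funext h1]
  exact hm.stronglyMeasurable.integral_prod_right'

lemma tendsto_cdfOf_atBot (hw : Integrable w M) : Tendsto (cdfOf M w) atBot (𝓝 0) := by
  have h1 : ∀ x, cdfOf M w x = ∫ s, (Set.Iic x).indicator w s ∂M := fun x =>
    (integral_indicator measurableSet_Iic).symm
  have h2 : Tendsto (fun x : ℝ => ∫ s, (Set.Iic x).indicator w s ∂M) atBot
      (𝓝 (∫ _s : ℝ, (0 : ℂ) ∂M)) := by
    refine tendsto_integral_filter_of_dominated_convergence (fun s => ‖w s‖) ?_ ?_ hw.norm ?_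
    · exact Eventually.of_forall fun x => hw.1.indicator measurableSet_Iic
    · exact Eventually.of_forall fun x => Eventually.of_forall fun s => norm_indicator_le_norm_self _ _
    · refine Eventually.of_forall fun s => ?_
      refine tendsto_const_nhds.congr' ?_
      filter_upwards [eventually_lt_atBot s] with x hx
      rw [Set.indicator_of_notMem (by simpa using hx)]
  rw [integral_zero] at h2
  exact h2.congr fun x => (h1 x).symm

lemma integrable_cdfOf_mul (hwm : Measurable w) (hw : Integrable w M) {f : ℝ → ℂ}
    (hf : Integrable f) (x : ℝ) : Integrable fun y => cdfOf M w (x + y) * f y :=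
  hf.bdd_mul ((stronglyMeasurable_cdfOf hwm).comp_measurable
    (measurable_const_add x)).aestronglyMeasurable
    (Eventually.of_forall fun y => norm_cdfOf_le hw (x + y))

/-- Fubini: the mass at s is counted exactly for y in [s - x, s - x + b). The difference at x and x
- b replaces the primitive of f by an integrable kernel. -/
lemma integral_cdfOf_sub_mul (hwm : Measurable w) (hw : Integrable w M) {f : ℝ → ℂ}
    (hf : Integrable f) (x : ℝ) {b : ℝ} (hb : 0 ≤ b) :
    (∫ y, cdfOf M w (x + y) * f y) - ∫ y, cdfOf M w (x - b + y) * f y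
      = ∫ s, w s * slidingIntegral f b (s - x) ∂M := by
  rw [← integral_sub (integrable_cdfOf_mul hwm hw hf _) (integrable_cdfOf_mul hwm hw hf _)]
  set E : Set (ℝ × ℝ) := {p | x - b + p.1 < p.2 ∧ p.2 ≤ x + p.1} with hE
  have hEm : MeasurableSet E :=
    (measurableSet_lt (measurable_const.add measurable_fst) measurable_snd).inter
      (measurableSet_le measurable_snd (measurable_const.add measurable_fst))
  set H : ℝ × ℝ → ℂ := E.indicator fun p => f p.1 * w p.2 with hH
  have hint : Integrable H (volume.prod M) := (hf.mul_prod hw).indicator hEm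
  have h1 : ∀ y, cdfOf M w (x + y) * f y - cdfOf M w (x - b + y) * f y = ∫ s, H (y, s) ∂M := by
    intro y
    rw [← sub_mul, cdfOf, cdfOf, intervalIntegral.integral_Iic_sub_Iic hw.integrableOn
      hw.integrableOn, intervalIntegral.integral_of_le (by linarith), ← integral_mul_const,
      ← integral_indicator measurableSet_Ioc]
    refine integral_congr_ae (Eventually.of_forall fun s => ?_)
    simp only [hH, Set.indicator_apply, hE, Set.mem_ofPred_eq, Set.mem_Ioc, mul_comm (w s)]
  have h2 : ∀ s, w s * slidingIntegral f b (s - x) = ∫ y, H (y, s) := by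
    intro s
    rw [slidingIntegral, intervalIntegral.integral_of_le (by linarith), ← integral_Ico_eq_integral_Ioc,
      ← integral_const_mul, ← integral_indicator measurableSet_Ico]
    refine integral_congr_ae (Eventually.of_forall fun y => ?_)
    simp only [hH, Set.indicator_apply, hE, Set.mem_ofPred_eq, Set.mem_Ico, mul_comm (w s)]
    congr 1
    apply propext
    constructor <;> rintro ⟨h3, h4⟩ <;> constructor <;> linarith
  simp_rw [h1, h2]
  exact integral_integral_swap hint

/-- Parseval's identity, by Fourier inversion of the sliding integral and Fubini. -/
lemma integral_mul_slidingIntegral (hw : Integrable w M) {f : ℝ → ℂ}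
    (hd : Differentiable ℝ f) (hf : Integrable f) (hf' : Integrable (deriv f)) (x : ℝ) {b : ℝ}
    (hb : 0 ≤ b) :
    (Integrable fun ξ : ℝ => 𝓕 (slidingIntegral f b) ξ *
      (Complex.exp (-(2 * Real.pi * ξ * x * Complex.I)) * charOf M w (2 * Real.pi * ξ))) ∧
    ∫ s, w s * slidingIntegral f b (s - x) ∂M
      = ∫ ξ, 𝓕 (slidingIntegral f b) ξ * (Complex.exp (-(2 * Real.pi * ξ * x * Complex.I))
        * charOf M w (2 * Real.pi * ξ)) := by
  have hk := integrable_fourier_slidingIntegral hd hf hf' hb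
  have hkc : Continuous (slidingIntegral f b) :=
    continuous_iff_continuousAt.mpr fun u => (hasDerivAt_slidingIntegral hd.continuous b u).continuousAt
  have hinv := hkc.fourierInv_fourier_eq (integrable_slidingIntegral hf hb) hk
  set H : ℝ × ℝ → ℂ := fun p => Complex.exp (2 * Real.pi * (p.2 * (p.1 - x)) * Complex.I) *
    (w p.1 * 𝓕 (slidingIntegral f b) p.2) with hH
  have hint : Integrable H (M.prod volume) := by
    refine (hw.mul_prod hk).bdd_mul (c := 1) ?_ (Eventually.of_forall fun p => ?_)
    · exact (Continuous.aestronglyMeasurable (by fun_prop))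
    · rw [Complex.norm_exp]
      simp
  have h1 : ∀ s, w s * slidingIntegral f b (s - x) = ∫ ξ, H (s, ξ) := by
    intro s
    conv_lhs => rw [← hinv, Real.fourierInv_eq', ← integral_const_mul]
    refine integral_congr_ae (Eventually.of_forall fun ξ => ?_)
    simp only [hH, smul_eq_mul]
    rw [mul_left_comm]
    congr 3
    simp [mul_comm]
  have h2 : ∀ ξ : ℝ, 𝓕 (slidingIntegral f b) ξ * (Complex.exp (-(2 * Real.pi * ξ * x * Complex.I))
        * charOf M w (2 * Real.pi * ξ)) = ∫ s, H (s, ξ) ∂M := by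
    intro ξ
    rw [charOf, ← integral_const_mul, ← integral_const_mul]
    refine integral_congr_ae (Eventually.of_forall fun s => ?_)
    simp only [hH]
    rw [← mul_assoc (Complex.exp _), ← Complex.exp_add, mul_left_comm, mul_comm _ (w s)]
    congr 2
    push_cast
    ring
  simp_rw [h1, h2]
  exact ⟨hint.integral_prod_right, integral_integral_swap hint⟩

lemma tendsto_integral_cdfOf_sub (hwm : Measurable w) (hw : Integrable w M) {f : ℝ → ℂ}
    (hf : Integrable f) (x : ℝ) :
    Tendsto (fun n : ℕ => ∫ y, cdfOf M w (x - n + y) * f y) atTop (𝓝 0) := by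
  have h : Tendsto (fun n : ℕ => ∫ y, cdfOf M w (x - n + y) * f y) atTop
      (𝓝 (∫ _y : ℝ, (0 : ℂ))) := by
    refine tendsto_integral_of_dominated_convergence (fun y => (∫ s, ‖w s‖ ∂M) * ‖f y‖)
      (fun n => (integrable_cdfOf_mul hwm hw hf _).1) (hf.norm.const_mul _) ?_ ?_
    · intro n
      refine Eventually.of_forall fun y => ?_
      rw [norm_mul]
      gcongr
      exact norm_cdfOf_le hw _
    · refine Eventually.of_forall fun y => ?_
      have h1 : Tendsto (fun n : ℕ => x - n + y) atTop atBot := by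
        refine tendsto_atBot_add_const_right _ _ ?_
        simp_rw [sub_eq_add_neg]
        exact tendsto_atBot_add_const_left _ _
          (tendsto_neg_atTop_atBot.comp tendsto_natCast_atTop_atTop)
      simpa using ((tendsto_cdfOf_atBot hw).comp h1).mul_const (f y)
  simpa using h

/-- Smoothing inequality: the averages of the difference of two distribution functions against `f`
are controlled by the difference of the characteristic functions. -/
theorem norm_integral_cdfOf_sub_le {M' : Measure ℝ} [SFinite M'] {w' : ℝ → ℂ} (hwm : Measurable w)
    (hw : Integrable w M) (hwm' : Measurable w') (hw' : Integrable w' M') {f : ℝ → ℂ}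
    (hd : Differentiable ℝ f) (hf : Integrable f) (hf' : Integrable (deriv f)) {g : ℝ → ℝ}
    (hg : Integrable g)
    (hbound : ∀ ξ : ℝ, ξ ≠ 0 → ‖charOf M w (2 * Real.pi * ξ) - charOf M' w' (2 * Real.pi * ξ)‖
      * ‖𝓕 f ξ‖ ≤ Real.pi * |ξ| * g ξ) (x : ℝ) :
    ‖∫ y, (cdfOf M w (x + y) - cdfOf M' w' (x + y)) * f y‖ ≤ ∫ ξ, g ξ := by
  have hsplit : ∀ x, ∫ y, (cdfOf M w (x + y) - cdfOf M' w' (x + y)) * f y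
      = (∫ y, cdfOf M w (x + y) * f y) - ∫ y, cdfOf M' w' (x + y) * f y := by
    intro x
    simp_rw [sub_mul]
    exact integral_sub (integrable_cdfOf_mul hwm hw hf _) (integrable_cdfOf_mul hwm' hw' hf _)
  -- Only increments over a window of length n have a transform formula. The bound does not depend
  -- on n, and the term at x - n vanishes in the limit because distribution functions tend to 0 at
  -- -∞.
  have hstep : ∀ n : ℕ, ‖(∫ y, (cdfOf M w (x + y) - cdfOf M' w' (x + y)) * f y)
      - ∫ y, (cdfOf M w (x - n + y) - cdfOf M' w' (x - n + y)) * f y‖ ≤ ∫ ξ, g ξ := by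
    intro n
    have hn : (0 : ℝ) ≤ n := n.cast_nonneg
    obtain ⟨i1, e1⟩ := integral_mul_slidingIntegral hw hd hf hf' x hn
    obtain ⟨i2, e2⟩ := integral_mul_slidingIntegral hw' hd hf hf' x hn
    rw [hsplit, hsplit, sub_sub_sub_comm, integral_cdfOf_sub_mul hwm hw hf x hn,
      integral_cdfOf_sub_mul hwm' hw' hf x hn, e1, e2, ← integral_sub i1 i2]
    refine norm_integral_le_of_norm_le hg ?_
    filter_upwards [Measure.ae_ne volume (0 : ℝ)] with ξ hξ
    have h1 := norm_fourier_slidingIntegral_le hd.continuous hf hn ξ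
    have h2 := hbound ξ hξ
    have hξ' : 0 < |ξ| := abs_pos.mpr hξ
    rw [← mul_sub, ← mul_sub, norm_mul, norm_mul]
    have h3 : ‖Complex.exp (-(2 * Real.pi * ξ * x * Complex.I))‖ = 1 := by
      rw [Complex.norm_exp]; simp
    rw [h3, one_mul]
    refine le_of_mul_le_mul_left (le_trans ?_ h2) (by positivity : 0 < Real.pi * |ξ|)
    rw [← mul_assoc, mul_comm _ ‖𝓕 f ξ‖]
    gcongr
    linarith
  have hlim : Tendsto (fun n : ℕ => ‖(∫ y, (cdfOf M w (x + y) - cdfOf M' w' (x + y)) * f y)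
      - ∫ y, (cdfOf M w (x - n + y) - cdfOf M' w' (x - n + y)) * f y‖) atTop
      (𝓝 ‖∫ y, (cdfOf M w (x + y) - cdfOf M' w' (x + y)) * f y‖) := by
    have h1 := (tendsto_integral_cdfOf_sub hwm hw hf x).sub
      (tendsto_integral_cdfOf_sub hwm' hw' hf x)
    have h2 := (tendsto_const_nhds (x := ∫ y, (cdfOf M w (x + y) - cdfOf M' w' (x + y)) * f y)).sub h1
    simp only [sub_zero] at h2
    refine (h2.norm).congr fun n => ?_
    rw [hsplit (x - n)]
  exact le_of_tendsto hlim (Eventually.of_forall hstep)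

end Smoothing
end AvgEdgeworth

namespace AvgEdgeworth

/-! ### Polynomial multiples of the Gaussian density and their transforms. -/

section Hermite

open Topology Polynomial

variable {v : ℝ≥0}

lemma integrable_polynomial_mul_gaussianPDFReal (hv : 0 < v) (P : ℝ[X]) :
    Integrable fun x : ℝ => P.eval x * gaussianPDFReal 0 v x := by
  have hv' : (0 : ℝ) < v := hv
  induction P using Polynomial.induction_on' with
  | add p q hp hq =>
    simp_rw [Polynomial.eval_add, add_mul]
    exact hp.add hq
  | monomial n a =>
    have h := (integrable_rpow_mul_exp_neg_mul_sq (b := (2 * (v : ℝ))⁻¹) (by positivity)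
      (s := n) (by linarith [n.cast_nonneg (α := ℝ)])).const_mul (a * (√(2 * Real.pi * v))⁻¹)
    refine h.congr (Eventually.of_forall fun x => ?_)
    simp only [Polynomial.eval_monomial, gaussianPDFReal, Real.rpow_natCast, sub_zero]
    rw [show -(2 * (v : ℝ))⁻¹ * x ^ 2 = -x ^ 2 / (2 * v) by ring]
    ring

lemma hasDerivAt_gaussianPDFReal (v : ℝ≥0) (x : ℝ) :
    HasDerivAt (gaussianPDFReal 0 v) (-(x / v) * gaussianPDFReal 0 v x) x := by
  have h1 : HasDerivAt (fun x : ℝ => -(x - 0) ^ 2 / (2 * (v : ℝ))) (-(x / v)) x := by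
    have := (((hasDerivAt_id x).sub_const 0).pow 2).neg.div_const (2 * (v : ℝ))
    refine this.congr_deriv ?_
    simp only [id, sub_zero]
    ring
  have h2 := h1.exp.const_mul (√(2 * Real.pi * v))⁻¹
  refine h2.congr_deriv ?_
  simp only [gaussianPDFReal]
  ring

/-- The action of differentiation on the polynomial factor of `P 𝔫`. -/
noncomputable def gaussianDeriv (v : ℝ≥0) (P : ℝ[X]) : ℝ[X] :=
  Polynomial.derivative P - Polynomial.C ((v : ℝ)⁻¹) * Polynomial.X * P

lemma hasDerivAt_polynomial_mul_gaussianPDFReal (v : ℝ≥0) (P : ℝ[X]) (x : ℝ) :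
    HasDerivAt (fun x => P.eval x * gaussianPDFReal 0 v x)
      ((gaussianDeriv v P).eval x * gaussianPDFReal 0 v x) x := by
  refine ((P.hasDerivAt x).mul (hasDerivAt_gaussianPDFReal v x)).congr_deriv ?_
  simp only [gaussianDeriv, Polynomial.eval_sub, Polynomial.eval_mul, Polynomial.eval_C,
    Polynomial.eval_X]
  ring

/-- The complex valued density `P 𝔫`. -/
noncomputable def gaussianDensity (v : ℝ≥0) (P : ℝ[X]) (x : ℝ) : ℂ :=
  ((P.eval x * gaussianPDFReal 0 v x : ℝ) : ℂ)

lemma integrable_gaussianDensity (hv : 0 < v) (P : ℝ[X]) : Integrable (gaussianDensity v P) :=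
  (integrable_polynomial_mul_gaussianPDFReal hv P).ofReal

lemma measurable_gaussianDensity (P : ℝ[X]) : Measurable (gaussianDensity v P) :=
  Complex.measurable_ofReal.comp (P.continuous.measurable.mul (measurable_gaussianPDFReal 0 v))

lemma hasDerivAt_gaussianDensity (v : ℝ≥0) (P : ℝ[X]) (x : ℝ) :
    HasDerivAt (gaussianDensity v P) (gaussianDensity v (gaussianDeriv v P) x) x :=
  (hasDerivAt_polynomial_mul_gaussianPDFReal v P x).ofReal_comp

lemma integrable_exp_mul {w : ℝ → ℂ} {M : Measure ℝ} (hw : Integrable w M) (t : ℝ) :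
    Integrable (fun s : ℝ => Complex.exp (Complex.I * t * s) * w s) M := by
  refine hw.bdd_mul (c := 1) (Continuous.aestronglyMeasurable (by fun_prop))
    (Eventually.of_forall fun s => ?_)
  rw [Complex.norm_exp]
  simp

lemma charOf_gaussianDensity_one (hv : 0 < v) (u : ℝ) :
    charOf volume (gaussianDensity v 1) u = Complex.exp (-(v * u ^ 2) / 2) := by
  have h := charFun_gaussianReal (μ := 0) (v := v) u
  rw [charFun_apply_real, integral_gaussianReal_eq_integral_smul hv.ne'] at h
  rw [charOf]
  convert h using 1
  · refine integral_congr_ae (Eventually.of_forall fun x => ?_)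
    simp only [gaussianDensity, Polynomial.eval_one, one_mul, Complex.real_smul]
    rw [mul_comm]
    congr 2
    ring
  · congr 1
    push_cast
    ring

/-- Integration by parts. -/
lemma charOf_gaussianDeriv (hv : 0 < v) (P : ℝ[X]) (u : ℝ) :
    charOf volume (gaussianDensity v (gaussianDeriv v P)) u
      = -(Complex.I * u) * charOf volume (gaussianDensity v P) u := by
  have hexp : ∀ x : ℝ, HasDerivAt (fun x : ℝ => Complex.exp (Complex.I * u * x))
      (Complex.I * u * Complex.exp (Complex.I * u * x)) x := by
    intro x
    have h1 : HasDerivAt (fun x : ℝ => Complex.I * u * (x : ℂ)) (Complex.I * u) x := by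
      simpa using (Complex.ofRealCLM.hasDerivAt (x := x)).const_mul (Complex.I * u)
    refine h1.cexp.congr_deriv ?_
    ring
  have h := integral_mul_deriv_eq_deriv_mul_of_integrable (fun x _ => hexp x)
    (fun x _ => hasDerivAt_gaussianDensity v P x)
    (integrable_exp_mul (integrable_gaussianDensity hv _) u)
    (by
      have := (integrable_exp_mul (integrable_gaussianDensity hv P) u).const_mul (Complex.I * u)
      refine this.congr (Eventually.of_forall fun x => ?_)
      simp only [Pi.mul_apply]
      ring)
    (integrable_exp_mul (integrable_gaussianDensity hv P) u)
  rw [charOf, h, charOf, ← integral_const_mul, ← integral_neg]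
  refine integral_congr_ae (Eventually.of_forall fun x => ?_)
  simp only
  ring

lemma charOf_add {w w' : ℝ → ℂ} {M : Measure ℝ} (hw : Integrable w M) (hw' : Integrable w' M)
    (t : ℝ) : charOf M (fun s => w s + w' s) t = charOf M w t + charOf M w' t := by
  simp only [charOf, mul_add]
  exact integral_add (integrable_exp_mul hw t) (integrable_exp_mul hw' t)

lemma charOf_const_mul (c : ℂ) (w : ℝ → ℂ) (M : Measure ℝ) (t : ℝ) :
    charOf M (fun s => c * w s) t = c * charOf M w t := by
  simp only [charOf, ← integral_const_mul]
  refine integral_congr_ae (Eventually.of_forall fun x => ?_)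
  simp only
  ring

lemma gaussianDensity_add (P Q : ℝ[X]) :
    gaussianDensity v (P + Q) = fun x => gaussianDensity v P x + gaussianDensity v Q x := by
  funext x
  simp [gaussianDensity, add_mul]

lemma gaussianDensity_C_mul (a : ℝ) (P : ℝ[X]) :
    gaussianDensity v (Polynomial.C a * P) = fun x => a * gaussianDensity v P x := by
  funext x
  simp [gaussianDensity, mul_assoc]

/-- Every polynomial multiple of the Gaussian characteristic function is the Fourier transform of a
polynomial multiple of the Gaussian density. -/
lemma exists_charOf_gaussianDensity_eq (hv : 0 < v) (A : ℝ[X]) :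
    ∃ R : ℝ[X], ∀ u : ℝ, charOf volume (gaussianDensity v R) u
      = Polynomial.aeval (Complex.I * u) A * Complex.exp (-(v * u ^ 2) / 2) := by
  induction A using Polynomial.induction_on' with
  | add p q hp hq =>
    obtain ⟨R, hR⟩ := hp
    obtain ⟨R', hR'⟩ := hq
    refine ⟨R + R', fun u => ?_⟩
    rw [gaussianDensity_add, charOf_add (integrable_gaussianDensity hv _)
      (integrable_gaussianDensity hv _), hR, hR', map_add, add_mul]
  | monomial n a =>
    have h : ∃ R : ℝ[X], ∀ u : ℝ, charOf volume (gaussianDensity v R) u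
        = (Complex.I * u) ^ n * Complex.exp (-(v * u ^ 2) / 2) := by
      induction n with
      | zero => exact ⟨1, fun u => by rw [charOf_gaussianDensity_one hv]; simp⟩
      | succ n ih =>
        obtain ⟨R, hR⟩ := ih
        refine ⟨Polynomial.C (-1) * gaussianDeriv v R, fun u => ?_⟩
        rw [gaussianDensity_C_mul, charOf_const_mul, charOf_gaussianDeriv hv, hR]
        push_cast
        ring
    obtain ⟨R, hR⟩ := h
    refine ⟨Polynomial.C a * R, fun u => ?_⟩
    rw [gaussianDensity_C_mul, charOf_const_mul, hR, Polynomial.aeval_monomial, mul_assoc]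
    rfl

lemma cdfOf_gaussianDeriv (hv : 0 < v) (P : ℝ[X]) (x : ℝ) :
    cdfOf volume (gaussianDensity v (gaussianDeriv v P)) x = gaussianDensity v P x := by
  have ht := tendsto_zero_of_hasDerivAt_of_integrableOn_Iic (a := x)
    (fun y _ => hasDerivAt_gaussianDensity v P y) (integrable_gaussianDensity hv _).integrableOn
    (integrable_gaussianDensity hv _).integrableOn
  have h := integral_Iic_of_hasDerivAt_of_tendsto' (a := x)
    (fun y _ => hasDerivAt_gaussianDensity v P y) (integrable_gaussianDensity hv _).integrableOn ht
  rw [cdfOf, h, sub_zero]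

lemma cdfOf_gaussianDensity_one (x : ℝ) :
    cdfOf volume (gaussianDensity v 1) x = (normalCdf v x : ℂ) := by
  rw [cdfOf, normalCdf, ← integral_complex_ofReal]
  simp [gaussianDensity]

lemma cdfOf_add {w w' : ℝ → ℂ} {M : Measure ℝ} (hw : Integrable w M) (hw' : Integrable w' M)
    (t : ℝ) : cdfOf M (fun s => w s + w' s) t = cdfOf M w t + cdfOf M w' t :=
  integral_add hw.integrableOn hw'.integrableOn

lemma cdfOf_const_mul (c : ℂ) (w : ℝ → ℂ) (M : Measure ℝ) (t : ℝ) :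
    cdfOf M (fun s => c * w s) t = c * cdfOf M w t :=
  integral_const_mul _ _

/-- The Edgeworth polynomials in the position variable. -/
theorem exists_edgeworth_density (hv : 0 < v) (Q : ℕ → ℝ[X])
    (hQ : ∀ p, 1 ≤ p → (Q p).eval 0 = 0) (r : ℕ) :
    ∃ (P : ℕ → ℝ[X]), ∀ a : ℕ → ℝ, ∃ R : ℝ[X],
      (∀ u : ℝ, charOf volume (gaussianDensity v R) u = Complex.exp (-(v * u ^ 2) / 2) *
        (1 + ∑ p ∈ Finset.Icc 1 r, (a p : ℂ) * Polynomial.aeval (Complex.I * u) (Q p))) ∧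
      ∀ x : ℝ, cdfOf volume (gaussianDensity v R) x = (normalCdf v x : ℂ)
        + ∑ p ∈ Finset.Icc 1 r, (a p : ℂ) * gaussianDensity v (P p) x := by
  -- Since Q_p(0) = 0, Q_p = X · divX. If R_p 𝔫 has the transform of divX, then -(R_p 𝔫)' has that
  -- of Q_p and its primitive is -R_p 𝔫. Hence P_p = -R_p, which does not see the coefficients a p,
  -- to be taken as N^{-p/2}.
  choose R hR using fun p => exists_charOf_gaussianDensity_eq hv (Q p).divX
  refine ⟨fun p => Polynomial.C (-1) * R p, fun a => ?_⟩
  have hs : ∀ s : Finset ℕ, (∀ p ∈ s, 1 ≤ p) → ∃ T : ℝ[X],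
      (∀ u : ℝ, charOf volume (gaussianDensity v T) u = Complex.exp (-(v * u ^ 2) / 2) *
        (1 + ∑ p ∈ s, (a p : ℂ) * Polynomial.aeval (Complex.I * u) (Q p))) ∧
      ∀ x : ℝ, cdfOf volume (gaussianDensity v T) x = (normalCdf v x : ℂ)
        + ∑ p ∈ s, (a p : ℂ) * gaussianDensity v (Polynomial.C (-1) * R p) x := by
    intro s
    induction s using Finset.induction_on with
    | empty =>
      intro _
      refine ⟨1, fun u => ?_, fun x => ?_⟩
      · rw [charOf_gaussianDensity_one hv]; simp
      · rw [cdfOf_gaussianDensity_one]; simp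
    | insert p s hp ih =>
      intro h1
      obtain ⟨T, hT1, hT2⟩ := ih fun q hq => h1 q (by simp [hq])
      refine ⟨T + Polynomial.C (a p) * gaussianDeriv v (Polynomial.C (-1) * R p),
        fun u => ?_, fun x => ?_⟩
      · have hQp : Polynomial.aeval (Complex.I * u) (Q p)
            = Complex.I * u * Polynomial.aeval (Complex.I * u) (Q p).divX := by
          conv_lhs => rw [← Polynomial.X_mul_divX_add (Q p)]
          rw [Polynomial.coeff_zero_eq_eval_zero, hQ p (h1 p (by simp))]
          simp
        rw [gaussianDensity_add, charOf_add (integrable_gaussianDensity hv _)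
          (integrable_gaussianDensity hv _), hT1, gaussianDensity_C_mul, charOf_const_mul,
          charOf_gaussianDeriv hv, gaussianDensity_C_mul, charOf_const_mul, hR,
          Finset.sum_insert hp, hQp]
        push_cast
        ring
      · rw [gaussianDensity_add, cdfOf_add (integrable_gaussianDensity hv _)
          (integrable_gaussianDensity hv _), hT2, gaussianDensity_C_mul, cdfOf_const_mul,
          cdfOf_gaussianDeriv hv, Finset.sum_insert hp]
        ring
  exact hs _ fun p hp => (Finset.mem_Icc.mp hp).1

/-- Moves the limiting density to the scale of S_N - NA, where f need not be rescaled and the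
frequency is the parameter of L t. -/
lemma charOf_scale (w : ℝ → ℂ) {s : ℝ} (hs : 0 < s) (t : ℝ) :
    charOf volume (fun y => (s : ℂ)⁻¹ * w (y / s)) t = charOf volume w (s * t) := by
  have h := Measure.integral_comp_div (fun x : ℝ => Complex.exp (Complex.I * (s * t : ℝ) * x) * w x) s
  rw [charOf_const_mul, charOf, charOf]
  have hs0 : (s : ℂ) ≠ 0 := by exact_mod_cast hs.ne'
  rw [abs_of_pos hs, Complex.real_smul] at h
  rw [inv_mul_eq_iff_eq_mul₀ hs0, ← h]
  refine integral_congr_ae (Eventually.of_forall fun x => ?_)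
  simp only
  congr 2
  push_cast
  field_simp

lemma cdfOf_scale (w : ℝ → ℂ) {s : ℝ} (hs : 0 < s) (x : ℝ) :
    cdfOf volume (fun y => (s : ℂ)⁻¹ * w (y / s)) x = cdfOf volume w (x / s) := by
  have h := Measure.integral_comp_div ((Set.Iic (x / s)).indicator w) s
  have hs0 : (s : ℂ) ≠ 0 := by exact_mod_cast hs.ne'
  rw [abs_of_pos hs, Complex.real_smul] at h
  rw [cdfOf_const_mul, cdfOf, cdfOf, inv_mul_eq_iff_eq_mul₀ hs0,
    ← integral_indicator measurableSet_Iic, ← integral_indicator measurableSet_Iic, ← h]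
  refine integral_congr_ae (Eventually.of_forall fun y => ?_)
  simp only [Set.indicator_apply, Set.mem_Iic, div_le_div_iff_of_pos_right hs]

end Hermite
end AvgEdgeworth

namespace AvgEdgeworth

/-! ### Characteristic functions and Edgeworth approximations away from the origin. -/

section ErrorEstimate

open Topology

lemma sqrt_pow_eq_rpow (N r : ℕ) : √(N : ℝ) ^ r = (N : ℝ) ^ ((r : ℝ) / 2) := by
  rw [Real.sqrt_eq_rpow, ← Real.rpow_natCast, ← Real.rpow_mul N.cast_nonneg]
  congr 1
  ring

lemma exists_sqrt_pow_le_mul_exp {c : ℝ} (hc : 0 < c) (r : ℕ) :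
    ∃ K : ℝ, 0 < K ∧ ∀ N : ℕ, 1 ≤ N → √(N : ℝ) ^ r ≤ K * Real.exp (c * N) := by
  obtain ⟨K, hK, h⟩ := exists_pow_le_mul_exp hc r
  refine ⟨K, hK, fun N hN => le_trans ?_ (h N N.cast_nonneg)⟩
  gcongr
  have h1 : (1 : ℝ) ≤ N := by exact_mod_cast hN
  rw [Real.sqrt_le_left (by positivity)]
  nlinarith

variable {B : Type*} [NormedAddCommGroup B] [NormedSpace ℂ B]

/-- Powers of the polynomial decay bound: the exponent in condition (A4) can be made arbitrarily
large at the price of a constant factor in the range of frequencies. -/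
lemma CondA4.exists_norm_pow_le {L : ℝ → B →L[ℂ] B} {r₁ : ℝ} (h : CondA4 L r₁) (a : ℝ) :
    ∃ (K : ℝ) (m : ℕ), 0 < K ∧ 1 ≤ m ∧ ∀ᶠ k : ℕ in atTop, ∀ N : ℕ, m * k ≤ N →
      ∀ t : ℝ, K ≤ |t| → |t| ≤ (k : ℝ) ^ r₁ → ‖L t ^ N‖ ≤ (k : ℝ) ^ (-a) := by
  obtain ⟨hr₁, K, r₂, N₀, hK, hr₂, hN₀, hb⟩ := h
  obtain ⟨m, hm⟩ := exists_nat_gt (max 1 (a / r₂))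
  have hm1 : (1 : ℝ) < m := (le_max_left _ _).trans_lt hm
  have hm2 : a < m * r₂ := by
    have := (le_max_right 1 (a / r₂)).trans_lt hm
    rwa [div_lt_iff₀ hr₂] at this
  have hm1' : 1 < m := by exact_mod_cast hm1
  refine ⟨K, m, hK, hm1'.le, ?_⟩
  filter_upwards [tendsto_natCast_atTop_atTop.eventually_gt_atTop N₀, eventually_ge_atTop 1]
    with k hk hk1 N hN t ht1 ht2
  have hk0 : (1 : ℝ) ≤ k := by exact_mod_cast hk1
  have hbk : ∀ n : ℕ, k ≤ n → ‖L t ^ n‖ ≤ 1 / (k : ℝ) ^ r₂ := by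
    intro n hn
    have hn' : (k : ℝ) ≤ n := by exact_mod_cast hn
    refine (hb n (hk.trans_le hn') t ht1 (ht2.trans ?_)).trans ?_
    · gcongr
    · gcongr
  have hkm : k * (m - 1) + k ≤ N := by
    have : k * (m - 1) + k = m * k := by
      obtain ⟨j, rfl⟩ : ∃ j, m = j + 1 := ⟨m - 1, by omega⟩
      simp only [Nat.add_sub_cancel]
      ring
    omega
  -- A product of m powers, each with exponent at least k and so of norm at most k^{-r₂}; the choice
  -- m > a / r₂ gives k^{-a}.
  have hdec : L t ^ N = (L t ^ k) ^ (m - 1) * L t ^ (N - k * (m - 1)) := by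
    rw [← pow_mul, ← pow_add]
    congr 1
    omega
  have hq : 0 ≤ 1 / (k : ℝ) ^ r₂ := by positivity
  calc ‖L t ^ N‖ ≤ ‖(L t ^ k) ^ (m - 1)‖ * ‖L t ^ (N - k * (m - 1))‖ := by
        rw [hdec]; exact norm_mul_le _ _
    _ ≤ (1 / (k : ℝ) ^ r₂) ^ (m - 1) * (1 / (k : ℝ) ^ r₂) := by
        gcongr
        · exact (norm_pow_le' _ (by omega)).trans (by gcongr; exact hbk k le_rfl)
        · exact hbk _ (by omega)
    _ = (1 / (k : ℝ) ^ r₂) ^ m := by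
        rw [← pow_succ]
        congr 1
        omega
    _ = (k : ℝ) ^ (-(m * r₂)) := by
        rw [one_div, inv_pow, ← Real.rpow_natCast, ← Real.rpow_mul (by positivity),
          Real.rpow_neg (by positivity), mul_comm]
    _ ≤ (k : ℝ) ^ (-a) := Real.rpow_le_rpow_of_exponent_le hk0 (by linarith)

variable [CompleteSpace B]

/-- Uniform bound for the characteristic functions away from the origin. -/
lemma exists_bound_of_le_abs {L : ℝ → B →L[ℂ] B} (hL : Continuous L) (hA3 : CondA3 L) {r₁ : ℝ}
    (hA4 : CondA4 L r₁) {φ : ℕ → ℝ → ℂ} (hφ1 : ∀ N t, ‖φ N t‖ ≤ 1) {D : ℝ}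
    (hφL : ∀ N : ℕ, 1 ≤ N → ∀ t, ‖φ N t‖ ≤ D * ‖L t ^ N‖) (r : ℕ) {δ : ℝ} (hδ : 0 < δ) :
    ∃ K : ℝ, ∀ᶠ N : ℕ in atTop, ∀ t : ℝ, δ ≤ |t| →
      √(N : ℝ) ^ r * ‖φ N t‖ ≤ K * (1 + |t| ^ ((r : ℝ) / (2 * r₁))) := by
  have hr₁ := hA4.1
  obtain ⟨K, m, hK, hm, hev⟩ := hA4.exists_norm_pow_le ((r : ℝ) / 2)
  set s : Set ℝ := {t | δ ≤ |t| ∧ |t| ≤ K} with hs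
  have hsc : IsCompact s := by
    refine (isCompact_Icc (a := -K) (b := K)).of_isClosed_subset ?_ ?_
    · exact (isClosed_le continuous_const continuous_abs).inter
        (isClosed_le continuous_abs continuous_const)
    · rintro t ⟨-, ht⟩
      exact ⟨by linarith [neg_abs_le t], by linarith [le_abs_self t]⟩
  obtain ⟨C, κ, hC, hκ0, hκ1, hpow⟩ := exists_norm_pow_le_of_isCompact hL hsc (fun t ht => by
    refine hA3 t ?_
    rintro rfl
    have := ht.1
    rw [abs_zero] at this
    linarith)
  -- This rate makes exp(cN) = κ^{-N}.
  obtain ⟨K₁, hK₁, hexp⟩ := exists_sqrt_pow_le_mul_exp (c := -Real.log κ)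
    (by linarith [Real.log_neg hκ0 hκ1]) r
  set D' : ℝ := max D 0 with hD'
  have hD'0 : 0 ≤ D' := le_max_right _ _
  have hφL' : ∀ N : ℕ, 1 ≤ N → ∀ t, ‖φ N t‖ ≤ D' * ‖L t ^ N‖ := fun N hN t =>
    (hφL N hN t).trans (by gcongr; exact le_max_left _ _)
  have hm0 : (0 : ℝ) < m := by exact_mod_cast hm
  -- The (A4) bound is used at k = N / m rounded down; N ≤ 2mk makes the loss from N to k the
  -- constant E.
  set E : ℝ := (2 * m : ℝ) ^ ((r : ℝ) / 2) with hE
  have hE0 : 0 < E := by positivity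
  have hdiv : Tendsto (fun N : ℕ => N / m) atTop atTop :=
    tendsto_atTop.mpr fun b => by
      filter_upwards [eventually_ge_atTop (b * m)] with N hN
      exact (Nat.le_div_iff_mul_le (by omega)).mpr hN
  refine ⟨K₁ * (D' * C) + D' * E + E, ?_⟩
  filter_upwards [hdiv.eventually hev, hdiv.eventually_ge_atTop 1, eventually_ge_atTop 1]
    with N hN hk1 hN1 t ht
  set k := N / m with hk
  have hpos : 0 ≤ |t| ^ ((r : ℝ) / (2 * r₁)) := by positivity
  have hk0 : (1 : ℝ) ≤ k := by exact_mod_cast hk1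
  have hNk : (N : ℝ) ≤ 2 * m * k := by
    have h1 : N < m * (k + 1) := by
      have := Nat.lt_mul_div_succ N (b := m) (by omega)
      simpa [hk] using this
    have h2 : (N : ℝ) < m * (k + 1) := by exact_mod_cast h1
    nlinarith
  have hmk : m * k ≤ N := Nat.mul_div_le N m
  have hsq : √(N : ℝ) ^ r ≤ E * (k : ℝ) ^ ((r : ℝ) / 2) := by
    rw [sqrt_pow_eq_rpow, hE, ← Real.mul_rpow (by positivity) (by positivity)]
    exact Real.rpow_le_rpow N.cast_nonneg hNk (by positivity)
  rcases le_total |t| K with h1 | h1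
  · have h2 : √(N : ℝ) ^ r * κ ^ N ≤ K₁ := by
      have h3 := hexp N hN1
      have h4 : Real.exp (-Real.log κ * N) * κ ^ N = 1 := by
        rw [← Real.exp_log hκ0, ← Real.exp_nat_mul, ← Real.exp_add, Real.log_exp]
        rw [show -Real.log κ * N + N * Real.log κ = 0 by ring, Real.exp_zero]
      calc √(N : ℝ) ^ r * κ ^ N ≤ (K₁ * Real.exp (-Real.log κ * N)) * κ ^ N := by gcongr
        _ = K₁ := by rw [mul_assoc, h4, mul_one]
    calc √(N : ℝ) ^ r * ‖φ N t‖ ≤ √(N : ℝ) ^ r * (D' * (C * κ ^ N)) := by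
          gcongr
          exact (hφL' N hN1 t).trans (by gcongr; exact hpow t ⟨ht, h1⟩ N)
      _ = (√(N : ℝ) ^ r * κ ^ N) * (D' * C) := by ring
      _ ≤ K₁ * (D' * C) := by gcongr
      _ ≤ (K₁ * (D' * C) + D' * E + E) * 1 := by
          have : 0 ≤ D' * E := by positivity
          linarith
      _ ≤ _ := by gcongr; linarith
  · rcases le_or_gt |t| ((k : ℝ) ^ r₁) with h2 | h2
    · calc √(N : ℝ) ^ r * ‖φ N t‖
          ≤ (E * (k : ℝ) ^ ((r : ℝ) / 2)) * (D' * (k : ℝ) ^ (-((r : ℝ) / 2))) := by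
            gcongr
            exact (hφL' N hN1 t).trans (by gcongr; exact hN N hmk t h1 h2)
        _ = D' * E * ((k : ℝ) ^ ((r : ℝ) / 2) * (k : ℝ) ^ (-((r : ℝ) / 2))) := by ring
        _ = D' * E := by
            rw [← Real.rpow_add (by positivity), add_neg_cancel, Real.rpow_zero, mul_one]
        _ ≤ (K₁ * (D' * C) + D' * E + E) * 1 := by
            have : 0 ≤ K₁ * (D' * C) := by positivity
            linarith
        _ ≤ _ := by gcongr; linarith
    -- Beyond k^{r₁} nothing is known but ‖φ‖ ≤ 1; there k^{r/2} = (k^{r₁})^{r/(2r₁)} is dominated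
    -- by a power of |t|. This is the origin of the exponent r/(2r₁).
    · have h3 : (k : ℝ) ^ ((r : ℝ) / 2) ≤ |t| ^ ((r : ℝ) / (2 * r₁)) := by
        have h4 : (k : ℝ) ^ ((r : ℝ) / 2) = ((k : ℝ) ^ r₁) ^ ((r : ℝ) / (2 * r₁)) := by
          rw [← Real.rpow_mul (by positivity)]
          congr 1
          field_simp
        rw [h4]
        gcongr
      calc √(N : ℝ) ^ r * ‖φ N t‖ ≤ (E * |t| ^ ((r : ℝ) / (2 * r₁))) * 1 := by
            gcongr
            · exact hsq.trans (by gcongr)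
            · exact hφ1 N t
        _ = E * |t| ^ ((r : ℝ) / (2 * r₁)) := mul_one _
        _ ≤ (K₁ * (D' * C) + D' * E + E) * (1 + |t| ^ ((r : ℝ) / (2 * r₁))) := by
            have h5 : 0 ≤ D' * E := by positivity
            have h6 : 0 ≤ K₁ * (D' * C) := by positivity
            gcongr <;> linarith

lemma tendsto_sqrt_pow_mul_pow {κ : ℝ} (h0 : 0 < κ) (h1 : κ < 1) (r : ℕ) :
    Tendsto (fun N : ℕ => √(N : ℝ) ^ r * κ ^ N) atTop (𝓝 0) := by
  have h := tendsto_pow_const_mul_const_pow_of_lt_one r h0.le h1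
  refine squeeze_zero (fun N => by positivity) (fun N => ?_) h
  gcongr
  rcases Nat.eq_zero_or_pos N with rfl | hN
  · simp
  · have h1 : (1 : ℝ) ≤ N := by exact_mod_cast hN
    rw [Real.sqrt_le_left (by positivity)]
    nlinarith

lemma tendsto_sqrt_pow_mul_norm {L : ℝ → B →L[ℂ] B} (hL : Continuous L) (hA3 : CondA3 L)
    {φ : ℕ → ℝ → ℂ} {D : ℝ} (hφL : ∀ N : ℕ, 1 ≤ N → ∀ t, ‖φ N t‖ ≤ D * ‖L t ^ N‖) (r : ℕ) {t : ℝ}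
    (ht : t ≠ 0) : Tendsto (fun N : ℕ => √(N : ℝ) ^ r * ‖φ N t‖) atTop (𝓝 0) := by
  obtain ⟨C, κ, hC, hκ0, hκ1, hpow⟩ := exists_norm_pow_le_of_isCompact hL
    (isCompact_singleton (x := t)) (fun u hu => by rw [Set.mem_singleton_iff.mp hu]; exact hA3 t ht)
  have h := (tendsto_sqrt_pow_mul_pow hκ0 hκ1 r).mul_const (|D| * C)
  rw [zero_mul] at h
  refine squeeze_zero' (Eventually.of_forall fun N => by positivity) ?_ h
  filter_upwards [eventually_ge_atTop 1] with N hN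
  rw [mul_assoc]
  gcongr
  calc ‖φ N t‖ ≤ D * ‖L t ^ N‖ := hφL N hN t
    _ ≤ |D| * (C * κ ^ N) := by
      gcongr
      · exact le_abs_self D
      · exact hpow t rfl N
    _ = _ := by ring

open Polynomial in
lemma exists_norm_aeval_I_mul_le (Q : ℝ[X]) {c : ℝ} (hc : 0 < c) :
    ∃ K : ℝ, 0 < K ∧ ∀ u : ℝ, ‖Polynomial.aeval (Complex.I * u) Q‖ ≤ K * Real.exp (c * u ^ 2) := by
  induction Q using Polynomial.induction_on' with
  | add p q hp hq =>
    obtain ⟨K, hK, h1⟩ := hp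
    obtain ⟨K', hK', h2⟩ := hq
    refine ⟨K + K', by positivity, fun u => ?_⟩
    rw [map_add, add_mul]
    exact (norm_add_le _ _).trans (add_le_add (h1 u) (h2 u))
  | monomial n a =>
    obtain ⟨K, hK, h1⟩ := exists_pow_le_mul_exp hc n
    refine ⟨(|a| + 1) * (1 + K), by positivity, fun u => ?_⟩
    have h2 : |u| ^ n ≤ (1 + K) * Real.exp (c * u ^ 2) := by
      have h3 := h1 (u ^ 2) (sq_nonneg u)
      have h4 : (1 : ℝ) ≤ Real.exp (c * u ^ 2) := Real.one_le_exp (by positivity)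
      have h5 : |u| ^ n ≤ 1 + (u ^ 2) ^ n := by
        have h6 : (u ^ 2) ^ n = (|u| ^ n) ^ 2 := by rw [← sq_abs, ← pow_mul, ← pow_mul, mul_comm]
        rw [h6]
        nlinarith [sq_nonneg (|u| ^ n - 1 / 2)]
      linarith
    rw [Polynomial.aeval_monomial, norm_mul, norm_pow, norm_mul, Complex.norm_I, one_mul,
      Complex.norm_real, Complex.coe_algebraMap, Complex.norm_real, mul_assoc, Real.norm_eq_abs,
      Real.norm_eq_abs]
    gcongr
    linarith

open Polynomial in
-- Half of the Gaussian decay e^{-σ²u²/2} pays for the polynomial factors.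
lemma exists_norm_edgeworthChar_le {σsq : ℝ≥0} (hσ : 0 < σsq) (Q : ℕ → ℝ[X]) (r : ℕ) :
    ∃ K : ℝ, 0 < K ∧ ∀ N : ℕ, 1 ≤ N → ∀ u : ℝ,
      ‖edgeworthChar σsq Q r N u‖ ≤ K * Real.exp (-(σsq / 4 * u ^ 2)) := by
  have hσ' : (0 : ℝ) < σsq := hσ
  choose K hK hKu using fun p =>
    exists_norm_aeval_I_mul_le (Q p) (c := (σsq : ℝ) / 4) (by positivity)
  have hKs : 0 ≤ ∑ p ∈ Finset.Icc 1 r, K p := Finset.sum_nonneg fun p _ => (hK p).le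
  refine ⟨1 + ∑ p ∈ Finset.Icc 1 r, K p, by positivity, fun N hN u => ?_⟩
  have hN1 : (1 : ℝ) ≤ N := by exact_mod_cast hN
  have h1 : ‖1 + ∑ p ∈ Finset.Icc 1 r, ((√(N : ℝ))⁻¹ : ℂ) ^ p
      * Polynomial.aeval (Complex.I * u) (Q p)‖
      ≤ (1 + ∑ p ∈ Finset.Icc 1 r, K p) * Real.exp (σsq / 4 * u ^ 2) := by
    rw [add_mul, one_mul, Finset.sum_mul]
    refine (norm_add_le _ _).trans (add_le_add ?_ ((norm_sum_le _ _).trans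
      (Finset.sum_le_sum fun p _ => ?_)))
    · rw [norm_one]
      exact Real.one_le_exp (by positivity)
    · rw [norm_mul, norm_pow, norm_inv, Complex.norm_real, Real.norm_of_nonneg (Real.sqrt_nonneg _)]
      have h2 : (√(N : ℝ))⁻¹ ^ p ≤ 1 :=
        pow_le_one₀ (by positivity) (inv_le_one_of_one_le₀ (Real.one_le_sqrt.mpr hN1))
      calc (√(N : ℝ))⁻¹ ^ p * ‖Polynomial.aeval (Complex.I * u) (Q p)‖
          ≤ 1 * (K p * Real.exp (σsq / 4 * u ^ 2)) := by
            gcongr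
            exact hKu p u
        _ = _ := one_mul _
  rw [edgeworthChar, norm_mul]
  have h2 : ‖Complex.exp (-(σsq * (u : ℂ) ^ 2) / 2)‖ = Real.exp (-(σsq * u ^ 2) / 2) := by
    rw [Complex.norm_exp]
    congr 1
    rw [← Complex.ofReal_pow, ← Complex.ofReal_mul, ← Complex.ofReal_neg, ← Complex.ofReal_ofNat,
      ← Complex.ofReal_div, Complex.ofReal_re]
  rw [h2]
  calc Real.exp (-(σsq * u ^ 2) / 2) * _
      ≤ Real.exp (-(σsq * u ^ 2) / 2)
        * ((1 + ∑ p ∈ Finset.Icc 1 r, K p) * Real.exp (σsq / 4 * u ^ 2)) := by gcongr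
    _ = (1 + ∑ p ∈ Finset.Icc 1 r, K p)
        * (Real.exp (-(σsq * u ^ 2) / 2) * Real.exp (σsq / 4 * u ^ 2)) := by ring
    _ = _ := by rw [← Real.exp_add]; ring_nf

open Polynomial in
-- For |t| ≥ δ the factor N^{r/2} is at most a constant times e^{σ²Nt²/8}, so half of the remaining
-- decay absorbs it.
lemma exists_sqrt_pow_mul_norm_edgeworthChar_le {σsq : ℝ≥0} (hσ : 0 < σsq) (Q : ℕ → ℝ[X]) (r : ℕ)
    {δ : ℝ} (hδ : 0 < δ) :
    ∃ K : ℝ, 0 < K ∧ ∀ N : ℕ, 1 ≤ N → ∀ t : ℝ, δ ≤ |t| →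
      √(N : ℝ) ^ r * ‖edgeworthChar σsq Q r N (√(N : ℝ) * t)‖
        ≤ K * Real.exp (-(σsq / 8 * (N * t ^ 2))) := by
  have hσ' : (0 : ℝ) < σsq := hσ
  obtain ⟨K, hK, h⟩ := exists_norm_edgeworthChar_le hσ Q r
  obtain ⟨K', hK', h'⟩ := exists_sqrt_pow_le_mul_exp (c := (σsq : ℝ) / 8 * δ ^ 2) (by positivity) r
  refine ⟨K' * K, by positivity, fun N hN t ht => ?_⟩
  have h1 := h N hN (√(N : ℝ) * t)
  rw [mul_pow, Real.sq_sqrt N.cast_nonneg] at h1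
  have h2 : δ ^ 2 ≤ t ^ 2 := by
    rw [← sq_abs t]
    gcongr
  have h3 : √(N : ℝ) ^ r ≤ K' * Real.exp (σsq / 8 * (N * t ^ 2)) := by
    refine (h' N hN).trans ?_
    gcongr K' * Real.exp ?_
    have : (0 : ℝ) ≤ N := N.cast_nonneg
    calc (σsq : ℝ) / 8 * δ ^ 2 * N ≤ σsq / 8 * t ^ 2 * N := by gcongr
      _ = _ := by ring
  calc √(N : ℝ) ^ r * ‖edgeworthChar σsq Q r N (√(N : ℝ) * t)‖
      ≤ (K' * Real.exp (σsq / 8 * (N * t ^ 2))) * (K * Real.exp (-(σsq / 4 * (N * t ^ 2)))) := by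
        gcongr
    _ = K' * K * (Real.exp (σsq / 8 * (N * t ^ 2)) * Real.exp (-(σsq / 4 * (N * t ^ 2)))) := by ring
    _ = _ := by rw [← Real.exp_add]; ring_nf

end ErrorEstimate
end AvgEdgeworth

namespace AvgEdgeworth

/-! ### The weighted integral of the error in the characteristic functions. -/

section ErrorIntegral

open Topology

/-- Replaces |t| by 1 + |t| throughout; the exponent -(1 + q - β) on the right is below -1, hence
integrable, exactly when β < q. -/
lemma one_add_abs_rpow_div_le {β δ : ℝ} (hβ : 0 ≤ β) (hδ : 0 < δ) (q : ℕ) {t : ℝ} (ht : δ ≤ |t|) :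
    (1 + |t| ^ β) / (|t| * (1 + |t| ^ q))
      ≤ 2 * (1 + 1 / δ) * 2 ^ q * (1 + |t|) ^ (-(1 + q - β)) := by
  have ht0 : 0 < |t| := hδ.trans_le ht
  have h1 : 1 + |t| ^ β ≤ 2 * (1 + |t|) ^ β := by
    have h2 : 1 ≤ (1 + |t|) ^ β := Real.one_le_rpow (by linarith) hβ
    have h3 : |t| ^ β ≤ (1 + |t|) ^ β := Real.rpow_le_rpow ht0.le (by linarith) hβ
    linarith
  have h2 : 1 + |t| ≤ (1 + 1 / δ) * |t| := by
    have : 1 ≤ 1 / δ * |t| := by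
      rw [one_div, ← div_eq_inv_mul, le_div_iff₀ hδ]
      linarith
    linarith
  have h3 : (1 + |t|) ^ q ≤ 2 ^ q * (1 + |t| ^ q) := by
    rcases le_total |t| 1 with h | h
    · calc (1 + |t|) ^ q ≤ 2 ^ q := by gcongr; linarith
        _ ≤ 2 ^ q * (1 + |t| ^ q) := le_mul_of_one_le_right (by positivity) (by
          have : 0 ≤ |t| ^ q := by positivity
          linarith)
    · calc (1 + |t|) ^ q ≤ (2 * |t|) ^ q := by gcongr; linarith
        _ = 2 ^ q * |t| ^ q := mul_pow _ _ _
        _ ≤ _ := by gcongr; linarith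
  have h4 : (1 + |t|) ^ (-(1 + q - β)) = (1 + |t|) ^ β / ((1 + |t|) * (1 + |t|) ^ q) := by
    rw [show -(1 + q - β) = β - ((1 + q : ℕ) : ℝ) by push_cast; ring,
      Real.rpow_sub (by positivity), Real.rpow_natCast, pow_add, pow_one]
  rw [h4, ← mul_div_assoc, div_le_div_iff₀ (by positivity) (by positivity)]
  calc (1 + |t| ^ β) * ((1 + |t|) * (1 + |t|) ^ q)
      ≤ (2 * (1 + |t|) ^ β) * (((1 + 1 / δ) * |t|) * (2 ^ q * (1 + |t| ^ q))) := by gcongr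
    _ = _ := by ring

lemma integrable_abs_pow_mul_exp {c : ℝ} (hc : 0 < c) (n : ℕ) :
    Integrable fun u : ℝ => |u| ^ n * Real.exp (-(c * u ^ 2)) := by
  have h := (integrable_rpow_mul_exp_neg_mul_sq hc (s := n)
    (by linarith [(n.cast_nonneg : (0 : ℝ) ≤ n)])).norm
  refine h.congr (ae_of_all _ fun u => ?_)
  simp only
  rw [norm_mul, Real.rpow_natCast, norm_pow, Real.norm_eq_abs, Real.norm_of_nonneg (Real.exp_pos _).le,
    neg_mul]

/-- The weighted difference of two characteristic functions. -/
noncomputable def weightedError (D : ℕ → ℝ → ℝ) (q N : ℕ) (t : ℝ) : ℝ :=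
  D N t / (|t| * (1 + |t| ^ q))

variable {D : ℕ → ℝ → ℝ} {c C κ β : ℝ} {q r : ℕ}

lemma weightedError_nonneg (hD0 : ∀ N t, 0 ≤ D N t) (N : ℕ) (t : ℝ) :
    0 ≤ weightedError D q N t := div_nonneg (hD0 N t) (by positivity)

/-- Both terms of the bound contain a factor |t|, which cancels the singularity of the weight; at t
= 0 division by zero gives 0. -/
lemma weightedError_le_of_near (hr : 1 ≤ r) (hC : 0 ≤ C) (hκ0 : 0 < κ)
    {ε : ℝ} (hε : 0 ≤ ε) {N : ℕ} {t : ℝ}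
    (h : D N t ≤ ε * (|t| ^ r * Real.exp (-(c * (N * t ^ 2)))) + C * κ ^ N * |t|) :
    weightedError D q N t ≤ ε * (|t| ^ (r - 1) * Real.exp (-(c * (N * t ^ 2)))) + C * κ ^ N := by
  rcases eq_or_ne t 0 with rfl | ht
  · simp only [weightedError, abs_zero, zero_mul, div_zero]
    positivity
  · have ht0 : 0 < |t| := abs_pos.mpr ht
    obtain ⟨s, rfl⟩ : ∃ s, r = s + 1 := ⟨r - 1, by omega⟩
    rw [Nat.add_sub_cancel, weightedError, div_le_iff₀ (by positivity)]
    calc D N t ≤ (ε * (|t| ^ s * Real.exp (-(c * (N * t ^ 2)))) + C * κ ^ N) * (|t| * 1) := by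
          refine h.trans_eq ?_
          ring
      _ ≤ _ := by
          gcongr
          have : 0 ≤ |t| ^ q := by positivity
          linarith

lemma measurable_weightedError {N : ℕ} (hD : Measurable (D N)) :
    Measurable (weightedError D q N) := by
  unfold weightedError
  fun_prop

lemma weightedError_le_of_far (hβ : 0 ≤ β) {δ : ℝ} (hδ : 0 < δ) {K a : ℝ}
    (hK : 0 ≤ K) {N : ℕ} {t : ℝ} (ht : δ ≤ |t|) (h : a * D N t ≤ K * (1 + |t| ^ β)) :
    a * weightedError D q N t
      ≤ K * (2 * (1 + 1 / δ) * 2 ^ q) * (1 + |t|) ^ (-(1 + q - β)) := by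
  calc a * weightedError D q N t = a * D N t / (|t| * (1 + |t| ^ q)) := by
        rw [weightedError, mul_div_assoc]
    _ ≤ K * (1 + |t| ^ β) / (|t| * (1 + |t| ^ q)) := by gcongr
    _ = K * ((1 + |t| ^ β) / (|t| * (1 + |t| ^ q))) := mul_div_assoc _ _ _
    _ ≤ K * (2 * (1 + 1 / δ) * 2 ^ q * (1 + |t|) ^ (-(1 + q - β))) := by
        gcongr
        exact one_add_abs_rpow_div_le hβ hδ q ht
    _ = _ := by ring

lemma integrable_one_add_abs_rpow (hβq : β < q) :
    Integrable fun t : ℝ => (1 + |t|) ^ (-(1 + q - β)) := by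
  have := integrable_one_add_norm (E := ℝ) (μ := volume) (r := 1 + q - β) (by simp; linarith)
  simpa only [Real.norm_eq_abs] using this

lemma measurableSet_abs_le (δ : ℝ) : MeasurableSet {t : ℝ | |t| ≤ δ} :=
  (isClosed_le continuous_abs continuous_const).measurableSet

lemma setOf_abs_le_eq (δ : ℝ) : {t : ℝ | |t| ≤ δ} = Set.Icc (-δ) δ := by
  ext t
  exact abs_le (a := t) (b := δ)

lemma integrable_weightedError (hD0 : ∀ N t, 0 ≤ D N t) (hD : ∀ N, 1 ≤ N → Measurable (D N))
    (hr : 1 ≤ r) (hc : 0 < c) (hC : 0 ≤ C) (hκ0 : 0 < κ) (hq : 1 ≤ q)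
    (hnear : ∀ ε : ℝ, 0 < ε → ∃ δ : ℝ, 0 < δ ∧ ∀ t : ℝ, |t| ≤ δ → ∀ N : ℕ, 1 ≤ N →
      D N t ≤ ε * (|t| ^ r * Real.exp (-(c * (N * t ^ 2)))) + C * κ ^ N * |t|)
    (hbdd : ∀ N, 1 ≤ N → ∃ M, ∀ t, D N t ≤ M) {N : ℕ} (hN : 1 ≤ N) :
    Integrable (weightedError D q N) := by
  obtain ⟨δ, hδ, h⟩ := hnear 1 one_pos
  obtain ⟨M, hM⟩ := hbdd N hN
  have hM0 : 0 ≤ M := (hD0 N 0).trans (hM 0)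
  have hN0 : (0 : ℝ) < N := by exact_mod_cast hN
  have hm := measurable_weightedError (q := q) (hD N hN)
  rw [← integrableOn_univ, ← Set.union_compl_self {t : ℝ | |t| ≤ δ}]
  refine IntegrableOn.union ?_ ?_
  · have h1 : Integrable fun t : ℝ => 1 * (|t| ^ (r - 1) * Real.exp (-(c * (N * t ^ 2)))) := by
      have := (integrable_abs_pow_mul_exp (mul_pos hc hN0) (r - 1)).const_mul 1
      simpa only [mul_assoc] using this
    have h2 : IntegrableOn (fun _ : ℝ => C * κ ^ N) {t : ℝ | |t| ≤ δ} := by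
      rw [setOf_abs_le_eq]
      exact integrableOn_const (by simp)
    refine (h1.integrableOn.add h2).mono' hm.aestronglyMeasurable ?_
    refine (ae_restrict_iff' (measurableSet_abs_le δ)).mpr (ae_of_all _ fun t ht => ?_)
    rw [Real.norm_of_nonneg (weightedError_nonneg hD0 N t)]
    exact weightedError_le_of_near hr hC hκ0 one_pos.le (h t ht N hN)
  · have h1 := (integrable_one_add_abs_rpow (β := 0) (q := q) (by exact_mod_cast hq)).const_mul
      (M * (2 * (1 + 1 / δ) * 2 ^ q))
    refine h1.integrableOn.mono' hm.aestronglyMeasurable ?_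
    refine (ae_restrict_iff' (measurableSet_abs_le δ).compl).mpr (ae_of_all _ fun t ht => ?_)
    rw [Real.norm_of_nonneg (weightedError_nonneg hD0 N t)]
    have ht' : δ ≤ |t| := (not_le.mp (show ¬ |t| ≤ δ from ht)).le
    have h2 := weightedError_le_of_far (D := D) (q := q) (le_refl (0 : ℝ)) hδ hM0 (a := 1) (N := N) ht'
      (by
        rw [one_mul, Real.rpow_zero]
        linarith [hM t])
    rwa [one_mul] at h2

/-- The uniform bound alone would give only O(N^{-r/2}). It serves as the majorant for dominated
convergence, and the pointwise limit improves O to o. -/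
lemma tendsto_setIntegral_weightedError_far (hD0 : ∀ N t, 0 ≤ D N t)
    (hD : ∀ N, 1 ≤ N → Measurable (D N)) (hβ : 0 ≤ β) (hβq : β < q)
    (hfar : ∀ δ : ℝ, 0 < δ → ∃ K : ℝ, ∀ᶠ N : ℕ in atTop, ∀ t : ℝ, δ ≤ |t| →
      √(N : ℝ) ^ r * D N t ≤ K * (1 + |t| ^ β))
    (hlim : ∀ t : ℝ, t ≠ 0 → Tendsto (fun N : ℕ => √(N : ℝ) ^ r * D N t) atTop (𝓝 0))
    {δ : ℝ} (hδ : 0 < δ) :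
    Tendsto (fun N : ℕ => √(N : ℝ) ^ r * ∫ t in {t : ℝ | |t| ≤ δ}ᶜ, weightedError D q N t)
      atTop (𝓝 0) := by
  obtain ⟨K, hK⟩ := hfar δ hδ
  have h := tendsto_integral_filter_of_dominated_convergence (l := atTop)
    (μ := volume.restrict {t : ℝ | |t| ≤ δ}ᶜ)
    (F := fun (N : ℕ) t => √(N : ℝ) ^ r * weightedError D q N t) (f := fun _ => (0 : ℝ))
    (fun t => |K| * (2 * (1 + 1 / δ) * 2 ^ q) * (1 + |t|) ^ (-(1 + q - β))) ?_ ?_ ?_ ?_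
  · simpa only [integral_const_mul, integral_zero] using h
  · filter_upwards [eventually_ge_atTop 1] with N hN
    exact ((measurable_weightedError (hD N hN)).const_mul _).aestronglyMeasurable
  · filter_upwards [hK] with N hN
    refine (ae_restrict_iff' (measurableSet_abs_le δ).compl).mpr (ae_of_all _ fun t ht => ?_)
    have ht' : δ ≤ |t| := (not_le.mp (show ¬ |t| ≤ δ from ht)).le
    rw [Real.norm_of_nonneg (mul_nonneg (by positivity) (weightedError_nonneg hD0 N t))]
    refine weightedError_le_of_far hβ hδ (abs_nonneg K) ht' ((hN t ht').trans ?_)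
    gcongr
    exact le_abs_self K
  · exact ((integrable_one_add_abs_rpow hβq).const_mul _).integrableOn
  · refine (ae_restrict_iff' (measurableSet_abs_le δ).compl).mpr (ae_of_all _ fun t ht => ?_)
    have ht' : δ < |t| := not_le.mp (show ¬ |t| ≤ δ from ht)
    have h1 := (hlim t (abs_pos.mp (hδ.trans ht'))).div_const (|t| * (1 + |t| ^ q))
    simpa only [zero_div, weightedError, mul_div_assoc] using h1

/-- The substitution u = √N t turns N^{r/2} ∫ |t|^{r-1} e^{-cNt²} dt into a constant, so the factor
ε survives. -/
lemma sqrt_pow_mul_setIntegral_weightedError_near_le (hr : 1 ≤ r)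
    (hc : 0 < c) (hC : 0 ≤ C) (hκ0 : 0 < κ) {ε δ : ℝ} (hε : 0 ≤ ε) (hδ : 0 < δ) {N : ℕ}
    (hN : 1 ≤ N) (hint : Integrable (weightedError D q N))
    (h : ∀ t : ℝ, |t| ≤ δ →
      D N t ≤ ε * (|t| ^ r * Real.exp (-(c * (N * t ^ 2)))) + C * κ ^ N * |t|) :
    √(N : ℝ) ^ r * ∫ t in {t : ℝ | |t| ≤ δ}, weightedError D q N t
      ≤ ε * (∫ u : ℝ, |u| ^ (r - 1) * Real.exp (-(c * u ^ 2)))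
        + √(N : ℝ) ^ r * κ ^ N * (C * (2 * δ)) := by
  have hN0 : (0 : ℝ) < N := by exact_mod_cast hN
  have hs : 0 < √(N : ℝ) := Real.sqrt_pos.mpr hN0
  have h1 : Integrable fun t : ℝ => |t| ^ (r - 1) * Real.exp (-(c * (N * t ^ 2))) := by
    simpa only [mul_assoc] using integrable_abs_pow_mul_exp (mul_pos hc hN0) (r - 1)
  have h2 : IntegrableOn (fun _ : ℝ => C * κ ^ N) {t : ℝ | |t| ≤ δ} := by
    rw [setOf_abs_le_eq]
    exact integrableOn_const (by simp)
  have h3 : ∫ t in {t : ℝ | |t| ≤ δ}, weightedError D q N t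
      ≤ (∫ t : ℝ, ε * (|t| ^ (r - 1) * Real.exp (-(c * (N * t ^ 2))))) + C * κ ^ N * (2 * δ) := by
    calc ∫ t in {t : ℝ | |t| ≤ δ}, weightedError D q N t
        ≤ ∫ t in {t : ℝ | |t| ≤ δ},
            (ε * (|t| ^ (r - 1) * Real.exp (-(c * (N * t ^ 2)))) + C * κ ^ N) :=
          setIntegral_mono_on hint.integrableOn ((h1.const_mul ε).integrableOn.add h2)
            (measurableSet_abs_le δ)
            fun t ht => weightedError_le_of_near hr hC hκ0 hε (h t ht)
      _ = (∫ t in {t : ℝ | |t| ≤ δ}, ε * (|t| ^ (r - 1) * Real.exp (-(c * (N * t ^ 2)))))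
            + ∫ t in {t : ℝ | |t| ≤ δ}, C * κ ^ N :=
          integral_add (h1.const_mul ε).integrableOn h2
      _ ≤ _ := by
          gcongr ?_ + ?_
          · exact setIntegral_le_integral (h1.const_mul ε) (ae_of_all _ fun t => by positivity)
          · rw [setIntegral_const, setOf_abs_le_eq, Real.volume_real_Icc_of_le (by linarith),
              smul_eq_mul]
            apply le_of_eq
            ring
  have h4 : √(N : ℝ) ^ r * ∫ t : ℝ, |t| ^ (r - 1) * Real.exp (-(c * (N * t ^ 2)))
      = ∫ u : ℝ, |u| ^ (r - 1) * Real.exp (-(c * u ^ 2)) := by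
    have h5 := Measure.integral_comp_mul_left
      (fun u : ℝ => |u| ^ (r - 1) * Real.exp (-(c * u ^ 2))) (√(N : ℝ))
    rw [abs_of_pos (inv_pos.mpr hs), smul_eq_mul] at h5
    have h6 : (∫ u : ℝ, |u| ^ (r - 1) * Real.exp (-(c * u ^ 2)))
        = √(N : ℝ) * ∫ t : ℝ, |√(N : ℝ) * t| ^ (r - 1) * Real.exp (-(c * (√(N : ℝ) * t) ^ 2)) := by
      rw [h5]
      field_simp
    rw [h6, ← integral_const_mul, ← integral_const_mul]
    congr 1
    ext t
    obtain ⟨s, rfl⟩ : ∃ s, r = s + 1 := ⟨r - 1, by omega⟩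
    rw [Nat.add_sub_cancel, abs_mul, abs_of_pos hs, mul_pow, mul_pow, Real.sq_sqrt hN0.le]
    ring
  calc _ ≤ √(N : ℝ) ^ r * ((∫ t : ℝ, ε * (|t| ^ (r - 1) * Real.exp (-(c * (N * t ^ 2)))))
        + C * κ ^ N * (2 * δ)) := by gcongr
    _ = _ := by
        rw [integral_const_mul, ← h4]
        ring

/-- The weighted `L¹` distance of the characteristic functions is `o(N ^ (-r / 2))`. -/
theorem isLittleO_integral_weightedError (hD0 : ∀ N t, 0 ≤ D N t)
    (hD : ∀ N, 1 ≤ N → Measurable (D N))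
    (hr : 1 ≤ r) (hc : 0 < c) (hC : 0 ≤ C) (hκ0 : 0 < κ) (hκ1 : κ < 1) (hq : 1 ≤ q) (hβ : 0 ≤ β)
    (hβq : β < q)
    (hnear : ∀ ε : ℝ, 0 < ε → ∃ δ : ℝ, 0 < δ ∧ ∀ t : ℝ, |t| ≤ δ → ∀ N : ℕ, 1 ≤ N →
      D N t ≤ ε * (|t| ^ r * Real.exp (-(c * (N * t ^ 2)))) + C * κ ^ N * |t|)
    (hbdd : ∀ N, 1 ≤ N → ∃ M, ∀ t, D N t ≤ M)
    (hfar : ∀ δ : ℝ, 0 < δ → ∃ K : ℝ, ∀ᶠ N : ℕ in atTop, ∀ t : ℝ, δ ≤ |t| →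
      √(N : ℝ) ^ r * D N t ≤ K * (1 + |t| ^ β))
    (hlim : ∀ t : ℝ, t ≠ 0 → Tendsto (fun N : ℕ => √(N : ℝ) ^ r * D N t) atTop (𝓝 0)) :
    (fun N => ∫ t, weightedError D q N t) =o[atTop] fun N : ℕ => (N : ℝ) ^ (-(r : ℝ) / 2) := by
  have hint : ∀ N, 1 ≤ N → Integrable (weightedError D q N) := fun N hN =>
    integrable_weightedError hD0 hD hr hc hC hκ0 hq hnear hbdd hN
  have key : Tendsto (fun N : ℕ => √(N : ℝ) ^ r * ∫ t, weightedError D q N t) atTop (𝓝 0) := by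
    set K₀ : ℝ := ∫ u : ℝ, |u| ^ (r - 1) * Real.exp (-(c * u ^ 2)) with hK₀
    have hK₀0 : 0 ≤ K₀ := integral_nonneg fun u => by positivity
    have hnn : ∀ N : ℕ, 0 ≤ √(N : ℝ) ^ r * ∫ t, weightedError D q N t := fun N =>
      mul_nonneg (by positivity) (integral_nonneg fun t => weightedError_nonneg hD0 N t)
    refine tendsto_order.mpr ⟨fun a ha => Eventually.of_forall fun N => ha.trans_le (hnn N),
      fun a ha => ?_⟩
    -- With this ε the main term near 0 is at most a/2; for the δ it fixes, the exponentially small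
    -- term and the far part are together below a/2 for large N.
    obtain ⟨δ, hδ, h⟩ := hnear (a / (2 * (K₀ + 1))) (by positivity)
    have h1 := ((tendsto_sqrt_pow_mul_pow hκ0 hκ1 r).mul_const (C * (2 * δ))).add
      (tendsto_setIntegral_weightedError_far (q := q) hD0 hD hβ hβq hfar hlim hδ)
    rw [zero_mul, zero_add] at h1
    filter_upwards [h1.eventually_lt_const (half_pos ha), eventually_ge_atTop 1] with N hN hN1
    have h2 := sqrt_pow_mul_setIntegral_weightedError_near_le hr hc hC hκ0
      (by positivity : 0 ≤ a / (2 * (K₀ + 1))) hδ hN1 (hint N hN1) (fun t ht => h t ht N hN1)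
    have h3 : a / (2 * (K₀ + 1)) * K₀ ≤ a / 2 := by
      rw [div_mul_eq_mul_div, div_le_div_iff₀ (by positivity) two_pos]
      nlinarith
    rw [← integral_add_compl (measurableSet_abs_le δ) (hint N hN1), mul_add]
    linarith
  rw [isLittleO_iff_tendsto']
  · refine key.congr fun N => ?_
    rw [sqrt_pow_eq_rpow, neg_div, Real.rpow_neg N.cast_nonneg, div_inv_eq_mul, mul_comm]
  · filter_upwards [eventually_ge_atTop 1] with N hN h
    have : (0 : ℝ) < N := by exact_mod_cast hN
    exact absurd h (Real.rpow_pos_of_pos this _).ne'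

end ErrorIntegral
end AvgEdgeworth

namespace AvgEdgeworth

/-! ### Laws of S_N and of its normalization. -/

section Laws

open Topology

variable {Ω : Type*} [MeasurableSpace Ω]

/-- The characteristic function of `S N`. -/
noncomputable def rvChar (P : Measure Ω) (S : ℕ → Ω → ℝ) (N : ℕ) (t : ℝ) : ℂ :=
  ∫ ω, Complex.exp (Complex.I * (t : ℂ) * (S N ω : ℂ)) ∂P

variable (P : Measure Ω) [IsProbabilityMeasure P] (S : ℕ → Ω → ℝ)

lemma norm_rvChar_le_one (N : ℕ) (t : ℝ) : ‖rvChar P S N t‖ ≤ 1 := by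
  have h := norm_integral_le_of_norm_le_const (μ := P) (C := 1)
    (f := fun ω => Complex.exp (Complex.I * (t : ℂ) * (S N ω : ℂ)))
    (Eventually.of_forall fun ω => by rw [Complex.norm_exp]; simp)
  simpa [rvChar] using h

lemma rvChar_zero (N : ℕ) : rvChar P S N 0 = 1 := by
  simp [rvChar]

lemma conj_rvChar (N : ℕ) (t : ℝ) : (starRingEnd ℂ) (rvChar P S N t) = rvChar P S N (-t) := by
  rw [rvChar, rvChar, ← integral_conj]
  refine integral_congr_ae (Eventually.of_forall fun ω => ?_)
  simp only [← Complex.exp_conj]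
  simp

variable {P S}

lemma measurable_normalized (hS : ∀ N, Measurable (S N)) (A : ℝ) (N : ℕ) :
    Measurable (normalized S A N) :=
  ((hS N).sub_const _).div_const _

lemma charFun_map_normalized (hS : ∀ N, Measurable (S N)) (A : ℝ) (N : ℕ) (u : ℝ) :
    charFun (P.map (normalized S A N)) u
      = Complex.exp (-(Complex.I * A * √(N : ℝ) * u)) * rvChar P S N (u / √(N : ℝ)) := by
  rw [charFun_apply_real, integral_map (measurable_normalized hS A N).aemeasurable
    (Continuous.aestronglyMeasurable (by fun_prop)), rvChar, ← integral_const_mul]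
  refine integral_congr_ae (Eventually.of_forall fun ω => ?_)
  simp only [← Complex.exp_add]
  congr 1
  have h : u * normalized S A N ω = -(A * √(N : ℝ) * u) + u / √(N : ℝ) * S N ω := by
    have h1 : (N : ℝ) / √(N : ℝ) = √(N : ℝ) := Real.div_sqrt
    rw [normalized, sub_div, mul_div_right_comm, h1]
    ring
  rw [← Complex.ofReal_mul, h]
  push_cast
  ring

lemma tendstoInDistribution_normalized (hS : ∀ N, Measurable (S N)) {A : ℝ} {σsq : ℝ≥0}
    (h : ∀ u : ℝ, Tendsto (fun N : ℕ => Complex.exp (-(Complex.I * A * √(N : ℝ) * u))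
      * rvChar P S N (u / √(N : ℝ))) atTop (𝓝 (Complex.exp (-(σsq * u ^ 2) / 2)))) :
    TendstoInDistribution (fun N : ℕ => normalized S A N) atTop (id : ℝ → ℝ) (fun _ => P)
      (gaussianReal 0 σsq) where
  forall_aemeasurable N := (measurable_normalized hS A N).aemeasurable
  aemeasurable_limit := aemeasurable_id
  tendsto := by
    refine ProbabilityMeasure.tendsto_iff_tendsto_charFun.2 fun u => ?_
    simp only [ProbabilityMeasure.coe_mk, Measure.map_id, charFun_map_normalized hS,
      charFun_gaussianReal]
    convert h u using 3
    push_cast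
    ring

lemma charOf_map_sub (hS : ∀ N, Measurable (S N)) (A : ℝ) (N : ℕ) (t : ℝ) :
    charOf (P.map fun ω => S N ω - N * A) 1 t
      = Complex.exp (-(Complex.I * (N * A) * t)) * rvChar P S N t := by
  have hm : Measurable fun ω => S N ω - N * A := (hS N).sub_const _
  rw [charOf, integral_map hm.aemeasurable (Continuous.aestronglyMeasurable (by
    simp only [Pi.one_apply]
    fun_prop)), rvChar, ← integral_const_mul]
  refine integral_congr_ae (Eventually.of_forall fun ω => ?_)
  simp only [← Complex.exp_add, Pi.one_apply, mul_one]
  congr 1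
  push_cast
  ring

lemma cdfOf_map_sub (hS : ∀ N, Measurable (S N)) (A : ℝ) {N : ℕ} (hN : 1 ≤ N) (x y : ℝ) :
    cdfOf (P.map fun ω => S N ω - N * A) 1 (√(N : ℝ) * x + y)
      = (P.real {ω | normalized S A N ω ≤ x + y / √(N : ℝ)} : ℂ) := by
  have hm : Measurable fun ω => S N ω - N * A := (hS N).sub_const _
  have hs : 0 < √(N : ℝ) := Real.sqrt_pos.mpr (by exact_mod_cast hN)
  have h1 : {ω | normalized S A N ω ≤ x + y / √(N : ℝ)}
      = (fun ω => S N ω - N * A) ⁻¹' Set.Iic (√(N : ℝ) * x + y) := by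
    ext ω
    change (S N ω - N * A) / √(N : ℝ) ≤ x + y / √(N : ℝ) ↔ S N ω - N * A ≤ √(N : ℝ) * x + y
    rw [div_le_iff₀ hs]
    have : (x + y / √(N : ℝ)) * √(N : ℝ) = √(N : ℝ) * x + y := by field_simp
    rw [this]
  rw [h1, ← map_measureReal_apply hm measurableSet_Iic, cdfOf]
  simp

end Laws

/-! ### Fourier decay of the test functions. -/

section TestFunctions

open FourierTransform

variable {q : ℕ} {f : ℝ → ℂ}

lemma eLpNorm_iteratedDeriv_le (f : ℝ → ℂ) {j : ℕ} (hj : j ≤ q) :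
    eLpNorm (iteratedDeriv j f) 1 volume ≤ normDeriv q f :=
  Finset.le_sup (f := fun j => eLpNorm (iteratedDeriv j f) 1 volume)
    (Finset.mem_range.mpr (Nat.lt_succ_of_le hj))

lemma integrable_iteratedDeriv_of_mem_spaceF (hf : f ∈ spaceF q 0) {j : ℕ} (hj : j ≤ q) :
    Integrable (iteratedDeriv j f) :=
  memLp_one_iff_integrable.mp
    ⟨(hf.1.continuous_iteratedDeriv j (by exact_mod_cast hj)).aestronglyMeasurable,
      ((eLpNorm_iteratedDeriv_le f hj).trans le_self_add).trans_lt hf.2⟩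

lemma integral_norm_iteratedDeriv_add_le (hf : f ∈ spaceF q 0) :
    (∫ x, ‖iteratedDeriv q f x‖) + ∫ x, ‖f x‖ ≤ (normF q 0 f).toReal := by
  have hq := integrable_iteratedDeriv_of_mem_spaceF hf le_rfl
  have h0 := integrable_iteratedDeriv_of_mem_spaceF hf (Nat.zero_le q)
  rw [iteratedDeriv_zero] at h0
  have h1 : eLpNorm (iteratedDeriv q f) 1 volume + eLpNorm f 1 volume ≤ normF q 0 f := by
    refine add_le_add (eLpNorm_iteratedDeriv_le f le_rfl) ?_
    simp [normMoment]
  have h2 := ENNReal.toReal_mono hf.2.ne h1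
  rwa [ENNReal.toReal_add (memLp_one_iff_integrable.mpr hq).2.ne
    (memLp_one_iff_integrable.mpr h0).2.ne, eLpNorm_one_eq_lintegral_enorm,
    eLpNorm_one_eq_lintegral_enorm, ← integral_norm_eq_lintegral_enorm hq.1,
    ← integral_norm_eq_lintegral_enorm h0.1] at h2

/-- Adds the trivial bounds on the transforms of f and of its q-th derivative. -/
lemma one_add_pow_mul_norm_fourier_le (hf : f ∈ spaceF q 0) (ξ : ℝ) :
    (1 + |2 * Real.pi * ξ| ^ q) * ‖𝓕 f ξ‖ ≤ (normF q 0 f).toReal := by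
  have h1 := Real.fourier_iteratedDeriv (N := q) (n := q) hf.1
    (fun n hn => integrable_iteratedDeriv_of_mem_spaceF hf (by exact_mod_cast hn)) le_rfl
  have h2 := norm_fourier_le (iteratedDeriv q f) ξ
  rw [h1] at h2
  have h3 : ‖(2 * Real.pi * Complex.I * ξ : ℂ) ^ q • 𝓕 f ξ‖ = |2 * Real.pi * ξ| ^ q * ‖𝓕 f ξ‖ := by
    rw [norm_smul, norm_pow]
    congr 2
    simp [abs_mul]
  rw [h3] at h2
  have h4 := norm_fourier_le f ξ
  linarith [integral_norm_iteratedDeriv_add_le hf]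

end TestFunctions
end AvgEdgeworth

namespace AvgEdgeworth

/-! ### The averaged expansion. -/

section Expansion

open Topology FourierTransform Polynomial

variable {Ω : Type*} [MeasurableSpace Ω] {P : Measure Ω} [IsProbabilityMeasure P] {S : ℕ → Ω → ℝ}
  {σsq : ℝ≥0} {q r : ℕ}

/-- The distance of the characteristic function of `S N - N A` from its Edgeworth approximation. -/
noncomputable def charError (P : Measure Ω) (S : ℕ → Ω → ℝ) (A : ℝ) (σsq : ℝ≥0) (Q : ℕ → ℝ[X])
    (r N : ℕ) (t : ℝ) : ℝ :=
  ‖Complex.exp (-(Complex.I * (N * A) * t)) * rvChar P S N t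
    - edgeworthChar σsq Q r N (√(N : ℝ) * t)‖

lemma integrable_cdfOf_comp_mul {M : Measure ℝ} [SFinite M] {w f : ℝ → ℂ} (hwm : Measurable w)
    (hw : Integrable w M) (hf : Integrable f) (z s : ℝ) :
    Integrable fun y => cdfOf M w (z + y / s) * f y :=
  hf.bdd_mul ((stronglyMeasurable_cdfOf hwm).comp_measurable (by fun_prop)).aestronglyMeasurable
    (Eventually.of_forall fun _ => norm_cdfOf_le hw _)

/-- A polynomial times the Gaussian density is bounded, being the primitive of its integrable
derivative. -/
lemma integrable_gaussianDensity_comp_mul (hσ : 0 < σsq) (R : ℝ[X]) {f : ℝ → ℂ} (hf : Integrable f)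
    (z s : ℝ) : Integrable fun y => gaussianDensity σsq R (z + y / s) * f y := by
  simp_rw [← cdfOf_gaussianDeriv hσ R]
  exact integrable_cdfOf_comp_mul (measurable_gaussianDensity _) (integrable_gaussianDensity hσ _)
    hf z s

lemma inv_sqrt_pow_eq (N p : ℕ) :
    (((1 / (N : ℝ) ^ ((p : ℝ) / 2) : ℝ)) : ℂ) = ((√(N : ℝ))⁻¹ : ℂ) ^ p := by
  rw [← sqrt_pow_eq_rpow, one_div]
  push_cast
  rw [inv_pow]

/-- The averaged expansion error is an integral of the difference of two distribution functions. -/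
lemma expansion_error_eq (hS : ∀ N, Measurable (S N)) (hσ : 0 < σsq) {A : ℝ} {N : ℕ} (hN : 1 ≤ N)
    {T : ℕ → ℝ[X]} {R : ℝ[X]}
    (hR : ∀ x, cdfOf volume (gaussianDensity σsq R) x = (normalCdf σsq x : ℂ)
      + ∑ p ∈ Finset.Icc 1 r, ((1 / (N : ℝ) ^ ((p : ℝ) / 2) : ℝ) : ℂ) * gaussianDensity σsq (T p) x)
    {f : ℝ → ℂ} (hf : Integrable f) (z : ℝ) :
    (∫ y : ℝ, ((P.real {ω | normalized S A N ω ≤ z + y / √(N : ℝ)}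
            - normalCdf σsq (z + y / √(N : ℝ)) : ℝ) : ℂ) * f y)
        - ∑ p ∈ Finset.Icc 1 r, ((1 / (N : ℝ) ^ ((p : ℝ) / 2) : ℝ) : ℂ) *
            ∫ y : ℝ, (((T p).eval (z + y / √(N : ℝ))
              * gaussianPDFReal 0 σsq (z + y / √(N : ℝ)) : ℝ) : ℂ) * f y
      = ∫ y, (cdfOf (P.map fun ω => S N ω - N * A) 1 (√(N : ℝ) * z + y)
          - cdfOf volume (fun y => ((√(N : ℝ) : ℝ) : ℂ)⁻¹ * gaussianDensity σsq R (y / √(N : ℝ)))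
            (√(N : ℝ) * z + y)) * f y := by
  have hm : Measurable fun ω => S N ω - N * A := (hS N).sub_const _
  have hs : 0 < √(N : ℝ) := Real.sqrt_pos.mpr (by exact_mod_cast hN)
  have hprob : IsProbabilityMeasure (P.map fun ω => S N ω - N * A) :=
    Measure.isProbabilityMeasure_map hm.aemeasurable
  have h1 : Integrable fun y : ℝ => (P.real {ω | normalized S A N ω ≤ z + y / √(N : ℝ)} : ℂ) * f y := by
    simp_rw [← cdfOf_map_sub hS A hN]
    exact integrable_cdfOf_mul measurable_one (integrable_const _) hf _
  have h2 : Integrable fun y : ℝ => (normalCdf σsq (z + y / √(N : ℝ)) : ℂ) * f y := by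
    simp_rw [← cdfOf_gaussianDensity_one]
    exact integrable_cdfOf_comp_mul (measurable_gaussianDensity _) (integrable_gaussianDensity hσ _)
      hf z _
  have h3 : ∀ p ∈ Finset.Icc 1 r, Integrable fun y : ℝ =>
      ((1 / (N : ℝ) ^ ((p : ℝ) / 2) : ℝ) : ℂ)
        * (gaussianDensity σsq (T p) (z + y / √(N : ℝ)) * f y) := fun p _ =>
    (integrable_gaussianDensity_comp_mul hσ (T p) hf z _).const_mul _
  have h4 : ∀ y : ℝ, (√(N : ℝ) * z + y) / √(N : ℝ) = z + y / √(N : ℝ) := fun y => by field_simp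
  simp_rw [cdfOf_scale _ hs, h4, hR, cdfOf_map_sub hS A hN]
  change _ - ∑ p ∈ Finset.Icc 1 r, ((1 / (N : ℝ) ^ ((p : ℝ) / 2) : ℝ) : ℂ) *
    ∫ y : ℝ, gaussianDensity σsq (T p) (z + y / √(N : ℝ)) * f y = _
  simp_rw [← integral_const_mul]
  rw [← integral_finsetSum _ h3, ← integral_sub ?_ (integrable_finsetSum _ h3)]
  · refine integral_congr_ae (Eventually.of_forall fun y => ?_)
    simp only [Complex.ofReal_sub, ← mul_assoc, ← Finset.sum_mul]
    ring
  · refine (h1.sub h2).congr (Eventually.of_forall fun y => ?_)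
    simp only [Pi.sub_apply, Complex.ofReal_sub, sub_mul]

/-- The smoothing inequality with g(ξ) = 2 c W(2πξ), where c is the norm of f: with t = 2πξ, π|ξ|
g(ξ) = c |t| W(t), which is the Fourier bound for f times the error. The change of variables leaves
c/π ∫ W. -/
lemma norm_expansion_error_le (hS : ∀ N, Measurable (S N)) (hσ : 0 < σsq) (hq : 1 ≤ q) {A : ℝ}
    {N : ℕ} (hN : 1 ≤ N) {Q T : ℕ → ℝ[X]} {R : ℝ[X]}
    (hRc : ∀ u : ℝ, charOf volume (gaussianDensity σsq R) u = edgeworthChar σsq Q r N u)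
    (hR : ∀ x, cdfOf volume (gaussianDensity σsq R) x = (normalCdf σsq x : ℂ)
      + ∑ p ∈ Finset.Icc 1 r, ((1 / (N : ℝ) ^ ((p : ℝ) / 2) : ℝ) : ℂ) * gaussianDensity σsq (T p) x)
    (hint : Integrable (weightedError (charError P S A σsq Q r) q N))
    {f : ℝ → ℂ} (hf : f ∈ spaceF q 0) (z : ℝ) :
    ‖(∫ y : ℝ, ((P.real {ω | normalized S A N ω ≤ z + y / √(N : ℝ)}
            - normalCdf σsq (z + y / √(N : ℝ)) : ℝ) : ℂ) * f y)
        - ∑ p ∈ Finset.Icc 1 r, ((1 / (N : ℝ) ^ ((p : ℝ) / 2) : ℝ) : ℂ) *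
            ∫ y : ℝ, (((T p).eval (z + y / √(N : ℝ))
              * gaussianPDFReal 0 σsq (z + y / √(N : ℝ)) : ℝ) : ℂ) * f y‖
      ≤ (normF q 0 f).toReal
        * (Real.pi⁻¹ * ∫ t, weightedError (charError P S A σsq Q r) q N t) := by
  have hm : Measurable fun ω => S N ω - N * A := (hS N).sub_const _
  have hs : 0 < √(N : ℝ) := Real.sqrt_pos.mpr (by exact_mod_cast hN)
  have hprob : IsProbabilityMeasure (P.map fun ω => S N ω - N * A) :=
    Measure.isProbabilityMeasure_map hm.aemeasurable
  have hf0 := integrable_iteratedDeriv_of_mem_spaceF hf (Nat.zero_le q)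
  have hf1 := integrable_iteratedDeriv_of_mem_spaceF hf hq
  rw [iteratedDeriv_zero] at hf0
  rw [iteratedDeriv_one] at hf1
  rw [expansion_error_eq hS hσ hN hR hf0]
  set c : ℝ := (normF q 0 f).toReal with hc
  set W := weightedError (charError P S A σsq Q r) q N with hW
  have h1 : Integrable fun ξ : ℝ => 2 * c * W (2 * Real.pi * ξ) :=
    (hint.comp_mul_left' (by positivity)).const_mul _
  have h2 : ∫ ξ : ℝ, 2 * c * W (2 * Real.pi * ξ) = c * (Real.pi⁻¹ * ∫ t, W t) := by
    rw [integral_const_mul, Measure.integral_comp_mul_left W, smul_eq_mul,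
      abs_of_pos (by positivity)]
    field_simp
  have h8 : Measurable fun y : ℝ =>
      ((√(N : ℝ) : ℝ) : ℂ)⁻¹ * gaussianDensity σsq R (y / √(N : ℝ)) :=
    ((measurable_gaussianDensity R).comp (measurable_id.div_const _)).const_mul _
  rw [← h2]
  refine norm_integral_cdfOf_sub_le measurable_one (integrable_const _) h8
    (((integrable_gaussianDensity hσ R).comp_div hs.ne').const_mul _)
    (hf.1.differentiable (by exact_mod_cast (by omega : q ≠ 0))) hf0 hf1 h1 (fun ξ hξ => ?_) _
  rw [charOf_scale _ hs, hRc, charOf_map_sub hS]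
  have hξ0 : 0 < |ξ| := abs_pos.mpr hξ
  have h3 : |2 * Real.pi * ξ| = 2 * Real.pi * |ξ| := by
    rw [abs_mul, abs_of_pos (by positivity)]
  have h4 := one_add_pow_mul_norm_fourier_le hf ξ
  rw [← hc] at h4
  have h5 : 0 < 1 + |2 * Real.pi * ξ| ^ q := by positivity
  change charError P S A σsq Q r N (2 * Real.pi * ξ) * ‖𝓕 f ξ‖ ≤ _
  have h6 : Real.pi * |ξ| * (2 * c * W (2 * Real.pi * ξ))
      = charError P S A σsq Q r N (2 * Real.pi * ξ) * (c / (1 + |2 * Real.pi * ξ| ^ q)) := by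
    rw [hW, weightedError]
    set E := 1 + |2 * Real.pi * ξ| ^ q with hE
    rw [h3]
    field_simp
  rw [h6]
  have h7 : 0 ≤ charError P S A σsq Q r N (2 * Real.pi * ξ) := norm_nonneg _
  gcongr
  rw [le_div_iff₀ h5, mul_comm]
  exact h4

/-- The averaged expansion follows from the estimates for the characteristic functions. -/
theorem admitsAveragedExpansion_of_charError (hS : ∀ N, Measurable (S N)) (hσ : 0 < σsq)
    (hq : 1 ≤ q) {A : ℝ} {Q : ℕ → ℝ[X]} (hQ : ∀ p, 1 ≤ p → (Q p).eval 0 = 0)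
    (hint : ∀ N, 1 ≤ N → Integrable (weightedError (charError P S A σsq Q r) q N))
    (ho : (fun N => ∫ t, weightedError (charError P S A σsq Q r) q N t)
      =o[atTop] fun N : ℕ => (N : ℝ) ^ (-(r : ℝ) / 2)) :
    AdmitsAveragedExpansion P S A σsq r (spaceF q 0) (fun f => (normF q 0 f).toReal) := by
  obtain ⟨T, hT⟩ := exists_edgeworth_density hσ Q hQ r
  refine ⟨T, fun N => Real.pi⁻¹ * ∫ t, weightedError (charError P S A σsq Q r) q N t,
    ho.const_mul_left _, fun f hf N hN z => ?_⟩
  obtain ⟨R, hRc, hR⟩ := hT fun p => 1 / (N : ℝ) ^ ((p : ℝ) / 2)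
  refine norm_expansion_error_le hS hσ hq hN (fun u => ?_) hR (hint N hN) hf z
  rw [hRc, edgeworthChar]
  simp_rw [inv_sqrt_pow_eq]

lemma continuous_edgeworthChar (σsq : ℝ≥0) (Q : ℕ → ℝ[X]) (r N : ℕ) :
    Continuous (edgeworthChar σsq Q r N) := by
  unfold edgeworthChar
  refine Continuous.mul (by fun_prop) (continuous_const.add (continuous_finsetSum _ fun p _ =>
    continuous_const.mul ?_))
  exact (Q p).continuous_aeval.comp (by fun_prop)

variable {B : Type*} [NormedAddCommGroup B] [NormedSpace ℂ B] [CompleteSpace B]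

/-- The averaged Edgeworth expansion for a sequence whose characteristic functions are given by
powers of operators. -/
theorem admitsAveragedExpansion_of_expansionData (hS : ∀ N, Measurable (S N)) (hσ : 0 < σsq)
    (hr : 1 ≤ r) {A : ℝ} (D : ExpansionData (rvChar P S) r A σsq)
    {L : ℝ → B →L[ℂ] B} {v : B} {l : B →L[ℂ] ℂ}
    (hchar : ∀ N : ℕ, 1 ≤ N → ∀ t, rvChar P S N t = l ((L t ^ N) v)) (hL : Continuous L)
    (hA3 : CondA3 L) {r₁ : ℝ} (hA4 : CondA4 L r₁) (hqr : (r : ℝ) / (2 * r₁) < q) :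
    AdmitsAveragedExpansion P S A σsq r (spaceF q 0) (fun f => (normF q 0 f).toReal) := by
  have hσ' : (0 : ℝ) < σsq := hσ
  have hr₁ := hA4.1
  have hβ : 0 < (r : ℝ) / (2 * r₁) := by
    have : (0 : ℝ) < r := by exact_mod_cast hr
    positivity
  -- Automatic from q > r/(2r₁) > 0; it ensures that f' exists and is integrable, as smoothing
  -- requires.
  have hq : 1 ≤ q := by
    have : (0 : ℝ) < q := hβ.trans hqr
    exact_mod_cast this
  obtain ⟨Q, hQ, hnear⟩ := exists_edgeworthChar_approx hr hσ D (conj_rvChar P S)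
  have hφL : ∀ N : ℕ, 1 ≤ N → ∀ t, ‖rvChar P S N t‖ ≤ (‖l‖ * ‖v‖) * ‖L t ^ N‖ := by
    intro N hN t
    rw [hchar N hN]
    calc ‖l ((L t ^ N) v)‖ ≤ ‖l‖ * (‖L t ^ N‖ * ‖v‖) :=
          (l.le_opNorm _).trans (by gcongr; exact (L t ^ N).le_opNorm v)
      _ = _ := by ring
  have hexp : ∀ (N : ℕ) (t : ℝ), ‖Complex.exp (-(Complex.I * (N * A) * t))‖ = 1 := by
    intro N t
    rw [Complex.norm_exp]
    simp
  have hle : ∀ (N : ℕ) (t : ℝ), charError P S A σsq Q r N t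
      ≤ ‖rvChar P S N t‖ + ‖edgeworthChar σsq Q r N (√(N : ℝ) * t)‖ := by
    intro N t
    refine (norm_sub_le _ _).trans ?_
    rw [norm_mul, hexp, one_mul]
  have h0 : ∀ N t, 0 ≤ charError P S A σsq Q r N t := fun N t => norm_nonneg _
  have hmeas : ∀ N, 1 ≤ N → Measurable (charError P S A σsq Q r N) := by
    intro N hN
    have h1 : Continuous (rvChar P S N) := by
      rw [show rvChar P S N = fun t => l ((L t ^ N) v) from funext (hchar N hN)]
      fun_prop
    have h2 := continuous_edgeworthChar σsq Q r N
    unfold charError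
    exact Continuous.measurable (by fun_prop)
  have hbdd : ∀ N, 1 ≤ N → ∃ M, ∀ t, charError P S A σsq Q r N t ≤ M := by
    intro N hN
    obtain ⟨K, hK, h⟩ := exists_norm_edgeworthChar_le hσ Q r
    refine ⟨1 + K, fun t => (hle N t).trans (add_le_add (norm_rvChar_le_one P S N t)
      ((h N hN _).trans (mul_le_of_le_one_right hK.le ?_)))⟩
    rw [Real.exp_le_one_iff, neg_nonpos]
    positivity
  refine admitsAveragedExpansion_of_charError hS hσ hq hQ (fun N hN =>
    integrable_weightedError h0 hmeas hr (by positivity) D.C_pos.le D.κ_pos hq hnear hbdd hN)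
    (isLittleO_integral_weightedError h0 hmeas hr (by positivity) D.C_pos.le D.κ_pos D.κ_lt hq
      hβ.le hqr hnear hbdd (fun δ hδ => ?_) fun t ht => ?_)
  · obtain ⟨K, hK⟩ := exists_bound_of_le_abs hL hA3 hA4 (norm_rvChar_le_one P S) hφL r hδ
    obtain ⟨K', hK', h'⟩ := exists_sqrt_pow_mul_norm_edgeworthChar_le hσ Q r hδ
    refine ⟨K + K', ?_⟩
    filter_upwards [hK, eventually_ge_atTop 1] with N hN hN1 t ht
    have h1 := hN t ht
    have h2 := h' N hN1 t ht
    have h3 : Real.exp (-(σsq / 8 * (N * t ^ 2))) ≤ 1 + |t| ^ ((r : ℝ) / (2 * r₁)) := by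
      have h4 : Real.exp (-(σsq / 8 * (N * t ^ 2))) ≤ 1 := by
        rw [Real.exp_le_one_iff, neg_nonpos]
        positivity
      have h5 : 0 ≤ |t| ^ ((r : ℝ) / (2 * r₁)) := by positivity
      linarith
    calc √(N : ℝ) ^ r * charError P S A σsq Q r N t
        ≤ √(N : ℝ) ^ r * (‖rvChar P S N t‖ + ‖edgeworthChar σsq Q r N (√(N : ℝ) * t)‖) := by
          gcongr
          exact hle N t
      _ = √(N : ℝ) ^ r * ‖rvChar P S N t‖
          + √(N : ℝ) ^ r * ‖edgeworthChar σsq Q r N (√(N : ℝ) * t)‖ := mul_add _ _ _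
      _ ≤ K * (1 + |t| ^ ((r : ℝ) / (2 * r₁))) + K' * (1 + |t| ^ ((r : ℝ) / (2 * r₁))) :=
          add_le_add h1 (h2.trans (by gcongr))
      _ = _ := by ring
  · have ht0 : 0 < |t| := abs_pos.mpr ht
    obtain ⟨K', hK', h'⟩ := exists_sqrt_pow_mul_norm_edgeworthChar_le hσ Q r ht0
    have h1 := tendsto_sqrt_pow_mul_norm hL hA3 hφL r ht
    have h2 : Tendsto (fun N : ℕ => K' * Real.exp (-(σsq / 8 * (N * t ^ 2)))) atTop (𝓝 0) := by
      have h3 : Tendsto (fun N : ℕ => (σsq : ℝ) / 8 * t ^ 2 * (N : ℝ)) atTop atTop :=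
        tendsto_natCast_atTop_atTop.const_mul_atTop (by positivity)
      have h4 := (Real.tendsto_exp_neg_atTop_nhds_zero.comp h3).const_mul K'
      rw [mul_zero] at h4
      refine h4.congr fun N => ?_
      simp only [Function.comp_apply]
      ring_nf
    have h5 := h1.add h2
    rw [add_zero] at h5
    refine squeeze_zero' (Eventually.of_forall fun N => mul_nonneg (by positivity) (h0 N t)) ?_ h5
    filter_upwards [eventually_ge_atTop 1] with N hN
    calc √(N : ℝ) ^ r * charError P S A σsq Q r N t
        ≤ √(N : ℝ) ^ r * (‖rvChar P S N t‖ + ‖edgeworthChar σsq Q r N (√(N : ℝ) * t)‖) := by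
          gcongr
          exact hle N t
      _ = √(N : ℝ) ^ r * ‖rvChar P S N t‖
          + √(N : ℝ) ^ r * ‖edgeworthChar σsq Q r N (√(N : ℝ) * t)‖ := mul_add _ _ _
      _ ≤ _ := add_le_add le_rfl (h' N hN t le_rfl)

end Expansion
end AvgEdgeworth

/-! ### Conclusion: the operator hypotheses supply the expansion data. -/

theorem mainTheorem7
    {Ω : Type*} [MeasurableSpace Ω] (P : Measure Ω) [IsProbabilityMeasure P]
    (X : ℕ → Ω → ℝ) (hX : ∀ n, Measurable (X n))
    {B : Type*} [NormedAddCommGroup B] [NormedSpace ℂ B] [CompleteSpace B]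
    (L : ℝ → B →L[ℂ] B) (v : B) (l : B →L[ℂ] ℂ)
    (hchar : ∀ N : ℕ, 1 ≤ N → ∀ t : ℝ,
      ∫ ω, Complex.exp (Complex.I * (t : ℂ) * (AvgEdgeworth.partialSum X N ω : ℂ)) ∂P
        = l ((L t ^ N) v))
    (r : ℕ) (hr : 1 ≤ r) (r₁ : ℝ)
    (hA1 : AvgEdgeworth.CondA1 L (r + 2))
    (hA2 : AvgEdgeworth.CondA2 (L 0))
    (hA3 : AvgEdgeworth.CondA3 L)
    (hA4 : AvgEdgeworth.CondA4 L r₁)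
    (q : ℕ) (hq : (r : ℝ) / (2 * r₁) < (q : ℝ)) :
    ∃ (A : ℝ) (σsq : ℝ≥0),
      TendstoInDistribution
        (fun N : ℕ => AvgEdgeworth.normalized (AvgEdgeworth.partialSum X) A N) atTop
        (id : ℝ → ℝ) (fun _ => P) (gaussianReal 0 σsq) ∧
      (0 < σsq →
        AvgEdgeworth.AdmitsAveragedExpansion P (AvgEdgeworth.partialSum X) A σsq r
          (AvgEdgeworth.spaceF q 0) (fun f => (AvgEdgeworth.normF q 0 f).toReal)) := by
  have hS : ∀ N, Measurable (AvgEdgeworth.partialSum X N) := fun N =>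
    Finset.measurable_sum _ fun n _ => hX n
  obtain ⟨hL, δ, hδ, hLs⟩ := hA1
  have hL0 : ContDiffAt ℝ (r + 2 : ℕ) L 0 :=
    hLs.contDiffAt (Icc_mem_nhds (by linarith) hδ)
  obtain ⟨lam, Z, R, C, κ, hlam, hlam0, hZ, hC, hκ0, hκ1, hdec⟩ :=
    AvgEdgeworth.exists_scalar_decomposition (by omega) hL0 hA2 v l
  obtain ⟨A, σsq, ⟨D⟩, hlim⟩ := AvgEdgeworth.exists_expansionData hr
    (AvgEdgeworth.norm_rvChar_le_one P (AvgEdgeworth.partialSum X))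
    (AvgEdgeworth.rvChar_zero P (AvgEdgeworth.partialSum X))
    (AvgEdgeworth.conj_rvChar P (AvgEdgeworth.partialSum X)) hlam hlam0 hZ hC hκ0 hκ1 (by
      filter_upwards [hdec] with t ht N hN
      rw [← (ht N hN).1]
      exact ⟨hchar N hN t, (ht N hN).2⟩)
  exact ⟨A, σsq, AvgEdgeworth.tendstoInDistribution_normalized hS hlim, fun hσ =>
    AvgEdgeworth.admitsAveragedExpansion_of_expansionData hS hσ hr D hchar hL hA3 hA4 hq⟩
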